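/- Let $n\ge 2$, $\gamma<2$, $r_0>0$, and let $g:(0,\infty)\to(0,\infty)$ be continuous with $$\liminf_{s\searrow 0}\, s^{-(n+1-\gamma)/(n-1)}\,g(s)>0\qquad\text{and}\qquad \liminf_{s\to\infty}\, s^{1-\gamma}\,g(s)>0$$ (each lower limit may be $+\infty$). Let $\Omega=\{x\in\mathbb{R}^n: x_n>0,\ |x|>r_0\}$. Then the equation $$-\Delta u=|x|^{-\gamma}g(u)\quad\text{in }\Omega$$ has no positive supersolution, whether classical, weak or viscosity. That is, there is no function $u:\Omega\to\mathbb{R}$ of any of the following three kinds: 1. (classical) $u\in C^2(\Omega)$, $u>0$ in $\Omega$, and $-\Delta u(x)\ge |x|^{-\gamma}g(u(x))$ for all $x\in\Omega$; 2. (weak) $u\in W^{1,2}_{\mathrm{loc}}(\Omega)$, $u>0$ almost everywhere in $\Omega$, and $$\int_\Omega Du\cdot D\varphi\,dx\ \ge\ \int_\Omega |x|^{-\gamma}g(u)\,\varphi\,dx$$ for every nonnegative $\varphi\in C_0^\infty(\Omega)$ (in particular the right-hand integral is finite); 3. (viscosity) $u$ is real-valued and lower semicontinuous, $u>0$ in $\Omega$,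 and whenever $x_0\in\Omega$, $\varphi\in C^2(\Omega)$ and $u-\varphi$ has a local minimum at $x_0$, one has $-\Delta\varphi(x_0)\ge |x_0|^{-\gamma}g(u(x_0))$. -/

import Mathlib

open Set Filter Topology MeasureTheory
open scoped ContDiff

/-- The open half space `{x ∈ ℝⁿ : xₙ > 0}`, where `xₙ` is the last coordinate. -/
def upperHalfSpace (n : ℕ) : Set (EuclideanSpace ℝ (Fin n)) :=
  {x | ∃ i : Fin n, (i : ℕ) + 1 = n ∧ 0 < x i}

/-- Real-valued `C^∞` functions with compact support contained in `Ω`. -/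
structure IsTestFunctionOn {n : ℕ} (Ω : Set (EuclideanSpace ℝ (Fin n)))
    (φ : EuclideanSpace ℝ (Fin n) → ℝ) : Prop where
  contDiff : ContDiff ℝ ∞ φ
  hasCompactSupport : HasCompactSupport φ
  tsupport_subset : tsupport φ ⊆ Ω

/-- `V` is the weak gradient of `u` in `Ω`: `∫_Ω u ∂ᵢφ = -∫_Ω Vᵢ φ` for all test functions `φ`
and all `i`. It is used below only for locally integrable `u` and `V`. -/
def IsWeakGradientOn {n : ℕ} (Ω : Set (EuclideanSpace ℝ (Fin n)))
    (u : EuclideanSpace ℝ (Fin n) → ℝ)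
    (V : EuclideanSpace ℝ (Fin n) → EuclideanSpace ℝ (Fin n)) : Prop :=
  ∀ φ : EuclideanSpace ℝ (Fin n) → ℝ, IsTestFunctionOn Ω φ → ∀ i : Fin n,
    ∫ x in Ω, u x * fderiv ℝ φ x (EuclideanSpace.single i 1) = -∫ x in Ω, V x i * φ x

/-- `u ∈ W^{1,2}_loc(Ω)` with weak gradient `V`. -/
structure IsW12LocWithGradient {n : ℕ} (Ω : Set (EuclideanSpace ℝ (Fin n)))
    (u : EuclideanSpace ℝ (Fin n) → ℝ)
    (V : EuclideanSpace ℝ (Fin n) → EuclideanSpace ℝ (Fin n)) : Prop where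
  memLp : ∀ K : Set (EuclideanSpace ℝ (Fin n)), IsCompact K → K ⊆ Ω →
    MemLp u 2 (volume.restrict K)
  memLp_gradient : ∀ K : Set (EuclideanSpace ℝ (Fin n)), IsCompact K → K ⊆ Ω →
    MemLp V 2 (volume.restrict K)
  isWeakGradient : IsWeakGradientOn Ω u V

/-- Classical supersolution of `-Δu = f(u, x)` in the open set `Ω`. -/
structure IsClassicalSupersolution {n : ℕ} (Ω : Set (EuclideanSpace ℝ (Fin n)))
    (f : ℝ → EuclideanSpace ℝ (Fin n) → ℝ) (u : EuclideanSpace ℝ (Fin n) → ℝ) : Prop where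
  contDiffOn : ContDiffOn ℝ 2 u Ω
  le_neg_laplacian : ∀ x ∈ Ω, f (u x) x ≤ -(Laplacian.laplacian u x)

/-- Weak (Sobolev) supersolution of `-Δu = f(u, x)` in the open set `Ω`: `u ∈ W^{1,2}_loc(Ω)` and
`∫_Ω Du · Dφ ≥ ∫_Ω f(u, x) φ` for every nonnegative test function `φ`. For `f ≥ 0` the right-hand
side is an integral in `[0, ∞]`, and the inequality forces it to be finite; this is the
integrability clause. -/
def IsWeakSupersolution {n : ℕ} (Ω : Set (EuclideanSpace ℝ (Fin n)))
    (f : ℝ → EuclideanSpace ℝ (Fin n) → ℝ) (u : EuclideanSpace ℝ (Fin n) → ℝ) : Prop :=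
  ∃ V : EuclideanSpace ℝ (Fin n) → EuclideanSpace ℝ (Fin n),
    IsW12LocWithGradient Ω u V ∧
    ∀ φ : EuclideanSpace ℝ (Fin n) → ℝ, IsTestFunctionOn Ω φ → (∀ x, 0 ≤ φ x) →
      IntegrableOn (fun x => f (u x) x * φ x) Ω ∧
      ∫ x in Ω, f (u x) x * φ x ≤ ∫ x in Ω, inner ℝ (V x) (gradient φ x)

/-- Viscosity supersolution of `-Δu = f(u, x)` in the open set `Ω`: a lower semicontinuous `u` such
that `-Δφ(x₀) ≥ f(u(x₀), x₀)` whenever `φ ∈ C²(Ω)` and `u - φ` has a local minimum at `x₀ ∈ Ω`. -/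
structure IsViscositySupersolution {n : ℕ} (Ω : Set (EuclideanSpace ℝ (Fin n)))
    (f : ℝ → EuclideanSpace ℝ (Fin n) → ℝ) (u : EuclideanSpace ℝ (Fin n) → ℝ) : Prop where
  lowerSemicontinuousOn : LowerSemicontinuousOn u Ω
  le_neg_laplacian : ∀ x₀ ∈ Ω, ∀ φ : EuclideanSpace ℝ (Fin n) → ℝ, ContDiffOn ℝ 2 φ Ω →
    IsLocalMin (fun x => u x - φ x) x₀ → f (u x₀) x₀ ≤ -(Laplacian.laplacian φ x₀)

/-! Both exponents are critical, and at each end a logarithm breaks the balance. The source is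
positive, so comparison with the harmonic function `x_l |x|⁻ⁿ` gives `u ≥ a x_l |x|⁻ⁿ`. Inside a
cone `x_l ≥ θ|x|` this means `u ≥ c |x|^(1-n)`, and the growth of `g` at zero then makes the source
at least of order `|x|^(-n-1)`. That is the order of `-Δ(x_l |x|⁻ⁿ log |x|)`, so the bound gains a
logarithm (`IsComparisonSupersolution.exists_log_le`).

With this gain, `|x|²` times the source is larger than any prescribed multiple of `u`, far out in
cones, as long as `u` is below a small multiple of `|x|`. A bump of radius comparable to `|x|`
placed below `u` can then be doubled repeatedly, so `u ≥ η|x|` in cones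
(`IsComparisonSupersolution.exists_linear_le`).

At linear size the growth of `g` at infinity makes the source of order `1/|x|`, the order of `-Δ(x_l
log (L/|x|))`. Barriers `ε x_l log (L/|x|)`, corrected by lower-order terms, with `ε log (L/R) = M`
fixed, push `u` above a multiple of `M` on one fixed region
(`IsComparisonSupersolution.le_of_linear_le`). Since `M` is arbitrary, this is absurd.

The argument uses only positivity, local positive lower bounds and the comparison principle
`ComparisonOn`. Its strict inequality is required only where `u < φ`, which bounds `u` from above
there; hence `g` need not be monotone. A filter stands for "everywhere" or "almost everywhere", so
one proof serves all notions of supersolution. Classical solutions are viscosity solutions, and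
these satisfy comparison by touching at a minimum. For weak solutions, comparison comes from
mollification and the concave truncation `(min w 0)³`, and the lower bounds from a weighted
mean-value inequality. -/

/-! ### The Laplacian in coordinates and of explicit functions. -/

abbrev Eucl (n : ℕ) := EuclideanSpace ℝ (Fin n)

/-- The Laplacian as the sum of the pure second partial derivatives. -/
theorem laplacian_eq_sum_fderiv {n : ℕ} {φ : Eucl n → ℝ} {x : Eucl n} (h : ContDiffAt ℝ 2 φ x) :
    Laplacian.laplacian φ x = ∑ i : Fin n,
      fderiv ℝ (fun y => fderiv ℝ φ y (EuclideanSpace.single i 1)) x (EuclideanSpace.single i 1) := by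
  rw [InnerProductSpace.laplacian_eq_iteratedFDeriv_orthonormalBasis φ
    (EuclideanSpace.basisFun (Fin n) ℝ)]
  refine Finset.sum_congr rfl fun i _ => ?_
  have hd : DifferentiableAt ℝ (fderiv ℝ φ) x :=
    (h.fderiv_right (m := 1) (by norm_num)).differentiableAt (by norm_num)
  rw [iteratedFDeriv_two_apply, fderiv_clm_apply hd (differentiableAt_const _)]
  simp

/-- Reduces a Laplacian to one-variable derivatives along the coordinate lines through `x`, so that
explicit functions need no second Fréchet derivative. -/
theorem laplacian_eq_sum_of_hasDerivAt {n : ℕ} {φ : Eucl n → ℝ} {x : Eucl n}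
    (h : ContDiffAt ℝ 2 φ x) {p : Fin n → ℝ → ℝ} {q : Fin n → ℝ}
    (hp : ∀ i, ∀ᶠ t in 𝓝 (0 : ℝ),
      HasDerivAt (fun s : ℝ => φ (x + s • EuclideanSpace.single i 1)) (p i t) t)
    (hq : ∀ i, HasDerivAt (p i) (q i) 0) :
    Laplacian.laplacian φ x = ∑ i, q i := by
  rw [laplacian_eq_sum_fderiv h]
  refine Finset.sum_congr rfl fun i _ => ?_
  set e : Eucl n := EuclideanSpace.single i 1
  have hline : ∀ t : ℝ, HasDerivAt (fun s : ℝ => x + s • e) e t := fun t => by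
    simpa using ((hasDerivAt_id t).smul_const e).const_add x
  have htend : Tendsto (fun s : ℝ => x + s • e) (𝓝 0) (𝓝 x) := by
    have := (hline 0).continuousAt.tendsto
    simpa using this
  have h1 : ∀ᶠ y in 𝓝 x, DifferentiableAt ℝ φ y :=
    (h.eventually (by simp)).mono fun y hy => hy.differentiableAt (by norm_num)
  have h2 : (fun t : ℝ => fderiv ℝ φ (x + t • e) e) =ᶠ[𝓝 0] p i := by
    filter_upwards [htend.eventually h1, hp i] with t ht1 ht2
    exact (ht1.hasFDerivAt.comp_hasDerivAt t (hline t)).unique ht2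
  have h3 : HasDerivAt (fun t : ℝ => fderiv ℝ φ (x + t • e) e) (q i) 0 :=
    (hq i).congr_of_eventuallyEq h2
  have hd : DifferentiableAt ℝ (fun y => fderiv ℝ φ y e) x :=
    ((h.fderiv_right (m := 1) (by norm_num)).differentiableAt (by norm_num)).clm_apply
      (differentiableAt_const _)
  have hd' : HasFDerivAt (fun y => fderiv ℝ φ y e) (fderiv ℝ (fun y => fderiv ℝ φ y e) x)
      (x + (0 : ℝ) • e) := by simpa using hd.hasFDerivAt
  have h4 := hd'.comp_hasDerivAt (0 : ℝ) (hline 0)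
  exact h4.unique h3

theorem norm_add_smul_single_sq {n : ℕ} (x : Eucl n) (i : Fin n) (t : ℝ) :
    ‖x + t • EuclideanSpace.single i (1 : ℝ)‖ ^ 2 = ‖x‖ ^ 2 + 2 * t * x i + t ^ 2 := by
  rw [norm_add_sq_real, inner_smul_right, EuclideanSpace.inner_single_right, norm_smul]
  simp
  ring

/-- The Laplacian of `A(x_l) B(|x|²)`. -/
theorem laplacian_mul_normSq {n : ℕ} (l : Fin n) {A A₁ A₂ B B₁ : ℝ → ℝ} {B₂ : ℝ} {x : Eucl n}
    (h : ContDiffAt ℝ 2 (fun y : Eucl n => A (y l) * B (‖y‖ ^ 2)) x)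
    (hA : ∀ s, HasDerivAt A (A₁ s) s) (hA₁ : ∀ s, HasDerivAt A₁ (A₂ s) s)
    (hB : ∀ᶠ s in 𝓝 (‖x‖ ^ 2), HasDerivAt B (B₁ s) s) (hB₁ : HasDerivAt B₁ B₂ (‖x‖ ^ 2)) :
    Laplacian.laplacian (fun y : Eucl n => A (y l) * B (‖y‖ ^ 2)) x =
      A₂ (x l) * B (‖x‖ ^ 2) + 4 * A₁ (x l) * B₁ (‖x‖ ^ 2) * x l +
        A (x l) * (4 * ‖x‖ ^ 2 * B₂ + 2 * n * B₁ (‖x‖ ^ 2)) := by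
  classical
  set d : Fin n → ℝ := fun i => if i = l then 1 else 0
  set Q : Fin n → ℝ → ℝ := fun i t => ‖x‖ ^ 2 + 2 * t * x i + t ^ 2
  have hQ : ∀ i t, HasDerivAt (Q i) (2 * x i + 2 * t) t := fun i t => by
    have := ((((hasDerivAt_id t).const_mul 2).mul_const (x i)).const_add (‖x‖ ^ 2)).add
      ((hasDerivAt_id t).pow 2)
    exact this.congr_deriv (by simp)
  have hQ0 : ∀ i, Q i 0 = ‖x‖ ^ 2 := fun i => by simp [Q]
  have hl : ∀ i t, HasDerivAt (fun t => x l + t * d i) (d i) t := fun i t => by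
    simpa using ((hasDerivAt_id t).mul_const (d i)).const_add (x l)
  have hlB : ∀ i, ∀ᶠ t in 𝓝 (0 : ℝ), HasDerivAt B (B₁ (Q i t)) (Q i t) := fun i => by
    have : Tendsto (Q i) (𝓝 0) (𝓝 (‖x‖ ^ 2)) := by
      have := (hQ i 0).continuousAt.tendsto
      rwa [hQ0] at this
    exact this.eventually hB
  have key := laplacian_eq_sum_of_hasDerivAt h
    (p := fun i t => A₁ (x l + t * d i) * d i * B (Q i t) +
      A (x l + t * d i) * (B₁ (Q i t) * (2 * x i + 2 * t)))
    (q := fun i => A₂ (x l) * d i * d i * B (‖x‖ ^ 2) +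
      A₁ (x l) * d i * (B₁ (‖x‖ ^ 2) * (2 * x i)) +
      (A₁ (x l) * d i * (B₁ (‖x‖ ^ 2) * (2 * x i)) +
       A (x l) * (B₂ * (2 * x i) * (2 * x i) + B₁ (‖x‖ ^ 2) * 2)))
    (fun i => ?_) (fun i => ?_)
  · rw [key]
    have e1 : ∑ i, d i = 1 := by simp [d]
    have e2 : ∑ i, d i * x i = x l := by simp [d]
    have e3 : ∑ i, d i * d i = 1 := by simp [d]
    have e4 : ∑ i, x i ^ 2 = ‖x‖ ^ 2 := by simp [EuclideanSpace.norm_sq_eq]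
    calc _ = ∑ i, (A₂ (x l) * B (‖x‖ ^ 2) * (d i * d i) +
            4 * A₁ (x l) * B₁ (‖x‖ ^ 2) * (d i * x i) +
            (4 * A (x l) * B₂) * (x i ^ 2) + 2 * A (x l) * B₁ (‖x‖ ^ 2)) :=
          Finset.sum_congr rfl fun i _ => by ring
      _ = _ := by
          simp only [Finset.sum_add_distrib, ← Finset.mul_sum, e2, e3, e4]
          simp
          ring
  · filter_upwards [hlB i] with t ht
    have h1 := ((hA _).comp t (hl i t)).mul (ht.comp t (hQ i t))
    have h2 : (fun s : ℝ => A ((x + s • EuclideanSpace.single i 1 : Eucl n) l) *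
        B (‖(x + s • EuclideanSpace.single i 1 : Eucl n)‖ ^ 2)) =
        (A ∘ fun t => x l + t * d i) * (B ∘ Q i) := by
      funext s
      simp only [norm_add_smul_single_sq, Pi.mul_apply, Function.comp_apply, Q, d]
      simp [eq_comm]
    rw [h2]
    exact h1
  · have hB0 : HasDerivAt B (B₁ (Q i 0)) (Q i 0) := (hlB i).self_of_nhds
    have hB10 : HasDerivAt B₁ B₂ (Q i 0) := by rwa [hQ0]
    have h1 := (((hA₁ _).comp (0 : ℝ) (hl i 0)).mul_const (d i)).mul (hB0.comp (0 : ℝ) (hQ i 0))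
    have h2 := ((hB10.comp (0 : ℝ) (hQ i 0)).mul
      (((hasDerivAt_id (0 : ℝ)).const_mul 2).const_add (2 * x i)))
    have h3 := h1.add (((hA _).comp (0 : ℝ) (hl i 0)).mul h2)
    exact h3.congr_deriv (by simp [hQ0])

/-- At a local minimum of a `C²` function the Laplacian is nonnegative. -/
theorem IsLocalMin.laplacian_nonneg {n : ℕ} {w : Eucl n → ℝ} {x : Eucl n} (hmin : IsLocalMin w x)
    (h : ContDiffAt ℝ 2 w x) : 0 ≤ Laplacian.laplacian w x := by
  rw [laplacian_eq_sum_fderiv h]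
  refine Finset.sum_nonneg fun i _ => ?_
  set e : Eucl n := EuclideanSpace.single i 1
  have hline : ∀ t : ℝ, HasDerivAt (fun s : ℝ => x + s • e) e t := fun t => by
    simpa using ((hasDerivAt_id t).smul_const e).const_add x
  have htend : Tendsto (fun s : ℝ => x + s • e) (𝓝 0) (𝓝 x) := by
    have := (hline 0).continuousAt.tendsto
    simpa using this
  have h1 : ∀ᶠ y in 𝓝 x, DifferentiableAt ℝ w y :=
    (h.eventually (by simp)).mono fun y hy => hy.differentiableAt (by norm_num)
  set f : ℝ → ℝ := fun t => w (x + t • e)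
  have h2 : (deriv f) =ᶠ[𝓝 0] fun t : ℝ => fderiv ℝ w (x + t • e) e := by
    filter_upwards [htend.eventually h1] with t ht1
    exact (ht1.hasFDerivAt.comp_hasDerivAt t (hline t)).deriv
  have hd : DifferentiableAt ℝ (fun y => fderiv ℝ w y e) x :=
    ((h.fderiv_right (m := 1) (by norm_num)).differentiableAt (by norm_num)).clm_apply
      (differentiableAt_const _)
  have hd' : HasFDerivAt (fun y => fderiv ℝ w y e) (fderiv ℝ (fun y => fderiv ℝ w y e) x)
      (x + (0 : ℝ) • e) := by simpa using hd.hasFDerivAt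
  have h3 : deriv (deriv f) 0 = fderiv ℝ (fun y => fderiv ℝ w y e) x e :=
    ((hd'.comp_hasDerivAt (0 : ℝ) (hline 0)).congr_of_eventuallyEq h2).deriv
  rw [← h3]
  by_contra! hneg
  have hfmin : IsLocalMin f 0 := by
    have : IsLocalMin w (x + (0 : ℝ) • e) := by simpa using hmin
    exact this.comp_continuous (g := fun s : ℝ => x + s • e) (hline 0).continuousAt
  have hcont : ContinuousAt f 0 := by
    have : ContinuousAt w (x + (0 : ℝ) • e) := by simpa using h.continuousAt
    exact this.comp (f := fun s : ℝ => x + s • e) (hline 0).continuousAt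
  -- A negative second derivative makes the minimum also a maximum. The function is then constant
  -- near 0, which forces the second derivative to vanish.
  have hfmax := isLocalMax_of_deriv_deriv_neg hneg hfmin.deriv_eq_zero hcont
  have hconst : f =ᶠ[𝓝 0] fun _ => f 0 := by
    filter_upwards [hfmin, hfmax] with t h1 h2 using le_antisymm h2 h1
  have : deriv (deriv f) 0 = 0 := by
    rw [hconst.deriv.deriv_eq]; simp
  linarith

theorem laplacian_sub_const {n : ℕ} {φ : Eucl n → ℝ} {x : Eucl n} (h : ContDiffAt ℝ 2 φ x) (c : ℝ) :
    Laplacian.laplacian (fun y => φ y - c) x = Laplacian.laplacian φ x := by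
  rw [laplacian_eq_sum_fderiv h, laplacian_eq_sum_fderiv (h.sub contDiffAt_const)]
  simp only [fderiv_sub_const]

theorem laplacian_comp_sub {n : ℕ} (φ : Eucl n → ℝ) (p x : Eucl n) :
    Laplacian.laplacian (fun y => φ (y - p)) x = Laplacian.laplacian φ (x - p) := by
  simp only [InnerProductSpace.laplacian_eq_iteratedFDeriv_stdOrthonormalBasis,
    iteratedFDeriv_comp_sub]

theorem laplacian_const_mul {n : ℕ} {φ : Eucl n → ℝ} {x : Eucl n} (c : ℝ)
    (h : ContDiffAt ℝ 2 φ x) :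
    Laplacian.laplacian (fun y => c * φ y) x = c * Laplacian.laplacian φ x :=
  InnerProductSpace.laplacian_smul c h

theorem laplacian_fun_add {n : ℕ} {φ ψ : Eucl n → ℝ} {x : Eucl n} (hφ : ContDiffAt ℝ 2 φ x)
    (hψ : ContDiffAt ℝ 2 ψ x) :
    Laplacian.laplacian (fun y => φ y + ψ y) x =
      Laplacian.laplacian φ x + Laplacian.laplacian ψ x :=
  hφ.laplacian_add hψ

theorem contDiff_coord {n : ℕ} (l : Fin n) {k : WithTop ℕ∞} :
    ContDiff ℝ k (fun y : Eucl n => y l) :=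
  (EuclideanSpace.proj l : Eucl n →L[ℝ] ℝ).contDiff

theorem contDiffAt_normSq_rpow_mul {n : ℕ} {x : Eucl n} (hx : x ≠ 0) (k α β : ℝ) :
    ContDiffAt ℝ 2 (fun y : Eucl n => (‖y‖ ^ 2) ^ k * (α + β * Real.log (‖y‖ ^ 2))) x := by
  have hq : ‖x‖ ^ 2 ≠ 0 := by simpa using hx
  have h0 : ContDiffAt ℝ 2 (fun y : Eucl n => ‖y‖ ^ 2) x := (contDiff_norm_sq ℝ).contDiffAt
  exact (h0.rpow_const_of_ne hq).mul (contDiffAt_const.add (contDiffAt_const.mul (h0.log hq)))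

/-- The family `s ^ k * (α + β log s)` is closed under differentiation. Every radial factor of the
two barriers belongs to it, with `s = |y|²`. -/
theorem hasDerivAt_rpow_mul_log {s : ℝ} (hs : 0 < s) (k α β : ℝ) :
    HasDerivAt (fun s : ℝ => s ^ k * (α + β * Real.log s))
      (s ^ (k - 1) * ((k * α + β) + k * β * Real.log s)) s := by
  have h1 := (Real.hasDerivAt_rpow_const (p := k) (Or.inl hs.ne')).mul
    (((Real.hasDerivAt_log hs.ne').const_mul β).const_add α)
  refine h1.congr_deriv ?_
  rw [Real.rpow_sub_one hs.ne']
  field_simp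
  ring

theorem laplacian_pow_mul_rpow_log {n : ℕ} (l : Fin n) (j : ℕ) {x : Eucl n} (hx : x ≠ 0)
    (k α β : ℝ) :
    Laplacian.laplacian (fun y : Eucl n =>
      y l ^ j * ((‖y‖ ^ 2) ^ k * (α + β * Real.log (‖y‖ ^ 2)))) x =
      j * ((j - 1 : ℕ) * x l ^ (j - 1 - 1)) * ((‖x‖ ^ 2) ^ k * (α + β * Real.log (‖x‖ ^ 2))) +
      4 * (j * x l ^ (j - 1)) *
        ((‖x‖ ^ 2) ^ (k - 1) * ((k * α + β) + k * β * Real.log (‖x‖ ^ 2))) * x l +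
      x l ^ j * (4 * ‖x‖ ^ 2 * ((‖x‖ ^ 2) ^ (k - 1 - 1) * (((k - 1) * (k * α + β) + k * β) +
        (k - 1) * (k * β) * Real.log (‖x‖ ^ 2))) + 2 * n *
        ((‖x‖ ^ 2) ^ (k - 1) * ((k * α + β) + k * β * Real.log (‖x‖ ^ 2)))) := by
  have hq : 0 < ‖x‖ ^ 2 := by positivity
  refine laplacian_mul_normSq (n := n) l (A := fun s => s ^ j) (A₁ := fun s => j * s ^ (j - 1))
    (A₂ := fun s => j * ((j - 1 : ℕ) * s ^ (j - 1 - 1)))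
    (B := fun s => s ^ k * (α + β * Real.log s))
    (B₁ := fun s => s ^ (k - 1) * ((k * α + β) + k * β * Real.log s)) ?_ ?_ ?_ ?_ ?_
  · exact ((contDiff_coord l).contDiffAt.pow j).mul (contDiffAt_normSq_rpow_mul hx k α β)
  · exact fun s => hasDerivAt_pow j s
  · exact fun s => (hasDerivAt_pow (j - 1) s).const_mul _
  · filter_upwards [lt_mem_nhds hq] with s hs using hasDerivAt_rpow_mul_log hs k α β
  · exact hasDerivAt_rpow_mul_log hq (k - 1) _ _

theorem laplacian_coord_mul_rpow_log {n : ℕ} (l : Fin n) {x : Eucl n} (hx : x ≠ 0)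
    (k α β : ℝ) :
    Laplacian.laplacian (fun y : Eucl n =>
      y l * ((‖y‖ ^ 2) ^ k * (α + β * Real.log (‖y‖ ^ 2)))) x =
      x l * (‖x‖ ^ 2) ^ (k - 1) * ((2 * n + 4 * k) * ((k * α + β) +
        k * β * Real.log (‖x‖ ^ 2)) + 4 * k * β) := by
  have hq : 0 < ‖x‖ ^ 2 := by positivity
  have := laplacian_pow_mul_rpow_log l 1 hx k α β
  simp only [pow_one] at this
  rw [this, Real.rpow_sub_one hq.ne' (k - 1)]
  field_simp
  simp
  ring

theorem laplacian_coord_sq_mul_rpow {n : ℕ} (l : Fin n) {x : Eucl n} (hx : x ≠ 0) (k : ℝ) :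
    Laplacian.laplacian (fun y : Eucl n => y l ^ 2 * (‖y‖ ^ 2) ^ k) x =
      2 * (‖x‖ ^ 2) ^ k + 2 * k * (2 + 2 * k + n) * x l ^ 2 * (‖x‖ ^ 2) ^ (k - 1) := by
  have hq : 0 < ‖x‖ ^ 2 := by positivity
  have := laplacian_pow_mul_rpow_log l 2 hx k 1 0
  simp only [zero_mul, add_zero, mul_one, mul_zero] at this
  rw [this, Real.rpow_sub_one hq.ne' (k - 1)]
  field_simp
  simp
  ring

theorem laplacian_normSq_rpow {n : ℕ} (l : Fin n) {x : Eucl n} (hx : x ≠ 0) (k : ℝ) :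
    Laplacian.laplacian (fun y : Eucl n => (‖y‖ ^ 2) ^ k) x =
      2 * k * (2 * (k - 1) + n) * (‖x‖ ^ 2) ^ (k - 1) := by
  have hq : 0 < ‖x‖ ^ 2 := by positivity
  have := laplacian_pow_mul_rpow_log l 0 hx k 1 0
  simp only [zero_mul, add_zero, mul_one, mul_zero, pow_zero, one_mul] at this
  rw [this, Real.rpow_sub_one hq.ne' (k - 1)]
  field_simp
  simp
  ring

/-- The odd power makes the bump nonpositive outside its ball, so it needs no truncation. In the
ball, with `z = 1 - |x - p|²/ρ²`, it is subharmonic wherever `n z ≤ 4 (1 - z)`; the source has to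
compensate only where the bump keeps a fixed fraction of its height. -/
theorem laplacian_bump {n : ℕ} (l : Fin n) (p : Eucl n) {ρ : ℝ} (hρ : 0 < ρ) (x : Eucl n) :
    Laplacian.laplacian (fun y : Eucl n => ((1 - ‖y - p‖ ^ 2 / ρ ^ 2) ^ 3 : ℝ)) x =
      6 / ρ ^ 2 * (1 - ‖x - p‖ ^ 2 / ρ ^ 2) *
        (4 * (‖x - p‖ ^ 2 / ρ ^ 2) - n * (1 - ‖x - p‖ ^ 2 / ρ ^ 2)) := by
  rw [laplacian_comp_sub (fun y : Eucl n => (1 - ‖y‖ ^ 2 / ρ ^ 2) ^ 3) p x]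
  set z := x - p
  have h1 : ∀ s : ℝ, HasDerivAt (fun s : ℝ => 1 - s / ρ ^ 2) (-(1 / ρ ^ 2)) s := fun s =>
    ((hasDerivAt_id s).div_const _).const_sub 1
  have := laplacian_mul_normSq (n := n) l (x := z) (A := fun _ => 1) (A₁ := fun _ => 0)
    (A₂ := fun _ => 0) (B := fun s => (1 - s / ρ ^ 2) ^ 3)
    (B₁ := fun s => 3 * (1 - s / ρ ^ 2) ^ 2 * (-(1 / ρ ^ 2)))
    (B₂ := 3 * (2 * (1 - ‖z‖ ^ 2 / ρ ^ 2) * (-(1 / ρ ^ 2))) * (-(1 / ρ ^ 2))) ?_ ?_ ?_ ?_ ?_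
  · simp only [one_mul] at this
    rw [this]
    field_simp
    ring
  · exact contDiffAt_const.mul ((contDiffAt_const.sub
      ((contDiff_norm_sq ℝ).contDiffAt.div_const _)).pow 3)
  · exact fun s => hasDerivAt_const _ _
  · exact fun s => hasDerivAt_const _ _
  · exact Eventually.of_forall fun s => ((h1 s).pow 3).congr_deriv (by simp)
  · exact ((((h1 (‖z‖ ^ 2)).pow 2).const_mul 3).mul_const _).congr_deriv (by simp)

/-! ### Comparison in the shifted exterior half space. -/

/-- The part of the half space `{x_l > -1}` outside the closed ball of radius `R`. -/
def halfSpaceExterior {n : ℕ} (l : Fin n) (R : ℝ) : Set (Eucl n) := {y | -1 < y l ∧ R < ‖y‖}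

/-- The comparison principle for supersolutions of `-Δu = F(u, x)` in `D`, with "almost everywhere"
or "everywhere" encoded by the filter `ℱ`. -/
def ComparisonOn {n : ℕ} (ℱ : Filter (Eucl n)) (D : Set (Eucl n)) (F : ℝ → Eucl n → ℝ)
    (u : Eucl n → ℝ) : Prop :=
  ∀ (φ : Eucl n → ℝ) (K : Set (Eucl n)), ContDiffOn ℝ 2 φ D → IsCompact K → K ⊆ D →
    (∀ᶠ x in ℱ, x ∈ D → x ∉ K → φ x ≤ u x) →
    (∀ᶠ x in ℱ, x ∈ K → u x < φ x → -Laplacian.laplacian φ x < F (u x) x) →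
    ∀ᶠ x in ℱ, x ∈ D → φ x ≤ u x

/-- A positive function satisfying the comparison principle in exterior half-space domains. -/
structure IsComparisonSupersolution {n : ℕ} (ℱ : Filter (Eucl n)) (l : Fin n) (R₀ : ℝ)
    (F : ℝ → Eucl n → ℝ) (u : Eucl n → ℝ) : Prop where
  pos : ∀ᶠ x in ℱ, x ∈ halfSpaceExterior l R₀ → 0 < u x
  lower_bound : ∀ K : Set (Eucl n), IsCompact K → K ⊆ halfSpaceExterior l R₀ →
    ∃ c > 0, ∀ᶠ x in ℱ, x ∈ K → c ≤ u x
  comparison : ∀ R, R₀ ≤ R → ComparisonOn ℱ (halfSpaceExterior l R) F u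

theorem halfSpaceExterior_anti {n : ℕ} (l : Fin n) {R R' : ℝ} (h : R ≤ R') :
    halfSpaceExterior l R' ⊆ halfSpaceExterior l R := fun _ hx => ⟨hx.1, h.trans_lt hx.2⟩

theorem abs_coord_le_norm {n : ℕ} (l : Fin n) (x : Eucl n) : |x l| ≤ ‖x‖ := by
  simpa using PiLp.norm_apply_le x l

theorem continuous_coord {n : ℕ} (l : Fin n) : Continuous (fun y : Eucl n => y l) :=
  (contDiff_coord l (k := 0)).continuous

/-- The closed half annulus is compact. -/
theorem isCompact_halfAnnulus {n : ℕ} (l : Fin n) (R R' : ℝ) :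
    IsCompact {x : Eucl n | 0 ≤ x l ∧ R ≤ ‖x‖ ∧ ‖x‖ ≤ R'} := by
  refine Metric.isCompact_of_isClosed_isBounded ?_ ?_
  · exact (isClosed_le continuous_const (continuous_coord l)).inter
      ((isClosed_le continuous_const continuous_norm).inter
        (isClosed_le continuous_norm continuous_const))
  · refine (Metric.isBounded_closedBall (x := (0 : Eucl n)) (r := R')).subset fun x hx => ?_
    simpa using hx.2.2

/-- Comparison with a barrier vanishing at infinity. -/
theorem ComparisonOn.le_of_decay {n : ℕ} {ℱ : Filter (Eucl n)} [CountableInterFilter ℱ]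
    {l : Fin n} {R : ℝ} {F : ℝ → Eucl n → ℝ} {u φ : Eucl n → ℝ}
    (h : ComparisonOn ℱ (halfSpaceExterior l R) F u) (hR : 0 < R)
    (hpos : ∀ᶠ x in ℱ, x ∈ halfSpaceExterior l R → 0 < u x)
    (hφ : ContDiffOn ℝ 2 φ (halfSpaceExterior l R))
    (hneg : ∀ x ∈ halfSpaceExterior l R, x l < 0 → φ x ≤ 0)
    (hann : ∀ᶠ x in ℱ, 0 ≤ x l → R < ‖x‖ → ‖x‖ ≤ 2 * R → φ x ≤ u x)
    (hdecay : ∀ δ > 0, ∃ ρ, ∀ x ∈ halfSpaceExterior l R, 0 ≤ x l → ρ ≤ ‖x‖ → φ x ≤ δ)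
    (hcontact : ∀ᶠ x in ℱ, 0 ≤ x l → 2 * R ≤ ‖x‖ → u x < φ x →
      -Laplacian.laplacian φ x < F (u x) x) :
    ∀ᶠ x in ℱ, x ∈ halfSpaceExterior l R → φ x ≤ u x := by
  have hopen : IsOpen (halfSpaceExterior l R) :=
    (isOpen_lt continuous_const (continuous_coord l)).inter
      (isOpen_lt continuous_const continuous_norm)
  -- Lowering the barrier by a constant confines possible contact to a compact half annulus.
  -- Constants `1/(k+1)` are used because only countably many exceptional sets can be combined.
  have key : ∀ k : ℕ, ∀ᶠ x in ℱ, x ∈ halfSpaceExterior l R → φ x - 1 / ((k : ℝ) + 1) ≤ u x := by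
    intro k
    set δ : ℝ := 1 / ((k : ℝ) + 1)
    have hδ : 0 < δ := by positivity
    obtain ⟨ρ, hρ⟩ := hdecay δ hδ
    have hKD : {x : Eucl n | 0 ≤ x l ∧ 2 * R ≤ ‖x‖ ∧ ‖x‖ ≤ ρ} ⊆ halfSpaceExterior l R :=
      fun x hx => ⟨by linarith [hx.1], by linarith [hx.2.1]⟩
    refine h (fun x => φ x - δ) {x | 0 ≤ x l ∧ 2 * R ≤ ‖x‖ ∧ ‖x‖ ≤ ρ}
      (hφ.sub contDiffOn_const) (isCompact_halfAnnulus l _ _) hKD ?_ ?_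
    · filter_upwards [hpos, hann] with x hx1 hx2 hxD hxK
      have hu := hx1 hxD
      rcases lt_or_ge (x l) 0 with h0 | h0
      · linarith [hneg x hxD h0]
      rcases le_or_gt ‖x‖ (2 * R) with h1 | h1
      · linarith [hx2 h0 hxD.2 h1]
      · have : ρ ≤ ‖x‖ := by
          by_contra hlt
          exact hxK ⟨h0, h1.le, (not_le.1 hlt).le⟩
        linarith [hρ x hxD h0 this]
    · filter_upwards [hcontact] with x hx hxK hlt
      rw [laplacian_sub_const (hφ.contDiffAt (hopen.mem_nhds (hKD hxK)))]
      exact hx hxK.1 hxK.2.1 (by linarith)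
  filter_upwards [eventually_countable_forall.2 key] with x hx hxD
  refine le_of_forall_pos_le_add fun δ hδ => ?_
  obtain ⟨k, hk⟩ := exists_nat_one_div_lt hδ
  linarith [hx k hxD]

/-! ### The logarithmic barrier and lower bounds for decaying supersolutions. -/

/-- The barrier `x_l |x|⁻ⁿ (a + ε log (|x| / R)) + ε x_l² |x|⁻⁽ⁿ⁺¹⁾`. -/
noncomputable def logBarrier {n : ℕ} (l : Fin n) (a ε R : ℝ) (y : Eucl n) : ℝ :=
  y l * ((‖y‖ ^ 2) ^ (-(n : ℝ) / 2) * ((a - ε * Real.log R) + ε / 2 * Real.log (‖y‖ ^ 2))) +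
    ε * (y l ^ 2 * (‖y‖ ^ 2) ^ (-((n + 1 : ℕ) : ℝ) / 2))

theorem sq_rpow_neg_half {r : ℝ} (hr : 0 < r) (m : ℕ) : (r ^ 2) ^ (-(m : ℝ) / 2) = (r ^ m)⁻¹ := by
  rw [← Real.rpow_natCast r 2, ← Real.rpow_mul hr.le, ← Real.rpow_natCast r m, ← Real.rpow_neg hr.le]
  congr 1
  push_cast
  ring

theorem logBarrier_eq {n : ℕ} (l : Fin n) (a ε : ℝ) {R : ℝ} (hR : 0 < R) {y : Eucl n}
    (hy : y ≠ 0) :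
    logBarrier l a ε R y = y l / ‖y‖ ^ n * (a + ε * Real.log (‖y‖ / R)) +
      ε * (y l ^ 2 / ‖y‖ ^ (n + 1)) := by
  have hr : 0 < ‖y‖ := norm_pos_iff.2 hy
  rw [logBarrier, sq_rpow_neg_half hr, sq_rpow_neg_half hr, Real.log_pow,
    Real.log_div hr.ne' hR.ne']
  push_cast
  ring

theorem contDiffAt_logBarrier_parts {n : ℕ} (l : Fin n) {x : Eucl n} (hx : x ≠ 0) (k α β k' : ℝ) :
    ContDiffAt ℝ 2 (fun y : Eucl n =>
      y l * ((‖y‖ ^ 2) ^ k * (α + β * Real.log (‖y‖ ^ 2)))) x ∧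
    ContDiffAt ℝ 2 (fun y : Eucl n => y l ^ 2 * (‖y‖ ^ 2) ^ k') x := by
  refine ⟨(contDiff_coord l).contDiffAt.mul (contDiffAt_normSq_rpow_mul hx k α β), ?_⟩
  have := contDiffAt_normSq_rpow_mul hx k' 1 0
  simp only [zero_mul, add_zero, mul_one] at this
  exact ((contDiff_coord l).contDiffAt.pow 2).mul this

theorem contDiffAt_logBarrier {n : ℕ} (l : Fin n) (a ε R : ℝ) {x : Eucl n} (hx : x ≠ 0) :
    ContDiffAt ℝ 2 (logBarrier l a ε R) x :=
  (contDiffAt_logBarrier_parts l hx _ _ _ 0).1.add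
    (contDiffAt_const.mul (contDiffAt_logBarrier_parts l hx 0 0 0 _).2)

theorem neg_laplacian_logBarrier {n : ℕ} (l : Fin n) (a ε R : ℝ) {x : Eucl n} (hx : x ≠ 0) :
    -Laplacian.laplacian (logBarrier l a ε R) x =
      ε / ‖x‖ ^ (n + 1) * (n * (x l / ‖x‖) + (n + 1) * (x l / ‖x‖) ^ 2 - 2) := by
  have hr : 0 < ‖x‖ := norm_pos_iff.2 hx
  have h1 := (contDiffAt_logBarrier_parts l hx (-(n : ℝ) / 2) (a - ε * Real.log R) (ε / 2) 0).1
  have h2 := (contDiffAt_logBarrier_parts l hx 0 0 0 (-((n + 1 : ℕ) : ℝ) / 2)).2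
  have h3 : Laplacian.laplacian (logBarrier l a ε R) x = _ :=
    laplacian_fun_add h1 (contDiffAt_const.mul h2)
  rw [h3, laplacian_const_mul ε h2, laplacian_coord_mul_rpow_log l hx,
    laplacian_coord_sq_mul_rpow l hx]
  have e1 : -(n : ℝ) / 2 - 1 = -((n + 2 : ℕ) : ℝ) / 2 := by push_cast; ring
  have e2 : -((n + 1 : ℕ) : ℝ) / 2 - 1 = -((n + 3 : ℕ) : ℝ) / 2 := by push_cast; ring
  rw [e1, e2, sq_rpow_neg_half hr, sq_rpow_neg_half hr, sq_rpow_neg_half hr]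
  push_cast
  field_simp
  ring

/-- In the strip `-1 < x_l < 0` one has `x_l/|x| ≥ -1`, so `ε ≤ a` lets the constant `a` absorb the
quadratic correction. What remains is `x_l` times a nonnegative factor. -/
theorem logBarrier_nonpos {n : ℕ} (l : Fin n) {a ε R : ℝ} (hε : 0 ≤ ε) (hεa : ε ≤ a) (hR : 1 ≤ R)
    {x : Eucl n} (hx : x ∈ halfSpaceExterior l R) (hl : x l < 0) : logBarrier l a ε R x ≤ 0 := by
  have hr : R < ‖x‖ := hx.2
  have hr0 : 0 < ‖x‖ := by linarith
  rw [logBarrier_eq l a ε (by linarith) (norm_pos_iff.1 hr0)]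
  have hlog : 0 ≤ Real.log (‖x‖ / R) := Real.log_nonneg (by rw [le_div_iff₀] <;> linarith)
  have hω : -1 ≤ x l / ‖x‖ := by
    rw [le_div_iff₀ hr0]; linarith [hx.1]
  have : x l / ‖x‖ ^ n * (a + ε * Real.log (‖x‖ / R)) + ε * (x l ^ 2 / ‖x‖ ^ (n + 1)) =
      x l / ‖x‖ ^ n * ((a + ε * (x l / ‖x‖)) + ε * Real.log (‖x‖ / R)) := by
    field_simp
    ring
  rw [this]
  refine mul_nonpos_of_nonpos_of_nonneg (div_nonpos_of_nonpos_of_nonneg hl.le (by positivity)) ?_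
  have : 0 ≤ a + ε * (x l / ‖x‖) := by nlinarith
  positivity

theorem logBarrier_le {n : ℕ} (hn : 2 ≤ n) (l : Fin n) {a ε R : ℝ} (hε : 0 ≤ ε) (hεa : ε ≤ a)
    (hR : 1 ≤ R) {x : Eucl n} (hr : R < ‖x‖) (hl : 0 ≤ x l) :
    logBarrier l a ε R x ≤ (a * (2 + Real.log (‖x‖ / R))) / ‖x‖ := by
  have hr0 : 0 < ‖x‖ := by linarith
  rw [logBarrier_eq l a ε (by linarith) (norm_pos_iff.1 hr0)]
  have hlog : 0 ≤ Real.log (‖x‖ / R) := Real.log_nonneg (by rw [le_div_iff₀] <;> linarith)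
  have ha : 0 ≤ a := hε.trans hεa
  have hxl : x l ≤ ‖x‖ := (le_abs_self _).trans (abs_coord_le_norm l x)
  have hpow : ‖x‖ ^ 2 ≤ ‖x‖ ^ n := pow_le_pow_right₀ (by linarith) hn
  have h1 : x l / ‖x‖ ^ n ≤ 1 / ‖x‖ := by
    rw [div_le_div_iff₀ (by positivity) hr0]
    nlinarith
  have h2 : x l ^ 2 / ‖x‖ ^ (n + 1) ≤ 1 / ‖x‖ := by
    rw [div_le_div_iff₀ (by positivity) hr0, pow_succ ‖x‖ n]
    have : x l ^ 2 ≤ ‖x‖ ^ 2 := by gcongr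
    nlinarith
  have h3 : x l / ‖x‖ ^ n * (a + ε * Real.log (‖x‖ / R)) ≤
      1 / ‖x‖ * (a + a * Real.log (‖x‖ / R)) := by
    have : 0 ≤ a + ε * Real.log (‖x‖ / R) := by positivity
    gcongr
  have h4 : ε * (x l ^ 2 / ‖x‖ ^ (n + 1)) ≤ a * (1 / ‖x‖) := by gcongr
  calc _ ≤ _ := add_le_add h3 h4
    _ = _ := by ring

theorem log_div_le {r R : ℝ} (hR : 1 ≤ R) (hr : R < r) : Real.log (r / R) ≤ r := by
  have h1 : r / R ≤ r := div_le_self (by linarith) hR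
  have h2 : 0 < r / R := by apply div_pos <;> linarith
  linarith [Real.log_le_sub_one_of_pos h2]

theorem logBarrier_le_const {n : ℕ} (hn : 2 ≤ n) (l : Fin n) {a ε R : ℝ} (hε : 0 ≤ ε)
    (hεa : ε ≤ a) (hR : 1 ≤ R) {x : Eucl n} (hr : R < ‖x‖) (hl : 0 ≤ x l) :
    logBarrier l a ε R x ≤ 3 * a := by
  refine (logBarrier_le hn l hε hεa hR hr hl).trans ?_
  rw [div_le_iff₀ (by linarith)]
  nlinarith [log_div_le hR hr]

theorem logBarrier_decay {n : ℕ} (hn : 2 ≤ n) (l : Fin n) {a ε R : ℝ} (hε : 0 ≤ ε)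
    (hεa : ε ≤ a) (hR : 1 ≤ R) {δ : ℝ} (hδ : 0 < δ) :
    ∃ ρ, ∀ x ∈ halfSpaceExterior l R, 0 ≤ x l → ρ ≤ ‖x‖ → logBarrier l a ε R x ≤ δ := by
  -- From `log |x| ≤ 2 √|x|` the barrier is at most `4 a / √|x|`, which is at most `δ` beyond this
  -- radius.
  refine ⟨(4 * a / δ) ^ 2, fun x hx hl hρ => (logBarrier_le hn l hε hεa hR hx.2 hl).trans ?_⟩
  have hr : R < ‖x‖ := hx.2
  have hr0 : 0 < ‖x‖ := by linarith
  have ha : 0 ≤ a := hε.trans hεa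
  have hs : 4 * a / δ ≤ √‖x‖ := Real.le_sqrt_of_sq_le hρ
  have hss : √‖x‖ * √‖x‖ = ‖x‖ := Real.mul_self_sqrt hr0.le
  have hs1 : 1 ≤ √‖x‖ := by rw [Real.one_le_sqrt]; linarith
  have hlog : Real.log (‖x‖ / R) ≤ 2 * √‖x‖ := by
    have h1 : Real.log (‖x‖ / R) ≤ Real.log ‖x‖ :=
      Real.log_le_log (by apply div_pos <;> linarith) (div_le_self hr0.le hR)
    have h2 : Real.log ‖x‖ = 2 * Real.log √‖x‖ := by rw [Real.log_sqrt hr0.le]; ring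
    linarith [Real.log_le_sub_one_of_pos (show 0 < √‖x‖ by linarith)]
  rw [div_le_iff₀ hr0]
  rw [div_le_iff₀ hδ] at hs
  calc a * (2 + Real.log (‖x‖ / R)) ≤ a * (2 * √‖x‖ + 2 * √‖x‖) := by gcongr; linarith
    _ = 4 * a * √‖x‖ := by ring
    _ ≤ √‖x‖ * δ * √‖x‖ := by gcongr
    _ = δ * ‖x‖ := by rw [← hss]; ring_nf; simp

theorem logBarrier_le_of_contact {n : ℕ} (hn : 2 ≤ n) {ℱ : Filter (Eucl n)} [CountableInterFilter ℱ]
    {l : Fin n} {R : ℝ} {F : ℝ → Eucl n → ℝ} {u : Eucl n → ℝ}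
    (h : ComparisonOn ℱ (halfSpaceExterior l R) F u) {a ε : ℝ} (hR : 1 ≤ R) (hε : 0 ≤ ε)
    (hεa : ε ≤ a) (hpos : ∀ᶠ x in ℱ, x ∈ halfSpaceExterior l R → 0 < u x)
    (hann : ∀ᶠ x in ℱ, 0 ≤ x l → R < ‖x‖ → ‖x‖ ≤ 2 * R → 3 * a ≤ u x)
    (hcontact : ∀ᶠ x in ℱ, 0 ≤ x l → 2 * R ≤ ‖x‖ → u x < logBarrier l a ε R x →
      ε / ‖x‖ ^ (n + 1) * (n * (x l / ‖x‖) + (n + 1) * (x l / ‖x‖) ^ 2 - 2) < F (u x) x) :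
    ∀ᶠ x in ℱ, x ∈ halfSpaceExterior l R → logBarrier l a ε R x ≤ u x := by
  have hne : ∀ x : Eucl n, R < ‖x‖ → x ≠ 0 := fun x hx => norm_pos_iff.1 (by linarith)
  refine h.le_of_decay (by linarith) hpos
    (fun x hx => (contDiffAt_logBarrier l a ε R (hne x hx.2)).contDiffWithinAt)
    (fun x hx hl => logBarrier_nonpos l hε hεa hR hx hl) ?_
    (fun δ hδ => logBarrier_decay hn l hε hεa hR hδ) ?_
  · filter_upwards [hann] with x hx h0 h1 h2
    exact (logBarrier_le_const hn l hε hεa hR h1 h0).trans (hx h0 h1 h2)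
  · filter_upwards [hcontact] with x hx h0 h1 h2
    rw [neg_laplacian_logBarrier l a ε R (hne x (by linarith))]
    exact hx h0 h1 h2

/-- A positive supersolution in the half space is bounded below by a multiple of the
fundamental solution `x_l |x|⁻ⁿ`. -/
theorem IsComparisonSupersolution.exists_fundamental_le {n : ℕ} (hn : 2 ≤ n) {ℱ : Filter (Eucl n)}
    [CountableInterFilter ℱ] {l : Fin n} {R₀ R : ℝ} {F : ℝ → Eucl n → ℝ} {u : Eucl n → ℝ}
    (hS : IsComparisonSupersolution ℱ l R₀ F u) (hRR : R₀ < R) (hR : 1 ≤ R)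
    (hF : ∀ s, 0 < s → ∀ x ∈ halfSpaceExterior l R, 0 < F s x) :
    ∃ a, 0 < a ∧ a ≤ 1 / 3 ∧
      (∀ᶠ x in ℱ, 0 ≤ x l → R < ‖x‖ → ‖x‖ ≤ 2 * R → 3 * a ≤ u x) ∧
      ∀ᶠ x in ℱ, x ∈ halfSpaceExterior l R → x l / ‖x‖ ^ n * a ≤ u x := by
  obtain ⟨c, hc, hcu⟩ := hS.lower_bound {x | 0 ≤ x l ∧ R ≤ ‖x‖ ∧ ‖x‖ ≤ 2 * R}
    (isCompact_halfAnnulus l _ _) fun x hx => ⟨by linarith [hx.1], by linarith [hx.2.1]⟩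
  have hpos : ∀ᶠ x in ℱ, x ∈ halfSpaceExterior l R → 0 < u x :=
    hS.pos.mono fun x hx hxD => hx (halfSpaceExterior_anti l hRR.le hxD)
  -- The factor 3 is that of `logBarrier_le_const`. The cap `1/3` keeps the barrier below 1, so that
  -- at contact `u` lies in the range where the behaviour of the source at zero is known.
  set a : ℝ := min (c / 3) (1 / 3)
  have ha : 0 < a := by positivity
  have hac : 3 * a ≤ c := by linarith [min_le_left (c / 3) (1 / 3)]
  have hann : ∀ᶠ x in ℱ, 0 ≤ x l → R < ‖x‖ → ‖x‖ ≤ 2 * R → 3 * a ≤ u x := by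
    filter_upwards [hcu] with x hx h0 h1 h2
    exact hac.trans (hx ⟨h0, h1.le, h2⟩)
  refine ⟨a, ha, min_le_right _ _, hann, ?_⟩
  have := logBarrier_le_of_contact hn (hS.comparison R hRR.le) hR le_rfl ha.le hpos hann ?_
  · filter_upwards [this] with x hx hxD
    have h1 := hx hxD
    have hx0 : x ≠ 0 := norm_pos_iff.1 (by linarith [hxD.2])
    rw [logBarrier_eq l a 0 (by linarith) hx0] at h1
    simpa using h1
  · filter_upwards [hpos] with x hx h0 h1 _
    have hxD : x ∈ halfSpaceExterior l R := ⟨by linarith, by linarith⟩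
    simpa using hF _ (hx hxD) x hxD

/-- This angular factor, with `θ = x_l/|x|`, occurs in `-Δ` of both barriers. The term `-2` comes
from the correction quadratic in `x_l`: it makes the barriers subharmonic near the boundary
hyperplane, where no quantitative lower bound on `u` is available. -/
theorem angular_source_neg {n : ℕ} (hn : 2 ≤ n) {θ : ℝ} (h0 : 0 ≤ θ) (h1 : θ < 1 / (2 * n)) :
    n * θ + (n + 1) * θ ^ 2 - 2 < -(1 / 2) := by
  have hn' : (2 : ℝ) ≤ n := by exact_mod_cast hn
  rw [lt_div_iff₀ (by linarith)] at h1
  have h2 : n * θ < 1 / 2 := by linarith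
  have h3 : θ < 1 / 4 := by nlinarith
  nlinarith

theorem angular_source_le {n : ℕ} {θ : ℝ} (h0 : 0 ≤ θ) (h1 : θ ≤ 1) :
    n * θ + (n + 1) * θ ^ 2 - 2 ≤ 2 * n - 1 := by
  have : θ ^ 2 ≤ 1 := pow_le_one₀ h0 h1
  have hn : (0 : ℝ) ≤ n := by positivity
  nlinarith

theorem coord_div_norm_le_one {n : ℕ} (l : Fin n) (x : Eucl n) : x l / ‖x‖ ≤ 1 :=
  div_le_one_of_le₀ ((le_abs_self _).trans (abs_coord_le_norm l x)) (norm_nonneg _)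

/-- The improvement by a logarithm of the lower bound for positive supersolutions, in the case of
a source which is critical at zero. -/
theorem IsComparisonSupersolution.exists_log_le {n : ℕ} (hn : 2 ≤ n) {ℱ : Filter (Eucl n)}
    [CountableInterFilter ℱ] {l : Fin n} {R₀ R γ c : ℝ} {F : ℝ → Eucl n → ℝ} {u : Eucl n → ℝ}
    (hS : IsComparisonSupersolution ℱ l R₀ F u) (hγ : γ < 2) (hRR : R₀ < R) (hR : 1 ≤ R)
    (hF : ∀ s, 0 < s → ∀ x ∈ halfSpaceExterior l R, 0 < F s x) (hc : 0 < c)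
    (hF0 : ∀ s, 0 < s → s ≤ 1 → ∀ x ∈ halfSpaceExterior l R,
      c * ‖x‖ ^ (-γ) * s ^ (((n : ℝ) + 1 - γ) / ((n : ℝ) - 1)) ≤ F s x) :
    ∃ ε, 0 < ε ∧ ∀ᶠ x in ℱ, x ∈ halfSpaceExterior l R → 0 ≤ x l →
      ε * (x l / ‖x‖ ^ n) * Real.log (‖x‖ / R) ≤ u x := by
  obtain ⟨a, ha, ha3, hann, hfund⟩ := hS.exists_fundamental_le hn hRR hR hF
  have hpos : ∀ᶠ x in ℱ, x ∈ halfSpaceExterior l R → 0 < u x :=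
    hS.pos.mono fun x hx hxD => hx (halfSpaceExterior_anti l hRR.le hxD)
  have hn' : (2 : ℝ) ≤ n := by exact_mod_cast hn
  set σ : ℝ := ((n : ℝ) + 1 - γ) / ((n : ℝ) - 1)
  have hσ : 0 < σ := div_pos (by linarith) (by linarith)
  have hσ' : ((n : ℝ) - 1) * σ = n + 1 - γ := by
    simp only [σ]; field_simp [show (n : ℝ) - 1 ≠ 0 by linarith]
  set θ₀ : ℝ := 1 / (2 * n)
  have hθ₀ : 0 < θ₀ := by positivity
  -- `c (a θ₀)^σ` is the source constant produced by the bound `u ≥ a θ₀ |x|^(1-n)` in the cone. The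
  -- divisor `2 n + 1` strictly exceeds the bound `2 n - 1` on the angular factor.
  set ε : ℝ := min a (c * (a * θ₀) ^ σ / (2 * n + 1))
  have hε : 0 < ε := by positivity
  have hεa : ε ≤ a := min_le_left _ _
  have hε' : ε * (2 * n + 1) ≤ c * (a * θ₀) ^ σ := by
    rw [← le_div_iff₀ (by positivity)]; exact min_le_right _ _
  refine ⟨ε, hε, ?_⟩
  have := logBarrier_le_of_contact hn (hS.comparison R hRR.le) hR hε.le hεa hpos hann ?_
  · filter_upwards [this] with x hx hxD hl
    have hr0 : 0 < ‖x‖ := by linarith [hxD.2]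
    have h1 := hx hxD
    rw [logBarrier_eq l a ε (by linarith) (norm_pos_iff.1 hr0)] at h1
    have h2 : 0 ≤ x l / ‖x‖ ^ n * a + ε * (x l ^ 2 / ‖x‖ ^ (n + 1)) := by positivity
    nlinarith
  · filter_upwards [hpos, hfund] with x hx hxf h0 h1 hlt
    have hxD : x ∈ halfSpaceExterior l R := ⟨by linarith, by linarith⟩
    have hr0 : 0 < ‖x‖ := by linarith
    have hu := hx hxD
    rcases lt_or_ge (x l / ‖x‖) θ₀ with hθ | hθ
    · have h2 := angular_source_neg hn (θ := x l / ‖x‖) (by positivity) hθ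
      refine lt_of_le_of_lt ?_ (hF _ hu x hxD)
      exact mul_nonpos_of_nonneg_of_nonpos (by positivity) (by linarith)
    · have hu1 : u x ≤ 1 := by
        have := logBarrier_le_const hn l hε.le hεa hR hxD.2 h0
        linarith
      refine lt_of_lt_of_le ?_ (hF0 _ hu hu1 x hxD)
      have h2 := angular_source_le (n := n) (θ := x l / ‖x‖) (by positivity)
        (coord_div_norm_le_one l x)
      have hlow : a * θ₀ * ‖x‖ ^ (1 - (n : ℝ)) ≤ u x := by
        refine le_trans ?_ (hxf hxD)
        rw [Real.rpow_sub hr0, Real.rpow_one, Real.rpow_natCast]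
        calc a * θ₀ * (‖x‖ / ‖x‖ ^ n) ≤ a * (x l / ‖x‖) * (‖x‖ / ‖x‖ ^ n) := by gcongr
          _ = _ := by field_simp
      calc _ < ε / ‖x‖ ^ (n + 1) * (2 * n + 1) := by gcongr; linarith
        _ = ε * (2 * n + 1) / ‖x‖ ^ (n + 1) := by ring
        _ ≤ c * (a * θ₀) ^ σ / ‖x‖ ^ (n + 1) := by gcongr
        _ = c * ‖x‖ ^ (-γ) * (a * θ₀ * ‖x‖ ^ (1 - (n : ℝ))) ^ σ := by
            rw [Real.mul_rpow (x := a * θ₀) (by positivity) (by positivity), ← Real.rpow_mul hr0.le,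
              div_eq_mul_inv, ← Real.rpow_natCast, ← Real.rpow_neg hr0.le]
            -- Criticality at zero: inserting `|x|^(1-n)` into the source gives exactly the power in
            -- `-Δ` of the barrier.
            have : -((n + 1 : ℕ) : ℝ) = -γ + (1 - (n : ℝ)) * σ := by push_cast; linarith
            rw [this, Real.rpow_add hr0]
            ring
        _ ≤ _ := by gcongr

/-! ### Growing bumps: linear growth in cones. -/

/-- A bump of height `t` below `u` can be raised to height `t'`. Where the higher bump fails to be
subharmonic, the old one already gives `u ≥ (4/(n+4))³ t`, and a contact point has `u < t'`; the
source is needed only for values in this window. -/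
theorem ComparisonOn.bump_le_of_bump_le {n : ℕ} {ℱ : Filter (Eucl n)} {l : Fin n} {R : ℝ}
    {F : ℝ → Eucl n → ℝ} {u : Eucl n → ℝ}
    (h : ComparisonOn ℱ (halfSpaceExterior l R) F u)
    (hpos : ∀ᶠ x in ℱ, x ∈ halfSpaceExterior l R → 0 < u x)
    (hF : ∀ s, 0 < s → ∀ x ∈ halfSpaceExterior l R, 0 < F s x)
    {p : Eucl n} {ρ t t' : ℝ} (hρ : 0 < ρ)
    (hball : Metric.closedBall p ρ ⊆ halfSpaceExterior l R) (ht : 0 ≤ t) (ht' : 0 ≤ t')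
    (hle : ∀ᶠ x in ℱ, x ∈ halfSpaceExterior l R → t * (1 - ‖x - p‖ ^ 2 / ρ ^ 2) ^ 3 ≤ u x)
    (hsrc : ∀ y ∈ Metric.closedBall p ρ, ∀ s, 0 < s → (4 / ((n : ℝ) + 4)) ^ 3 * t ≤ s → s < t' →
      6 * n / ρ ^ 2 * t' < F s y) :
    ∀ᶠ x in ℱ, x ∈ halfSpaceExterior l R → t' * (1 - ‖x - p‖ ^ 2 / ρ ^ 2) ^ 3 ≤ u x := by
  have hcd : ContDiff ℝ 2 (fun y : Eucl n => ((1 - ‖y - p‖ ^ 2 / ρ ^ 2) ^ 3 : ℝ)) :=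
    (contDiff_const.sub (((contDiff_id.sub contDiff_const).norm_sq ℝ).div_const _)).pow 3
  refine h (fun y => t' * (1 - ‖y - p‖ ^ 2 / ρ ^ 2) ^ 3) (Metric.closedBall p ρ)
    (contDiff_const.mul hcd).contDiffOn (isCompact_closedBall p ρ) hball ?_ ?_
  · filter_upwards [hpos] with x hx hxD hxK
    have h1 : ρ < ‖x - p‖ := by simpa [dist_eq_norm] using hxK
    have h2 : 1 - ‖x - p‖ ^ 2 / ρ ^ 2 ≤ 0 := by
      rw [sub_nonpos, le_div_iff₀ (by positivity), one_mul]
      gcongr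
    have h3 : (1 - ‖x - p‖ ^ 2 / ρ ^ 2) ^ 3 ≤ 0 := Odd.pow_nonpos (by decide) h2
    exact (mul_nonpos_of_nonneg_of_nonpos ht' h3).trans (hx hxD).le
  · filter_upwards [hpos, hle] with x hx hxt hxK hlt
    have hxD := hball hxK
    have hu := hx hxD
    have h1 : ‖x - p‖ ≤ ρ := by simpa [dist_eq_norm] using hxK
    rw [laplacian_const_mul t' hcd.contDiffAt, laplacian_bump l p hρ x]
    have hζ0 : 0 ≤ ‖x - p‖ ^ 2 / ρ ^ 2 := by positivity
    have hζ1 : ‖x - p‖ ^ 2 / ρ ^ 2 ≤ 1 := by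
      rw [div_le_one (by positivity)]
      gcongr
    have hxt' := hxt hxD
    set z := 1 - ‖x - p‖ ^ 2 / ρ ^ 2
    have hz : ‖x - p‖ ^ 2 / ρ ^ 2 = 1 - z := by simp [z]
    rw [hz] at hζ0 hζ1 ⊢
    -- The outer shell, where the bump is subharmonic and positivity of the source suffices, against
    -- the core `z ≥ 4/(n+4)`.
    rcases le_or_gt (n * z) (4 * (1 - z)) with hcase | hcase
    · refine lt_of_le_of_lt ?_ (hF _ hu x hxD)
      have : 0 ≤ t' * (6 / ρ ^ 2 * z * (4 * (1 - z) - n * z)) := by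
        have h5 : 0 ≤ z := by linarith
        have h6 : 0 ≤ 4 * (1 - z) - n * z := by linarith
        positivity
      linarith
    · have hz1 : 4 / ((n : ℝ) + 4) ≤ z := by
        rw [div_le_iff₀ (by positivity)]; linarith
      have hz0 : 0 ≤ z := by linarith
      have hz2 : (4 / ((n : ℝ) + 4)) ^ 3 ≤ z ^ 3 := by gcongr
      have hz3 : z ^ 3 ≤ 1 := pow_le_one₀ hz0 (by linarith)
      refine lt_of_le_of_lt ?_ (hsrc x hxK (u x) hu (by nlinarith) (by nlinarith))
      have h5 : -(4 * (1 - z) - n * z) ≤ n := by nlinarith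
      calc _ = 6 / ρ ^ 2 * t' * (z * -(4 * (1 - z) - n * z)) := by ring
        _ ≤ 6 / ρ ^ 2 * t' * (1 * n) := by
            have : 0 ≤ -(4 * (1 - z) - n * z) := by linarith
            gcongr
            linarith
        _ = _ := by ring

/-- The height is doubled until it reaches `T`. Since each step at most doubles it, the new height
is at most `2 s / c₁` for every `s` in the window. A source dominating a fixed multiple of `s`
therefore serves all steps, and `12` is `2 · 6`. -/
theorem ComparisonOn.bump_le_of_doubling {n : ℕ} {ℱ : Filter (Eucl n)} {l : Fin n} {R : ℝ}
    {F : ℝ → Eucl n → ℝ} {u : Eucl n → ℝ}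
    (h : ComparisonOn ℱ (halfSpaceExterior l R) F u)
    (hpos : ∀ᶠ x in ℱ, x ∈ halfSpaceExterior l R → 0 < u x)
    (hF : ∀ s, 0 < s → ∀ x ∈ halfSpaceExterior l R, 0 < F s x)
    {p : Eucl n} {ρ t T : ℝ} (hρ : 0 < ρ)
    (hball : Metric.closedBall p ρ ⊆ halfSpaceExterior l R) (ht : 0 < t) (hT : 0 < T)
    (hle : ∀ᶠ x in ℱ, x ∈ Metric.closedBall p ρ → t ≤ u x)
    (hsrc : ∀ y ∈ Metric.closedBall p ρ, ∀ s, 0 < s → (4 / ((n : ℝ) + 4)) ^ 3 * t ≤ s → s < T →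
      12 * n / ((4 / ((n : ℝ) + 4)) ^ 3 * ρ ^ 2) * s < F s y) :
    ∀ᶠ x in ℱ, x ∈ halfSpaceExterior l R → T * (1 - ‖x - p‖ ^ 2 / ρ ^ 2) ^ 3 ≤ u x := by
  set c₁ : ℝ := (4 / ((n : ℝ) + 4)) ^ 3
  have hc₁ : 0 < c₁ := by positivity
  have hle' : ∀ᶠ x in ℱ, x ∈ halfSpaceExterior l R → t * (1 - ‖x - p‖ ^ 2 / ρ ^ 2) ^ 3 ≤ u x := by
    filter_upwards [hpos, hle] with x hx hxt hxD
    rcases le_or_gt ‖x - p‖ ρ with h1 | h1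
    · have h2 : ‖x - p‖ ^ 2 / ρ ^ 2 ≤ 1 := by
        rw [div_le_one (by positivity)]
        gcongr
      have h3 : 0 ≤ ‖x - p‖ ^ 2 / ρ ^ 2 := by positivity
      have h4 : (1 - ‖x - p‖ ^ 2 / ρ ^ 2) ^ 3 ≤ 1 := pow_le_one₀ (by linarith) (by linarith)
      have := hxt (by simpa [dist_eq_norm] using h1)
      nlinarith
    · have h2 : 1 - ‖x - p‖ ^ 2 / ρ ^ 2 ≤ 0 := by
        rw [sub_nonpos, le_div_iff₀ (by positivity), one_mul]
        gcongr
      have h3 : (1 - ‖x - p‖ ^ 2 / ρ ^ 2) ^ 3 ≤ 0 := Odd.pow_nonpos (by decide) h2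
      exact (mul_nonpos_of_nonneg_of_nonpos ht.le h3).trans (hx hxD).le
  have key : ∀ k : ℕ, ∀ᶠ x in ℱ, x ∈ halfSpaceExterior l R →
      min (2 ^ k * t) T * (1 - ‖x - p‖ ^ 2 / ρ ^ 2) ^ 3 ≤ u x := by
    intro k
    induction k with
    | zero =>
      rcases le_or_gt t T with h1 | h1
      · simpa [min_eq_left h1] using hle'
      · simp only [pow_zero, one_mul, min_eq_right h1.le]
        filter_upwards [hpos, hle'] with x hx hxt hxD
        rcases le_or_gt 0 ((1 - ‖x - p‖ ^ 2 / ρ ^ 2) ^ 3) with h2 | h2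
        · exact (mul_le_mul_of_nonneg_right h1.le h2).trans (hxt hxD)
        · exact (mul_nonpos_of_nonneg_of_nonpos hT.le h2.le).trans (hx hxD).le
    | succ k ih =>
      rcases le_or_gt T (2 ^ k * t) with h1 | h1
      · rw [min_eq_right h1] at ih
        have h2 : T ≤ 2 ^ (k + 1) * t := by
          rw [pow_succ]; nlinarith [show 0 < 2 ^ k * t by positivity]
        rwa [min_eq_right h2]
      · rw [min_eq_left h1.le] at ih
        refine h.bump_le_of_bump_le hpos hF hρ hball (by positivity) (by positivity) ih ?_
        intro y hy s hs hs1 hs2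
        have h2k : (1 : ℝ) ≤ 2 ^ k := one_le_pow₀ (by norm_num)
        refine lt_of_le_of_lt ?_ (hsrc y hy s hs (le_trans ?_ hs1)
          (hs2.trans_le (min_le_right _ _)))
        · have h3 : min (2 ^ (k + 1) * t) T ≤ 2 * s / c₁ := by
            refine (min_le_left _ _).trans ?_
            rw [le_div_iff₀ hc₁, pow_succ]
            linarith
          calc _ ≤ 6 * n / ρ ^ 2 * (2 * s / c₁) := by gcongr
            _ = _ := by field_simp; ring
        · nlinarith [mul_pos hc₁ ht]
  obtain ⟨k, hk⟩ := pow_unbounded_of_one_lt (T / t) (one_lt_two (α := ℝ))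
  have hk' : T ≤ 2 ^ k * t := by rw [div_lt_iff₀ ht] at hk; exact hk.le
  simpa [min_eq_right hk'] using key k

/-- The constant `2 ^ (-|γ|)` covers both signs of `γ`. -/
theorem rpow_neg_half_scale_le {r z γ : ℝ} (hr : 0 < r) (h1 : r / 2 ≤ z) (h2 : z ≤ 2 * r) :
    2 ^ (-|γ|) * r ^ (-γ) ≤ z ^ (-γ) := by
  have hz : 0 < z := by linarith
  rcases le_total 0 γ with hγ | hγ
  · rw [abs_of_nonneg hγ, ← Real.mul_rpow (by norm_num) hr.le]
    exact Real.rpow_le_rpow_of_nonpos hz h2 (by linarith)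
  · rw [abs_of_nonpos hγ, neg_neg]
    have : (2 : ℝ) ^ γ * r ^ (-γ) = (r / 2) ^ (-γ) := by
      rw [Real.div_rpow hr.le (by norm_num), Real.rpow_neg (by norm_num : (0 : ℝ) ≤ 2), div_inv_eq_mul]
      ring
    rw [this]
    exact Real.rpow_le_rpow (by positivity) h1 (by linarith)

/-- Once `log r` is large, the source dominates `s r⁻²` for all `s` between the fundamental
solution (up to a logarithm) and a small multiple of `r`. -/
theorem exists_source_dominates {n : ℕ} (hn : 2 ≤ n) {γ : ℝ} (hγ : γ < 2) {b C R : ℝ} (hb : 0 < b)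
    (hC : 0 < C) (hR : 0 < R) :
    ∃ η > 0, ∃ R₁, ∀ r ≥ R₁, ∀ s > 0, b * (r / r ^ n) * Real.log (r / (2 * R)) ≤ s →
      (s ≤ 1 → C * s < r ^ (2 - γ) * s ^ (((n : ℝ) + 1 - γ) / ((n : ℝ) - 1))) ∧
      (1 ≤ s → s < η * r → C * s < r ^ (2 - γ) * s ^ (γ - 1)) := by
  have hn' : (2 : ℝ) ≤ n := by exact_mod_cast hn
  set τ : ℝ := (2 - γ) / ((n : ℝ) - 1)
  have hτ : 0 < τ := div_pos (by linarith) (by linarith)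
  have hτ' : ((n : ℝ) - 1) * τ = 2 - γ := by
    simp only [τ]; field_simp [show (n : ℝ) - 1 ≠ 0 by linarith]
  have hσ : ((n : ℝ) + 1 - γ) / ((n : ℝ) - 1) = 1 + τ := by
    simp only [τ]; field_simp [show (n : ℝ) - 1 ≠ 0 by linarith]; ring
  have h2γ : 0 < 2 - γ := by linarith
  -- For `1 ≤ s < η r` the quotient of source and `s` is `(r/s)^(2-γ) ≥ η^(-(2-γ))`; this `η` makes
  -- the last quantity `C + 1`.
  set η : ℝ := (C + 1) ^ (-(2 - γ)⁻¹)
  have hη : 0 < η := by positivity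
  have hηC : η ^ (-(2 - γ)) = C + 1 := by
    simp only [η]
    rw [← Real.rpow_mul (by positivity)]
    rw [show -(2 - γ)⁻¹ * -(2 - γ) = 1 by field_simp]
    simp
  have hlim : Tendsto (fun r : ℝ => (b * Real.log (r / (2 * R))) ^ τ) atTop atTop :=
    (tendsto_rpow_atTop hτ).comp ((Real.tendsto_log_atTop.comp
      (tendsto_id.atTop_div_const (by positivity))).const_mul_atTop hb)
  obtain ⟨R₁, hR₁⟩ := eventually_atTop.1 ((hlim.eventually_gt_atTop C).and
    (eventually_ge_atTop (max 1 (2 * R))))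
  refine ⟨η, hη, R₁, fun r hr s hs hbs => ⟨fun hs1 => ?_, fun hs1 hsr => ?_⟩⟩
  · obtain ⟨h1, h2⟩ := hR₁ r hr
    have hr1 : 1 ≤ r := (le_max_left _ _).trans h2
    have hr0 : 0 < r := by linarith
    have hlog : 0 ≤ Real.log (r / (2 * R)) :=
      Real.log_nonneg (by rw [le_div_iff₀ (by positivity)]; linarith [(le_max_right _ _).trans h2])
    rw [hσ, Real.rpow_add hs, Real.rpow_one, mul_comm C, mul_left_comm]
    refine mul_lt_mul_of_pos_left (h1.trans_le ?_) hs
    -- The quotient of source and `s` is now `(r^(n-1) s)^τ`. At the critical size `s ≈ r^(1-n)` it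
    -- would only be bounded below; the logarithm makes it unbounded.
    rw [← hτ', Real.rpow_mul hr0.le, ← Real.mul_rpow (by positivity) hs.le]
    refine Real.rpow_le_rpow (by positivity) ?_ hτ.le
    rw [Real.rpow_sub hr0, Real.rpow_natCast, Real.rpow_one]
    calc b * Real.log (r / (2 * R)) =
          r ^ n / r * (b * (r / r ^ n) * Real.log (r / (2 * R))) := by field_simp
      _ ≤ _ := by gcongr
  · have hr0 : 0 < r := by
      by_contra hneg
      nlinarith [not_lt.1 hneg]
    have h1 : s ^ (γ - 1) = s * s ^ (-(2 - γ)) := by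
      rw [show γ - 1 = 1 + -(2 - γ) by ring, Real.rpow_add hs, Real.rpow_one]
    rw [h1, mul_comm C, mul_left_comm]
    refine mul_lt_mul_of_pos_left ?_ hs
    calc C < C + 1 := by linarith
      _ = r ^ (2 - γ) * (η * r) ^ (-(2 - γ)) := by
          rw [Real.mul_rpow hη.le hr0.le, hηC, mul_left_comm, ← Real.rpow_add hr0]
          simp
      _ ≤ _ := by
          gcongr ?_ * ?_
          exact Real.rpow_le_rpow_of_nonpos hs hsr.le (by linarith)

/-- A positive supersolution grows at least linearly in cones. -/
theorem IsComparisonSupersolution.exists_linear_le {n : ℕ} (hn : 2 ≤ n) {ℱ : Filter (Eucl n)}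
    [CountableInterFilter ℱ] {l : Fin n} {R₀ R γ c : ℝ} {F : ℝ → Eucl n → ℝ} {u : Eucl n → ℝ}
    (hS : IsComparisonSupersolution ℱ l R₀ F u) (hγ : γ < 2) (hRR : R₀ < R) (hR : 1 ≤ R)
    (hF : ∀ s, 0 < s → ∀ x ∈ halfSpaceExterior l R, 0 < F s x) (hc : 0 < c)
    (hF0 : ∀ s, 0 < s → s ≤ 1 → ∀ x ∈ halfSpaceExterior l R,
      c * ‖x‖ ^ (-γ) * s ^ (((n : ℝ) + 1 - γ) / ((n : ℝ) - 1)) ≤ F s x)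
    (hF1 : ∀ s, 1 ≤ s → ∀ x ∈ halfSpaceExterior l R, c * ‖x‖ ^ (-γ) * s ^ (γ - 1) ≤ F s x) :
    ∃ η > 0, ∃ R₁ ≥ R, ∀ᶠ x in ℱ, R₁ ≤ ‖x‖ → 1 / (2 * n) * ‖x‖ ≤ x l → η * ‖x‖ ≤ u x := by
  obtain ⟨ε, hε, hlow⟩ := hS.exists_log_le hn hγ hRR hR hF hc hF0
  have hpos : ∀ᶠ x in ℱ, x ∈ halfSpaceExterior l R → 0 < u x :=
    hS.pos.mono fun x hx hxD => hx (halfSpaceExterior_anti l hRR.le hxD)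
  have hn' : (2 : ℝ) ≤ n := by exact_mod_cast hn
  set θ : ℝ := 1 / (2 * n)
  have hθ : 0 < θ := by positivity
  have hθ4 : θ ≤ 1 / 4 := by
    simp only [θ]
    apply one_div_le_one_div_of_le <;> linarith
  set c₁ : ℝ := (4 / ((n : ℝ) + 4)) ^ 3
  have hc₁ : 0 < c₁ := by positivity
  -- On the ball around `p` one has `y_l ≥ θ r/4` and `|y| ≤ 2 r`, so `ε y_l/|y|ⁿ ≥ b₀ r/rⁿ`.
  set b₀ : ℝ := ε * θ / (4 * 2 ^ n)
  have hb₀ : 0 < b₀ := by positivity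
  -- The constant of `ComparisonOn.bump_le_of_doubling` for radius `θ r/4`, divided by the loss in
  -- replacing `|y|^(-γ)` by `r^(-γ)`.
  set C : ℝ := 12 * n * 16 / (c₁ * θ ^ 2) / (c * 2 ^ (-|γ|))
  have hC : 0 < C := by positivity
  obtain ⟨η, hη, R₁, hdom⟩ := exists_source_dominates hn hγ (b := c₁ * b₀) (C := C) (R := R)
    (by positivity) hC (by linarith)
  set R₂ : ℝ := max (R₁) (4 * R)
  have hbump : ∀ p : Eucl n, R₂ ≤ ‖p‖ → θ / 2 * ‖p‖ ≤ p l → ∀ᶠ x in ℱ,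
      x ∈ halfSpaceExterior l R →
        η * ‖p‖ * (1 - ‖x - p‖ ^ 2 / (θ * ‖p‖ / 4) ^ 2) ^ 3 ≤ u x := by
    intro p hp hpl
    set r : ℝ := ‖p‖
    have hr4 : 4 * R ≤ r := (le_max_right _ _).trans hp
    have hr1 : R₁ ≤ r := (le_max_left _ _).trans hp
    have hr0 : 0 < r := by linarith
    have hlog : 0 < Real.log (r / (2 * R)) :=
      Real.log_pos (by rw [lt_div_iff₀ (by positivity)]; linarith)
    have hgeom : ∀ y ∈ Metric.closedBall p (θ * r / 4),
        θ * r / 4 ≤ y l ∧ r / 2 ≤ ‖y‖ ∧ ‖y‖ ≤ 2 * r := by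
      intro y hy
      have h1 : ‖y - p‖ ≤ θ * r / 4 := by simpa [dist_eq_norm] using hy
      have h2 : |y l - p l| ≤ ‖y - p‖ := by simpa using abs_coord_le_norm l (y - p)
      have h3 := abs_sub_abs_le_abs_sub ‖y‖ ‖p‖
      have h4 := abs_norm_sub_norm_le y p
      have h5 : θ * r / 4 ≤ r / 16 := by nlinarith
      have h6 := abs_le.1 (h4.trans h1)
      have h7 := abs_le.1 (h2.trans h1)
      change -(θ * r / 4) ≤ ‖y‖ - r ∧ ‖y‖ - r ≤ θ * r / 4 at h6
      refine ⟨by linarith, by linarith, by linarith⟩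
    have hball : Metric.closedBall p (θ * r / 4) ⊆ halfSpaceExterior l R := fun y hy => by
      obtain ⟨h1, h2, h3⟩ := hgeom y hy
      have : 0 < θ * r / 4 := by positivity
      exact ⟨by linarith, by linarith⟩
    refine (hS.comparison R hRR.le).bump_le_of_doubling hpos hF
      (t := b₀ * (r / r ^ n) * Real.log (r / (2 * R))) (by positivity) hball (by positivity)
      (by positivity) ?_ ?_
    · filter_upwards [hlow] with y hy hyB
      obtain ⟨h1, h2, h3⟩ := hgeom y hyB
      have h4 : 0 < θ * r / 4 := by positivity
      have hy0 : 0 < ‖y‖ := by linarith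
      refine le_trans ?_ (hy (hball hyB) (by linarith))
      have h5 : r / (2 * R) ≤ ‖y‖ / R := by
        rw [div_le_div_iff₀ (by positivity) (by positivity)]; nlinarith
      have h6 : Real.log (r / (2 * R)) ≤ Real.log (‖y‖ / R) :=
        Real.log_le_log (by positivity) h5
      calc b₀ * (r / r ^ n) * Real.log (r / (2 * R)) =
            ε * (θ * r / 4 / (2 * r) ^ n) * Real.log (r / (2 * R)) := by
            simp only [b₀]; rw [mul_pow]; field_simp
        _ ≤ ε * (y l / ‖y‖ ^ n) * Real.log (‖y‖ / R) := by
            have h7 : 0 ≤ y l := by linarith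
            gcongr
    · intro y hy s hs hs1 hsT
      obtain ⟨h1, h2, h3⟩ := hgeom y hy
      have h4 := hdom r hr1 s hs (by linarith)
      have h5 : ∀ G : ℝ, 0 ≤ G → C * s < r ^ (2 - γ) * G →
          12 * n / (c₁ * (θ * r / 4) ^ 2) * s < c * ‖y‖ ^ (-γ) * G := by
        intro G hG0 hG
        have h6 : 12 * n / (c₁ * (θ * r / 4) ^ 2) * s = c * 2 ^ (-|γ|) / r ^ 2 * (C * s) := by
          simp only [C]
          field_simp
          ring
        have h7 : r ^ (2 - γ) = r ^ 2 * r ^ (-γ) := by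
          rw [sub_eq_add_neg, Real.rpow_add hr0]; simp
        calc _ < c * 2 ^ (-|γ|) / r ^ 2 * (r ^ (2 - γ) * G) := by
              rw [h6]; gcongr
          _ = c * (2 ^ (-|γ|) * r ^ (-γ)) * G := by rw [h7]; field_simp
          _ ≤ _ := by
              gcongr
              exact rpow_neg_half_scale_le hr0 h2 h3
      rcases le_total s 1 with hs1' | hs1'
      · exact (h5 _ (by positivity) (h4.1 hs1')).trans_le (hF0 s hs hs1' y (hball hy))
      · exact (h5 _ (by positivity) (h4.2 hs1' hsT)).trans_le (hF1 s hs1' y (hball hy))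
  -- Each bump bound holds only up to its own exceptional set, so centres range over a countable
  -- dense set. Allowing them the wider cone `p_l ≥ θ|p|/2` lets every relevant `x` be approximated
  -- by a centre.
  obtain ⟨S, hSc, hSd⟩ := TopologicalSpace.exists_countable_dense (Eucl n)
  have hR₂ : 4 * R ≤ R₂ := le_max_right _ _
  refine ⟨η / 8, by positivity, 2 * R₂, by linarith, ?_⟩
  have hall : ∀ᶠ x in ℱ, ∀ p ∈ S, R₂ ≤ ‖p‖ → θ / 2 * ‖p‖ ≤ p l →
      x ∈ halfSpaceExterior l R →
        η * ‖p‖ * (1 - ‖x - p‖ ^ 2 / (θ * ‖p‖ / 4) ^ 2) ^ 3 ≤ u x := by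
    rw [eventually_countable_ball hSc]
    intro p _
    by_cases h1 : R₂ ≤ ‖p‖ ∧ θ / 2 * ‖p‖ ≤ p l
    · filter_upwards [hbump p h1.1 h1.2] with x hx _ _ hxD using hx hxD
    · exact Eventually.of_forall fun x ha hb => absurd ⟨ha, hb⟩ h1
  filter_upwards [hall] with x hx hxR hxl
  have hx0 : 0 < ‖x‖ := by linarith
  have hxD : x ∈ halfSpaceExterior l R := ⟨by linarith [mul_pos hθ hx0], by linarith⟩
  obtain ⟨p, hpS, hpd⟩ := hSd.exists_dist_lt x (show 0 < θ * ‖x‖ / 16 by positivity)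
  rw [dist_eq_norm] at hpd
  have h1 : |x l - p l| ≤ ‖x - p‖ := by simpa using abs_coord_le_norm l (x - p)
  have h2 := abs_le.1 (h1.trans hpd.le)
  have h3 := abs_le.1 ((abs_norm_sub_norm_le x p).trans hpd.le)
  have h4 : θ * ‖x‖ / 16 ≤ ‖x‖ / 64 := by nlinarith
  have h5 := hx p hpS (by linarith) (by nlinarith) hxD
  have hp0 : 0 < ‖p‖ := by linarith
  refine le_trans ?_ h5
  have h6 : ‖x - p‖ ≤ θ * ‖p‖ / 4 / 2 := by nlinarith
  have h7 : ‖x - p‖ ^ 2 / (θ * ‖p‖ / 4) ^ 2 ≤ 1 / 4 := by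
    rw [div_le_iff₀ (by positivity)]
    calc ‖x - p‖ ^ 2 ≤ (θ * ‖p‖ / 4 / 2) ^ 2 := by gcongr
      _ = _ := by ring
  have h8 : (3 / 4 : ℝ) ^ 3 ≤ (1 - ‖x - p‖ ^ 2 / (θ * ‖p‖ / 4) ^ 2) ^ 3 := by
    gcongr
    linarith
  calc η / 8 * ‖x‖ ≤ η * ‖p‖ * (3 / 4) ^ 3 := by nlinarith
    _ ≤ _ := by gcongr

/-! ### The linear barrier and the contradiction at infinity. -/

/-- The barrier `ε (x_l log (L / |x|) + x_l² / |x| - κ |x|) - N`. -/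
noncomputable def linearBarrier {n : ℕ} (l : Fin n) (ε κ L N : ℝ) (y : Eucl n) : ℝ :=
  ε * (y l * ((‖y‖ ^ 2) ^ (0 : ℝ) * (Real.log L + (-1 / 2) * Real.log (‖y‖ ^ 2))) +
    (y l ^ 2 * (‖y‖ ^ 2) ^ (-1 / 2 : ℝ) + (-κ) * (‖y‖ ^ 2) ^ (1 / 2 : ℝ))) - N

theorem sq_rpow_neg_half' {r : ℝ} (hr : 0 < r) : (r ^ 2) ^ (-1 / 2 : ℝ) = r⁻¹ := by
  simpa using sq_rpow_neg_half hr 1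

theorem sq_rpow_half {r : ℝ} (hr : 0 < r) : (r ^ 2) ^ (1 / 2 : ℝ) = r := by
  rw [← Real.sqrt_eq_rpow, Real.sqrt_sq hr.le]

theorem linearBarrier_eq {n : ℕ} (l : Fin n) (ε κ N : ℝ) {L : ℝ} (hL : 0 < L) {y : Eucl n}
    (hy : y ≠ 0) :
    linearBarrier l ε κ L N y =
      ε * (y l * Real.log (L / ‖y‖) + y l ^ 2 / ‖y‖ - κ * ‖y‖) - N := by
  have hr : 0 < ‖y‖ := norm_pos_iff.2 hy
  rw [linearBarrier, sq_rpow_neg_half' hr, sq_rpow_half hr, Real.log_pow,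
    Real.log_div hL.ne' hr.ne', Real.rpow_zero]
  push_cast
  ring

theorem contDiffAt_linearBarrier_parts {n : ℕ} (l : Fin n) (L : ℝ) {x : Eucl n} (hx : x ≠ 0) :
    ContDiffAt ℝ 2 (fun y : Eucl n => y l * ((‖y‖ ^ 2) ^ (0 : ℝ) *
      (Real.log L + (-1 / 2) * Real.log (‖y‖ ^ 2)))) x ∧
    ContDiffAt ℝ 2 (fun y : Eucl n => y l ^ 2 * (‖y‖ ^ 2) ^ (-1 / 2 : ℝ)) x ∧
    ContDiffAt ℝ 2 (fun y : Eucl n => (‖y‖ ^ 2) ^ (1 / 2 : ℝ)) x := by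
  refine ⟨(contDiffAt_logBarrier_parts l hx _ _ _ 0).1,
    (contDiffAt_logBarrier_parts l hx 0 0 0 _).2, ?_⟩
  have := contDiffAt_normSq_rpow_mul hx (1 / 2) 1 0
  simpa only [zero_mul, add_zero, mul_one] using this

theorem contDiffAt_linearBarrier {n : ℕ} (l : Fin n) (ε κ L N : ℝ) {x : Eucl n} (hx : x ≠ 0) :
    ContDiffAt ℝ 2 (linearBarrier l ε κ L N) x := by
  obtain ⟨h1, h2, h3⟩ := contDiffAt_linearBarrier_parts l L hx
  exact (contDiffAt_const.mul (h1.add (h2.add (contDiffAt_const.mul h3)))).sub contDiffAt_const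

theorem neg_laplacian_linearBarrier {n : ℕ} (l : Fin n) (ε κ L N : ℝ) {x : Eucl n} (hx : x ≠ 0) :
    -Laplacian.laplacian (linearBarrier l ε κ L N) x =
      ε / ‖x‖ * ((n * (x l / ‖x‖) + (n + 1) * (x l / ‖x‖) ^ 2 - 2) + κ * (n - 1)) := by
  have hr : 0 < ‖x‖ := norm_pos_iff.2 hx
  obtain ⟨h1, h2, h3⟩ := contDiffAt_linearBarrier_parts l L hx
  have h4 : Laplacian.laplacian (linearBarrier l ε κ L N) x = _ :=
    laplacian_sub_const (contDiffAt_const.mul (h1.add (h2.add (contDiffAt_const.mul h3)))) N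
  rw [h4, laplacian_const_mul ε (h1.add (h2.add (contDiffAt_const.mul h3))),
    laplacian_fun_add h1 (h2.add (contDiffAt_const.mul h3)),
    laplacian_fun_add h2 (contDiffAt_const.mul h3), laplacian_const_mul (-κ) h3,
    laplacian_coord_mul_rpow_log l hx, laplacian_coord_sq_mul_rpow l hx, laplacian_normSq_rpow l hx]
  have e1 : (0 : ℝ) - 1 = -((2 : ℕ) : ℝ) / 2 := by norm_num
  have e2 : (-1 / 2 : ℝ) - 1 = -((3 : ℕ) : ℝ) / 2 := by norm_num
  have e3 : (1 / 2 : ℝ) - 1 = -1 / 2 := by norm_num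
  rw [e1, e2, e3, sq_rpow_neg_half hr, sq_rpow_neg_half hr, sq_rpow_neg_half' hr]
  field_simp
  ring

theorem min_rpow_le {a b z k : ℝ} (ha : 0 < a) (h1 : a ≤ z) (h2 : z ≤ b) :
    min (a ^ k) (b ^ k) ≤ z ^ k := by
  rcases le_total 0 k with hk | hk
  · exact (min_le_left _ _).trans (Real.rpow_le_rpow ha.le h1 hk)
  · exact (min_le_right _ _).trans (Real.rpow_le_rpow_of_nonpos (by linarith) h2 hk)

theorem coord_le_norm {n : ℕ} (l : Fin n) (x : Eucl n) : x l ≤ ‖x‖ :=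
  (le_abs_self _).trans (abs_coord_le_norm l x)

theorem log_div_anti {L R r : ℝ} (hL : 0 < L) (hR : 0 < R) (hr : R ≤ r) :
    Real.log (L / r) ≤ Real.log (L / R) :=
  Real.log_le_log (div_pos hL (by linarith)) (by gcongr)

/-- The subtracted constant absorbs the logarithmic term for `|x| ≤ 2R`, and for `x_l ≥ 0` beyond
`L` that term is nonpositive. With `κ = θ²` the term `-κ|x|` cancels the quadratic term off the
cone. On the cone only `ε|x|` survives, which the linear lower bound on `u` will dominate. -/
theorem linearBarrier_outside {n : ℕ} (l : Fin n) {ε θ L R : ℝ} (hε : 0 ≤ ε) (hθ : 0 < θ)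
    (hR : 1 ≤ R) (hθR : 4 ≤ θ ^ 2 * R) (hRL : R ≤ L) {x : Eucl n}
    (hxD : x ∈ halfSpaceExterior l R) (hxK : ¬ (0 ≤ x l ∧ 2 * R ≤ ‖x‖ ∧ ‖x‖ ≤ L)) :
    linearBarrier l ε (θ ^ 2) L (ε * (2 * R * Real.log (L / R))) x ≤ 0 ∨
      (θ * ‖x‖ ≤ x l ∧
        linearBarrier l ε (θ ^ 2) L (ε * (2 * R * Real.log (L / R))) x ≤ ε * ‖x‖) := by
  obtain ⟨hx1, hx2⟩ := hxD
  have hr0 : 0 < ‖x‖ := by linarith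
  have hL : 0 < L := by linarith
  have hv : 0 ≤ Real.log (L / R) :=
    Real.log_nonneg (by rw [le_div_iff₀] <;> linarith)
  have hκr : 4 ≤ θ ^ 2 * ‖x‖ := hθR.trans (by gcongr)
  have hxle := coord_le_norm l x
  have hanti := log_div_anti hL (by linarith) hx2.le
  rw [linearBarrier_eq l ε (θ ^ 2) _ hL (norm_pos_iff.1 hr0), ← mul_sub]
  generalize Real.log (L / R) = v at *
  rcases lt_or_ge (x l) 0 with h0 | h0
  · left
    -- In the strip beyond `L` both factors are negative, but `|x_l| < 1` and `log (|x|/L) ≤ |x|/L`.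
    -- Half of `κ|x|` pays for this; the other half, at least 2, pays for `x_l²/|x| ≤ 1`.
    have h1 : x l * Real.log (L / ‖x‖) ≤ θ ^ 2 * ‖x‖ / 2 := by
      rcases le_or_gt 0 (Real.log (L / ‖x‖)) with h2 | h2
      · linarith [mul_nonpos_of_nonpos_of_nonneg h0.le h2]
      · have h3 : -Real.log (L / ‖x‖) ≤ ‖x‖ / L := by
          rw [← Real.log_inv, inv_div]
          linarith [Real.log_le_sub_one_of_pos (div_pos hr0 hL)]
        have h4 : ‖x‖ / L ≤ θ ^ 2 * ‖x‖ / 2 := by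
          rw [div_le_iff₀ hL]
          have h5 : 2 ≤ θ ^ 2 * L := by nlinarith
          calc ‖x‖ = ‖x‖ / 2 * 2 := by ring
            _ ≤ ‖x‖ / 2 * (θ ^ 2 * L) := by gcongr
            _ = _ := by ring
        have h6 : x l * Real.log (L / ‖x‖) ≤ -Real.log (L / ‖x‖) := by
          have := mul_nonneg_of_nonpos_of_nonpos (show -(x l + 1) ≤ 0 by linarith) h2.le
          linarith
        linarith
    have h2 : x l ^ 2 / ‖x‖ ≤ 1 := by
      rw [div_le_one hr0]
      nlinarith
    have h3 : 0 ≤ 2 * R * v := by positivity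
    exact mul_nonpos_of_nonneg_of_nonpos hε (by linarith)
  · have h1 : x l * Real.log (L / ‖x‖) ≤ 2 * R * v := by
      rcases le_or_gt ‖x‖ (2 * R) with h2 | h2
      · calc x l * Real.log (L / ‖x‖) ≤ x l * v := by gcongr
          _ ≤ _ := by gcongr; linarith
      · have h3 : L < ‖x‖ := by
          by_contra h4
          exact hxK ⟨h0, h2.le, not_lt.1 h4⟩
        have h4 : Real.log (L / ‖x‖) ≤ 0 :=
          Real.log_nonpos (by positivity) ((div_le_one hr0).2 h3.le)
        have h5 : 0 ≤ 2 * R * v := by positivity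
        exact (mul_nonpos_of_nonneg_of_nonpos h0 h4).trans h5
    rcases lt_or_ge (x l) (θ * ‖x‖) with h3 | h3
    · left
      have h4 : x l ^ 2 / ‖x‖ ≤ θ ^ 2 * ‖x‖ := by
        rw [div_le_iff₀ hr0]
        calc x l ^ 2 ≤ (θ * ‖x‖) ^ 2 := by gcongr
          _ = _ := by ring
      exact mul_nonpos_of_nonneg_of_nonpos hε (by linarith)
    · right
      have h4 : x l ^ 2 / ‖x‖ ≤ ‖x‖ := by
        rw [div_le_iff₀ hr0, ← sq]
        gcongr
      refine ⟨h3, ?_⟩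
      gcongr
      linarith

theorem linearBarrier_le {n : ℕ} (l : Fin n) {ε κ L R : ℝ} (hε : 0 ≤ ε) (hκ : 0 ≤ κ)
    (hR : 0 < R) (hRL : R ≤ L) {x : Eucl n} (hx : R ≤ ‖x‖) (h0 : 0 ≤ x l) :
    linearBarrier l ε κ L (ε * (2 * R * Real.log (L / R))) x ≤
      (ε * Real.log (L / R) + ε) * ‖x‖ := by
  have hr0 : 0 < ‖x‖ := by linarith
  have hL : 0 < L := by linarith
  have hv : 0 ≤ Real.log (L / R) :=
    Real.log_nonneg (by rw [le_div_iff₀] <;> linarith)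
  have hxle := coord_le_norm l x
  have hanti := log_div_anti hL hR hx
  rw [linearBarrier_eq l ε κ _ hL (norm_pos_iff.1 hr0), ← mul_sub]
  have h4 : x l ^ 2 / ‖x‖ ≤ ‖x‖ := by
    rw [div_le_iff₀ hr0, ← sq]
    gcongr
  have h5 : x l * Real.log (L / ‖x‖) ≤ ‖x‖ * Real.log (L / R) :=
    (mul_le_mul_of_nonneg_left hanti h0).trans (by gcongr)
  have h6 : 0 ≤ κ * ‖x‖ := by positivity
  have h7 : 0 ≤ 2 * R * Real.log (L / R) := by positivity
  calc _ ≤ ε * (‖x‖ * Real.log (L / R) + ‖x‖) := by gcongr; linarith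
    _ = _ := by ring

/-- At `x_l ≥ 4R` the logarithmic term is at least `4R (log (L/R) - 3)`, about twice the subtracted
constant; the 3 bounds `log 8`, the loss from `|x| ≤ 8R`. -/
theorem le_linearBarrier {n : ℕ} (l : Fin n) {ε θ L R : ℝ} (hε : 0 ≤ ε) (hθ : 0 ≤ θ)
    (hθ4 : θ ≤ 1 / 4) (hR : 0 < R) (hL : 0 < L) (hv : 3 ≤ Real.log (L / R)) {x : Eucl n}
    (hxl : 4 * R ≤ x l) (hxr : ‖x‖ ≤ 8 * R) :
    ε * (2 * R * Real.log (L / R) - 12 * R) ≤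
      linearBarrier l ε (θ ^ 2) L (ε * (2 * R * Real.log (L / R))) x := by
  have hxle := coord_le_norm l x
  have hr0 : 0 < ‖x‖ := by linarith
  rw [linearBarrier_eq l ε (θ ^ 2) _ hL (norm_pos_iff.1 hr0), ← mul_sub]
  have h1 : Real.log (L / R) - 3 ≤ Real.log (L / ‖x‖) := by
    have h8 : Real.log 8 ≤ 3 := by
      rw [show (8 : ℝ) = 2 ^ 3 by norm_num, Real.log_pow]
      have := Real.log_two_lt_d9
      push_cast
      linarith
    have h9 : Real.log (L / (8 * R)) ≤ Real.log (L / ‖x‖) :=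
      log_div_anti hL hr0 hxr
    have h10 : Real.log (L / (8 * R)) = Real.log (L / R) - Real.log 8 := by
      rw [Real.log_div hL.ne' (by positivity), Real.log_div hL.ne' (by positivity),
        Real.log_mul (by norm_num) (by positivity)]
      ring
    linarith
  have h2 : 4 * R * (Real.log (L / R) - 3) ≤ x l * Real.log (L / ‖x‖) := by
    have : 0 ≤ Real.log (L / R) - 3 := by linarith
    have : 0 ≤ x l := by linarith
    gcongr
  have h3 : θ ^ 2 * ‖x‖ ≤ x l ^ 2 / ‖x‖ := by
    rw [le_div_iff₀ hr0]
    calc θ ^ 2 * ‖x‖ * ‖x‖ = (θ * ‖x‖) ^ 2 := by ring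
      _ ≤ x l ^ 2 := by
        gcongr
        calc θ * ‖x‖ ≤ 1 / 4 * (8 * R) := by gcongr
          _ ≤ _ := by linarith
  exact mul_le_mul_of_nonneg_left (by linarith) hε

/-- Letting `L` grow exponentially makes `ε = M / log (L/R)` as small as needed, while `ε log (L/R)`
keeps the value `M`. -/
theorem exists_linearBarrier_params {R η m M A : ℝ} (hR : 0 < R) (hη : 0 < η) (hm : 0 < m)
    (hM : 0 < M) (hA : 0 < A) :
    ∃ ε L : ℝ, 0 < ε ∧ ε ≤ 1 ∧ ε ≤ η ∧ ε * A ≤ m ∧ R ≤ L ∧ 3 ≤ Real.log (L / R) ∧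
      ε * Real.log (L / R) = M := by
  have h1 : 0 < M / η := by positivity
  have h2 : 0 < M * A / m := by positivity
  set v : ℝ := 3 + M + M / η + M * A / m
  have hv1 : M / η ≤ v := by simp only [v]; linarith
  have hv2 : M * A / m ≤ v := by simp only [v]; linarith
  have hv3 : 3 + M ≤ v := by simp only [v]; linarith
  have hv : 0 < v := by linarith
  have hlog : Real.log (R * Real.exp v / R) = v := by
    rw [mul_div_cancel_left₀ _ hR.ne', Real.log_exp]
  refine ⟨M / v, R * Real.exp v, by positivity, ?_, ?_, ?_, ?_, ?_, ?_⟩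
  · rw [div_le_one hv]; linarith
  · rw [div_le_iff₀ hη] at hv1
    rw [div_le_iff₀ hv]; linarith
  · rw [div_le_iff₀ hm] at hv2
    rw [div_mul_eq_mul_div, div_le_iff₀ hv]; linarith
  · exact le_mul_of_one_le_right hR.le (Real.one_le_exp hv.le)
  · rw [hlog]; linarith
  · rw [hlog]; exact div_mul_cancel₀ _ hv.ne'

/-- If the source is critical at infinity and the function grows at least linearly in cones,
the comparison with `linearBarrier` makes it larger than any constant. -/
theorem IsComparisonSupersolution.le_of_linear_le {n : ℕ} (hn : 2 ≤ n) {ℱ : Filter (Eucl n)}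
    {l : Fin n} {R₀ R γ c η M : ℝ} {F : ℝ → Eucl n → ℝ} {u : Eucl n → ℝ}
    (hS : IsComparisonSupersolution ℱ l R₀ F u) (hRR : R₀ < R)
    (hRn : 16 * (n : ℝ) ^ 2 ≤ R) (hη : 0 < η) (hRη : 1 / η ≤ R)
    (hF : ∀ s, 0 < s → ∀ x ∈ halfSpaceExterior l R, 0 < F s x) (hc : 0 < c)
    (hF1 : ∀ s, 1 ≤ s → ∀ x ∈ halfSpaceExterior l R, c * ‖x‖ ^ (-γ) * s ^ (γ - 1) ≤ F s x)
    (hlin : ∀ᶠ x in ℱ, R ≤ ‖x‖ → 1 / (2 * n) * ‖x‖ ≤ x l → η * ‖x‖ ≤ u x) (hM : 0 < M) :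
    ∀ᶠ x in ℱ, 4 * R ≤ x l → ‖x‖ ≤ 8 * R → R * (2 * M - 12) ≤ u x := by
  have hn' : (2 : ℝ) ≤ n := by exact_mod_cast hn
  have hR : 1 ≤ R := by nlinarith
  have hpos : ∀ᶠ x in ℱ, x ∈ halfSpaceExterior l R → 0 < u x :=
    hS.pos.mono fun x hx hxD => hx (halfSpaceExterior_anti l hRR.le hxD)
  obtain ⟨θ₀, hθ₀def⟩ : ∃ θ₀ : ℝ, θ₀ = 1 / (2 * n) := ⟨_, rfl⟩
  have hθ₀ : 0 < θ₀ := by rw [hθ₀def]; positivity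
  have hθ₀4 : θ₀ ≤ 1 / 4 := by
    rw [hθ₀def]
    apply one_div_le_one_div_of_le <;> linarith
  -- With `θ₀ = 1/(2n)` this is the origin of the requirement `R ≥ 16 n²`.
  have hκR : 4 ≤ θ₀ ^ 2 * R := by
    have : θ₀ ^ 2 * (16 * (n : ℝ) ^ 2) = 4 := by rw [hθ₀def]; field_simp; norm_num
    nlinarith [sq_nonneg θ₀]
  -- The contribution of `-κ|x|` to `-Δ` stays below the margin `1/2` of `angular_source_neg`.
  have hκn : θ₀ ^ 2 * (n - 1) ≤ 1 / 4 := by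
    have : θ₀ ^ 2 * (2 * n) = θ₀ := by rw [hθ₀def]; field_simp
    nlinarith
  rw [← hθ₀def] at hlin
  obtain ⟨m, hmdef⟩ : ∃ m, m = c * min (η ^ (γ - 1)) ((M + 1) ^ (γ - 1)) := ⟨_, rfl⟩
  have hm : 0 < m := by rw [hmdef]; positivity
  obtain ⟨ε, L, hε, hε1, hεη, hεm, hRL, hv3, hεv⟩ := exists_linearBarrier_params
    (R := R) (A := 2 * n + 1) (by linarith) hη hm hM (by positivity)
  have hL : 0 < L := by linarith
  have hne : ∀ x : Eucl n, R < ‖x‖ → x ≠ 0 := fun x hx => norm_pos_iff.1 (by linarith)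
  have hcomp := hS.comparison R hRR.le
    (linearBarrier l ε (θ₀ ^ 2) L (ε * (2 * R * Real.log (L / R))))
    {x | 0 ≤ x l ∧ 2 * R ≤ ‖x‖ ∧ ‖x‖ ≤ L}
    (fun x hx => (contDiffAt_linearBarrier l ε _ L _ (hne x hx.2)).contDiffWithinAt)
    (isCompact_halfAnnulus l _ _)
    (fun x hx => ⟨by linarith [hx.1], by linarith [hx.2.1]⟩) ?_ ?_
  · filter_upwards [hcomp] with x hx hxl hxr
    have hxD : x ∈ halfSpaceExterior l R := ⟨by linarith, by linarith [coord_le_norm l x]⟩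
    refine le_trans ?_ (hx hxD)
    refine le_trans ?_ (le_linearBarrier l hε.le hθ₀.le hθ₀4 (by linarith) hL hv3 hxl hxr)
    calc R * (2 * M - 12) ≤ 2 * R * M - 12 * R * ε := by nlinarith
      _ = _ := by rw [← hεv]; ring
  · filter_upwards [hpos, hlin] with x hx hxlin hxD hxK
    rcases linearBarrier_outside l hε.le hθ₀ hR hκR hRL hxD hxK with h1 | ⟨h1, h2⟩
    · exact h1.trans (hx hxD).le
    · exact h2.trans ((by gcongr : ε * ‖x‖ ≤ η * ‖x‖).trans (hxlin hxD.2.le h1))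
  · filter_upwards [hpos, hlin] with x hx hxlin hxK hlt
    obtain ⟨h0, h1, h2⟩ := hxK
    have hxD : x ∈ halfSpaceExterior l R := ⟨by linarith, by linarith⟩
    have hr0 : 0 < ‖x‖ := by linarith
    have hu := hx hxD
    have hθ0 : 0 ≤ x l / ‖x‖ := by positivity
    rw [neg_laplacian_linearBarrier l ε _ L _ (hne x hxD.2)]
    rcases lt_or_ge (x l / ‖x‖) θ₀ with hθ | hθ
    · have h3 := angular_source_neg hn hθ0 (by rwa [← hθ₀def])
      refine lt_of_le_of_lt ?_ (hF _ hu x hxD)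
      exact mul_nonpos_of_nonneg_of_nonpos (by positivity) (by linarith)
    · have h3 := angular_source_le (n := n) hθ0 (coord_div_norm_le_one l x)
      have hulow : η * ‖x‖ ≤ u x := hxlin hxD.2.le (by rwa [le_div_iff₀ hr0] at hθ)
      have hu1 : 1 ≤ u x := by
        rw [div_le_iff₀ hη] at hRη
        nlinarith
      have huup : u x ≤ (M + 1) * ‖x‖ := by
        refine hlt.le.trans ((linearBarrier_le l hε.le (sq_nonneg θ₀) (by linarith) hRL
          hxD.2.le h0).trans ?_)
        rw [hεv]
        gcongr
      refine lt_of_lt_of_le ?_ (hF1 _ hu1 x hxD)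
      -- Contact bounds `u/|x|` by `M + 1` and the cone estimate bounds it below by `η`. Both ends
      -- are needed because `γ - 1` may have either sign. Criticality at infinity turns the source
      -- bound into `c (u/|x|)^(γ-1) / |x|`.
      have h4 : min (η ^ (γ - 1)) ((M + 1) ^ (γ - 1)) ≤ (u x / ‖x‖) ^ (γ - 1) :=
        min_rpow_le hη ((le_div_iff₀ hr0).2 hulow) ((div_le_iff₀ hr0).2 huup)
      calc _ < ε / ‖x‖ * (2 * n + 1) := mul_lt_mul_of_pos_left (by linarith) (by positivity)
        _ = ε * (2 * n + 1) / ‖x‖ := by ring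
        _ ≤ c * (u x / ‖x‖) ^ (γ - 1) / ‖x‖ := by
            refine div_le_div_of_nonneg_right (hεm.trans ?_) hr0.le
            rw [hmdef]
            exact mul_le_mul_of_nonneg_left h4 hc.le
        _ = _ := by
            rw [Real.div_rpow hu.le hr0.le, Real.rpow_neg hr0.le, Real.rpow_sub_one hr0.ne']
            field_simp

/-- Nonexistence of positive supersolutions satisfying the comparison principle, for sources which
are at least critical at zero and at infinity. -/
theorem IsComparisonSupersolution.false {n : ℕ} (hn : 2 ≤ n) {ℱ : Filter (Eucl n)}
    [CountableInterFilter ℱ] {l : Fin n} {R₀ γ c : ℝ} {F : ℝ → Eucl n → ℝ} {u : Eucl n → ℝ}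
    (hS : IsComparisonSupersolution ℱ l R₀ F u) (hγ : γ < 2)
    (hF : ∀ s, 0 < s → ∀ x ∈ halfSpaceExterior l R₀, 0 < F s x) (hc : 0 < c)
    (hF0 : ∀ s, 0 < s → s ≤ 1 → ∀ x ∈ halfSpaceExterior l R₀,
      c * ‖x‖ ^ (-γ) * s ^ (((n : ℝ) + 1 - γ) / ((n : ℝ) - 1)) ≤ F s x)
    (hF1 : ∀ s, 1 ≤ s → ∀ x ∈ halfSpaceExterior l R₀, c * ‖x‖ ^ (-γ) * s ^ (γ - 1) ≤ F s x)
    (hfreq : ∀ U : Set (Eucl n), IsOpen U → U.Nonempty → U ⊆ halfSpaceExterior l R₀ →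
      ∃ᶠ x in ℱ, x ∈ U) : False := by
  set R : ℝ := max 1 (R₀ + 1)
  have hR : 1 ≤ R := le_max_left _ _
  have hRR : R₀ < R := by linarith [le_max_right 1 (R₀ + 1)]
  have hsub := halfSpaceExterior_anti l hRR.le
  obtain ⟨η, hη, R₁, hR₁, hlin⟩ := hS.exists_linear_le hn hγ hRR hR
    (fun s hs x hx => hF s hs x (hsub hx)) hc (fun s hs hs1 x hx => hF0 s hs hs1 x (hsub hx))
    (fun s hs x hx => hF1 s hs x (hsub hx))
  set R₂ : ℝ := max R₁ (max (16 * (n : ℝ) ^ 2) (1 / η))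
  have hR₂ : R₁ ≤ R₂ := le_max_left _ _
  have hRR₂ : R₀ < R₂ := by linarith
  have hsub₂ := halfSpaceExterior_anti l hRR₂.le
  have key : ∀ k : ℕ, ∀ᶠ x in ℱ, 4 * R₂ ≤ x l → ‖x‖ ≤ 8 * R₂ →
      R₂ * (2 * ((k : ℝ) + 1) - 12) ≤ u x := fun k =>
    hS.le_of_linear_le hn hRR₂ ((le_max_left _ _).trans (le_max_right _ _)) hη
      ((le_max_right _ _).trans (le_max_right _ _))
      (fun s hs x hx => hF s hs x (hsub₂ hx)) hc (fun s hs x hx => hF1 s hs x (hsub₂ hx))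
      (hlin.mono fun x hx h1 h2 => hx (hR₂.trans h1) h2) (by positivity)
  -- The region does not depend on `M`, so one of its points satisfies all the bounds `key k`, which
  -- no real value `u x` can do.
  have hU : ∃ᶠ x in ℱ, x ∈ {x : Eucl n | 4 * R₂ < x l ∧ ‖x‖ < 8 * R₂} := by
    refine hfreq _ ?_ ?_ ?_
    · exact (isOpen_lt continuous_const (continuous_coord l)).inter
        (isOpen_lt continuous_norm continuous_const)
    · refine ⟨EuclideanSpace.single l (6 * R₂), ?_, ?_⟩
      · simp; linarith
      · rw [PiLp.norm_single, Real.norm_eq_abs, abs_of_pos (by linarith)]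
        linarith
    · intro x hx
      have := coord_le_norm l x
      exact ⟨by linarith [hx.1], by linarith [hx.1]⟩
  obtain ⟨x, ⟨h1, h2⟩, h3⟩ := (hU.and_eventually (eventually_countable_forall.2 key)).exists
  obtain ⟨k, hk⟩ := exists_nat_gt (|u x| / R₂ + 12)
  have h4 := h3 k h1.le h2.le
  have hR₂0 : 0 < R₂ := by linarith
  have h5 : 0 ≤ |u x| / R₂ := by positivity
  have h6 : |u x| / R₂ < 2 * ((k : ℝ) + 1) - 12 := by linarith
  rw [div_lt_iff₀ hR₂0] at h6
  linarith [le_abs_self (u x)]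

/-! ### Cutoffs; comparison for viscosity and classical supersolutions. -/

theorem ContDiff.two_of_infty {n : ℕ} {χ : Eucl n → ℝ} (h : ContDiff ℝ ∞ χ) : ContDiff ℝ 2 χ :=
  contDiff_infty.1 h 2

theorem IsCompact.exists_contDiff_cutoff {n : ℕ} {K D : Set (Eucl n)} (hK : IsCompact K)
    (hD : IsOpen D) (hKD : K ⊆ D) :
    ∃ χ : Eucl n → ℝ, ContDiff ℝ ∞ χ ∧ HasCompactSupport χ ∧ tsupport χ ⊆ D ∧
      (∀ᶠ x in 𝓝ˢ K, χ x = 1) ∧ ∀ x, χ x ∈ Icc (0 : ℝ) 1 := by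
  obtain ⟨K', hK', hKK', hK'D⟩ := exists_compact_between hK hD hKD
  obtain ⟨χ, h1, h2, h3⟩ := exists_contMDiffMap_one_nhds_of_subset_interior
    (n := ⊤) (modelWithCornersSelf ℝ (Eucl n)) hK.isClosed hKK'
  have hsub : tsupport χ ⊆ K' := closure_minimal
    (fun x hx => by by_contra h; exact hx (h2 x h)) hK'.isClosed
  exact ⟨χ, χ.contMDiff.contDiff, hK'.of_isClosed_subset (isClosed_tsupport _) hsub,
    hsub.trans hK'D, h1, h3⟩

theorem ContDiffOn.contDiff_cutoff_mul {n : ℕ} {D : Set (Eucl n)} {φ χ : Eucl n → ℝ}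
    (hφ : ContDiffOn ℝ 2 φ D) (hD : IsOpen D) (hχ : ContDiff ℝ ∞ χ) (hsupp : tsupport χ ⊆ D) :
    ContDiff ℝ 2 (fun x => χ x * φ x) := by
  rw [contDiff_iff_contDiffAt]
  intro x
  by_cases hx : x ∈ tsupport χ
  · exact hχ.two_of_infty.contDiffAt.mul
      (hφ.contDiffAt (hD.mem_nhds (hsupp hx)))
  · refine (contDiffAt_const (c := (0 : ℝ))).congr_of_eventuallyEq ?_
    filter_upwards [notMem_tsupport_iff_eventuallyEq.1 hx] with y hy
    simp [hy]

theorem laplacian_cutoff_mul {n : ℕ} {K : Set (Eucl n)} {φ χ : Eucl n → ℝ}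
    (hχ : ∀ᶠ x in 𝓝ˢ K, χ x = 1) {x : Eucl n} (hx : x ∈ K) :
    Laplacian.laplacian (fun x => χ x * φ x) x = Laplacian.laplacian φ x := by
  have h1 : (fun x => χ x * φ x) =ᶠ[𝓝 x] φ := by
    filter_upwards [hχ.filter_mono (nhds_le_nhdsSet hx)] with y hy
    simp [hy]
  exact (InnerProductSpace.laplacian_congr_nhds h1).self_of_nhds

/-- Viscosity supersolutions satisfy the comparison principle everywhere. -/
theorem IsViscositySupersolution.comparisonOn {n : ℕ} {Ω D : Set (Eucl n)} {f : ℝ → Eucl n → ℝ}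
    {u : Eucl n → ℝ} (hu : IsViscositySupersolution Ω f u) (hD : IsOpen D) (hDΩ : D ⊆ Ω) :
    ComparisonOn ⊤ D f u := by
  intro φ K hφ hK hKD hout hcontact
  rw [eventually_top] at *
  by_contra hcon
  push Not at hcon
  obtain ⟨x, hxD, hx⟩ := hcon
  have hxK : x ∈ K := by
    by_contra h
    exact absurd (hout x hxD h) (not_le.2 hx)
  have hlsc : LowerSemicontinuousOn (fun y => u y - φ y) K := by
    have h1 : LowerSemicontinuousOn u K := fun y hy =>
      (hu.lowerSemicontinuousOn y (hDΩ (hKD hy))).mono (hKD.trans hDΩ)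
    have h2 : ContinuousOn (fun y => -φ y) K := (hφ.continuousOn.mono hKD).neg
    simpa only [sub_eq_add_neg] using h1.add h2.lowerSemicontinuousOn
  obtain ⟨x₀, hx₀K, hmin⟩ := hlsc.exists_isMinOn ⟨x, hxK⟩ hK
  have hx₀neg : u x₀ - φ x₀ < 0 := lt_of_le_of_lt (hmin hxK) (by linarith)
  -- Test functions must be `C²` on all of `Ω`, whereas `φ` is so only on `D`. The negative minimum
  -- over `K` is a local minimum because `u - φ ≥ 0` on `D` off `K`.
  obtain ⟨χ, hχ, -, hχD, hχ1, -⟩ := hK.exists_contDiff_cutoff hD hKD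
  have hlocal : IsLocalMin (fun y => u y - χ y * φ y) x₀ := by
    filter_upwards [hD.mem_nhds (hKD hx₀K), hχ1.filter_mono (nhds_le_nhdsSet hx₀K)] with y hyD hy1
    rw [hy1, hχ1.self_of_nhdsSet x₀ hx₀K, one_mul, one_mul]
    by_cases hyK : y ∈ K
    · exact hmin hyK
    · linarith [hout y hyD hyK]
  have h1 := hu.le_neg_laplacian x₀ (hDΩ (hKD hx₀K)) _
    (hφ.contDiff_cutoff_mul hD hχ hχD).contDiffOn hlocal
  rw [laplacian_cutoff_mul hχ1 hx₀K] at h1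
  exact absurd h1 (not_le.2 (hcontact x₀ hx₀K (by linarith)))

/-- At a touching point `u - φ` has a local minimum, so `Δu ≥ Δφ` there. -/
theorem IsClassicalSupersolution.isViscositySupersolution {n : ℕ} {Ω : Set (Eucl n)}
    {f : ℝ → Eucl n → ℝ} {u : Eucl n → ℝ} (hΩ : IsOpen Ω) (hu : IsClassicalSupersolution Ω f u) :
    IsViscositySupersolution Ω f u where
  lowerSemicontinuousOn := hu.contDiffOn.continuousOn.lowerSemicontinuousOn
  le_neg_laplacian x₀ hx₀ φ hφ hmin := by
    have h1 := hu.contDiffOn.contDiffAt (hΩ.mem_nhds hx₀)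
    have h2 := hφ.contDiffAt (hΩ.mem_nhds hx₀)
    have h3 := hmin.laplacian_nonneg (h1.sub h2)
    have h4 : Laplacian.laplacian (fun x => u x - φ x) x₀ = _ := h1.laplacian_sub h2
    linarith [hu.le_neg_laplacian x₀ hx₀]

theorem LowerSemicontinuousOn.exists_pos_le {n : ℕ} {u : Eucl n → ℝ} {K : Set (Eucl n)}
    (hu : LowerSemicontinuousOn u K) (hK : IsCompact K) (hpos : ∀ x ∈ K, 0 < u x) :
    ∃ c > 0, ∀ x ∈ K, c ≤ u x := by
  rcases K.eq_empty_or_nonempty with rfl | hne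
  · exact ⟨1, one_pos, by simp⟩
  · obtain ⟨x₀, hx₀, hmin⟩ := hu.exists_isMinOn hne hK
    exact ⟨u x₀, hpos x₀ hx₀, fun x hx => hmin hx⟩

/-! ### Bounds on the nonlinearity and reduction to the shifted half space. -/

theorem ComparisonOn.translate {n : ℕ} {ℱ : Filter (Eucl n)} {D : Set (Eucl n)}
    {F : ℝ → Eucl n → ℝ} {u : Eucl n → ℝ} (p : Eucl n)
    (h : ComparisonOn ℱ ((fun x => x - p) ⁻¹' D) F u) :
    ComparisonOn (ℱ.map fun x => x - p) D (fun s y => F s (y + p)) (fun y => u (y + p)) := by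
  intro φ K hφ hK hKD hout hcontact
  simp only [eventually_map, sub_add_cancel] at *
  refine h (fun x => φ (x - p)) ((fun x => x - p) ⁻¹' K) ?_ ?_ ?_ hout ?_
  · exact hφ.comp (contDiff_id.sub contDiff_const).contDiffOn fun x hx => hx
  · have : (fun x => x - p) ⁻¹' K = (fun x => x + p) '' K := by
      ext x
      constructor
      · exact fun hx => ⟨x - p, hx, by simp⟩
      · rintro ⟨y, hy, rfl⟩
        simpa using hy
    rw [this]
    exact hK.image (continuous_id.add continuous_const)
  · exact fun x hx => hKD hx
  · filter_upwards [hcontact] with x hx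
    rw [laplacian_comp_sub]
    exact hx

theorem exists_pos_le_of_eventually_lt_zero {h : ℝ → ℝ} (hc : ContinuousOn h (Ioi 0))
    (hpos : ∀ s, 0 < s → 0 < h s) {a : ℝ} (ha : 0 < a) (hev : ∀ᶠ s in 𝓝[>] (0 : ℝ), a < h s) :
    ∃ c > 0, ∀ s, 0 < s → s ≤ 1 → c ≤ h s := by
  obtain ⟨s₀, hs₀, hs₀'⟩ := mem_nhdsGT_iff_exists_Ioo_subset.1 hev
  have hs₀ : 0 < s₀ := hs₀
  obtain ⟨c, hc0, hc1⟩ := (isCompact_Icc (a := s₀) (b := 1)).exists_forall_le' (a := 0)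
    (hc.mono fun s hs => hs₀.trans_le hs.1) (fun s hs => hpos s (hs₀.trans_le hs.1))
  refine ⟨min a c, lt_min ha hc0, fun s hs hs1 => ?_⟩
  rcases lt_or_ge s s₀ with h1 | h1
  · exact (min_le_left _ _).trans (hs₀' ⟨hs, h1⟩).le
  · exact (min_le_right _ _).trans (hc1 s ⟨h1, hs1⟩)

theorem exists_pos_le_of_eventually_lt_atTop {h : ℝ → ℝ} (hc : ContinuousOn h (Ioi 0))
    (hpos : ∀ s, 0 < s → 0 < h s) {a : ℝ} (ha : 0 < a) (hev : ∀ᶠ s in atTop, a < h s) :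
    ∃ c > 0, ∀ s, 1 ≤ s → c ≤ h s := by
  obtain ⟨s₀, hs₀⟩ := eventually_atTop.1 hev
  obtain ⟨c, hc0, hc1⟩ := (isCompact_Icc (a := 1) (b := s₀)).exists_forall_le' (a := 0)
    (hc.mono fun s hs => zero_lt_one.trans_le hs.1) (fun s hs => hpos s (zero_lt_one.trans_le hs.1))
  refine ⟨min a c, lt_min ha hc0, fun s hs1 => ?_⟩
  rcases le_total s₀ s with h1 | h1
  · exact (min_le_left _ _).trans (hs₀ s h1).le
  · exact (min_le_right _ _).trans (hc1 s ⟨hs1, h1⟩)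

theorem exists_pos_eventually_lt_of_liminf_pos {h : ℝ → ℝ} {ℓ : Filter ℝ}
    (hl : (0 : EReal) < liminf (fun s => (h s : EReal)) ℓ) :
    ∃ a > 0, ∀ᶠ s in ℓ, a < h s := by
  obtain ⟨a, ha0, ha⟩ := EReal.lt_iff_exists_real_btwn.1 hl
  exact ⟨a, by exact_mod_cast ha0,
    (eventually_lt_of_lt_liminf ha).mono fun s hs => by exact_mod_cast hs⟩

/-- The two lower limits bound the nonlinearity from below by critical powers. -/
theorem exists_critical_lower_bound {σ γ : ℝ} {g : ℝ → ℝ} (hg_cont : ContinuousOn g (Ioi 0))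
    (hg_pos : ∀ s, 0 < s → 0 < g s)
    (hg_zero : (0 : EReal) < liminf (fun s : ℝ => ((s ^ (-σ) * g s : ℝ) : EReal)) (𝓝[>] 0))
    (hg_top : (0 : EReal) < liminf (fun s : ℝ => ((s ^ (1 - γ) * g s : ℝ) : EReal)) atTop) :
    ∃ c > 0, (∀ s, 0 < s → s ≤ 1 → c * s ^ σ ≤ g s) ∧ ∀ s, 1 ≤ s → c * s ^ (γ - 1) ≤ g s := by
  have hc : ∀ k : ℝ, ContinuousOn (fun s : ℝ => s ^ k * g s) (Ioi 0) := fun k =>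
    (continuousOn_id.rpow_const fun s hs => Or.inl (ne_of_gt hs)).mul hg_cont
  have hp : ∀ k s : ℝ, 0 < s → 0 < s ^ k * g s := fun k s hs =>
    mul_pos (Real.rpow_pos_of_pos hs k) (hg_pos s hs)
  obtain ⟨a, ha, ha'⟩ := exists_pos_eventually_lt_of_liminf_pos hg_zero
  obtain ⟨b, hb, hb'⟩ := exists_pos_eventually_lt_of_liminf_pos hg_top
  obtain ⟨c₁, hc₁, h1⟩ := exists_pos_le_of_eventually_lt_zero (hc _) (hp _) ha ha'
  obtain ⟨c₂, hc₂, h2⟩ := exists_pos_le_of_eventually_lt_atTop (hc _) (hp _) hb hb'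
  refine ⟨min c₁ c₂, lt_min hc₁ hc₂, fun s hs hs1 => ?_, fun s hs1 => ?_⟩
  · have h3 := (min_le_left c₁ c₂).trans (h1 s hs hs1)
    rw [Real.rpow_neg hs.le, inv_mul_eq_div, le_div_iff₀ (by positivity)] at h3
    exact h3
  · have hs : 0 < s := by linarith
    have h3 := (min_le_right c₁ c₂).trans (h2 s hs1)
    rw [show 1 - γ = -(γ - 1) by ring, Real.rpow_neg hs.le, inv_mul_eq_div,
      le_div_iff₀ (by positivity)] at h3
    exact h3

theorem upperHalfSpace_eq {n : ℕ} {l : Fin n} (hl : (l : ℕ) + 1 = n) :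
    upperHalfSpace n = {x | 0 < x l} := by
  ext x
  constructor
  · rintro ⟨i, hi, hx⟩
    have : i = l := Fin.ext (by omega)
    exact this ▸ hx
  · exact fun hx => ⟨l, hl, hx⟩

/-- Nonexistence in the exterior half space for any notion of supersolution satisfying the
comparison principle. -/
theorem false_of_comparisonOn {n : ℕ} (hn : 2 ≤ n) {γ : ℝ} (hγ : γ < 2) {r₀ : ℝ} (hr₀ : 0 < r₀)
    {g : ℝ → ℝ} {c : ℝ} (hc : 0 < c) (hg_pos : ∀ s, 0 < s → 0 < g s)
    (hg0 : ∀ s, 0 < s → s ≤ 1 → c * s ^ (((n : ℝ) + 1 - γ) / ((n : ℝ) - 1)) ≤ g s)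
    (hg1 : ∀ s, 1 ≤ s → c * s ^ (γ - 1) ≤ g s)
    {ℱ : Filter (Eucl n)} [CountableInterFilter ℱ] {u : Eucl n → ℝ}
    (hpos : ∀ᶠ x in ℱ, x ∈ upperHalfSpace n \ Metric.closedBall 0 r₀ → 0 < u x)
    (hlow : ∀ K, IsCompact K → K ⊆ upperHalfSpace n \ Metric.closedBall 0 r₀ →
      ∃ c > 0, ∀ᶠ x in ℱ, x ∈ K → c ≤ u x)
    (hcomp : ∀ D, IsOpen D → D ⊆ upperHalfSpace n \ Metric.closedBall 0 r₀ →
      ComparisonOn ℱ D (fun s x => ‖x‖ ^ (-γ) * g s) u)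
    (hfreq : ∀ U : Set (Eucl n), IsOpen U → U.Nonempty →
      U ⊆ upperHalfSpace n \ Metric.closedBall 0 r₀ → ∃ᶠ x in ℱ, x ∈ U) : False := by
  set l : Fin n := ⟨n - 1, by omega⟩
  rw [upperHalfSpace_eq (l := l) (by simp [l]; omega)] at *
  -- Shifting by the unit normal puts the closed half annuli `{y_l ≥ 0, R ≤ |y| ≤ R'}` compactly
  -- inside the domain, where `u` has positive lower bounds. Beyond radius `2 + r₀` the shift
  -- changes the norm by at most a factor 2, costing `2 ^ (-|γ|)` in the source.
  set p : Eucl n := EuclideanSpace.single l 1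
  have hpl : p l = 1 := by simp [p]
  have hpn : ‖p‖ = 1 := by simp [p]
  have hcont : Continuous fun x : Eucl n => x - p := continuous_id.sub continuous_const
  have hnorm : ∀ y : Eucl n, 2 + r₀ < ‖y‖ → ‖y‖ / 2 ≤ ‖y + p‖ ∧ ‖y + p‖ ≤ 2 * ‖y‖ ∧
      r₀ < ‖y + p‖ := by
    intro y hy
    have h1 := norm_add_le y p
    have h2 := norm_sub_le (y + p) p
    rw [add_sub_cancel_right] at h2
    refine ⟨?_, ?_, ?_⟩ <;> linarith
  have hsub : ∀ y ∈ halfSpaceExterior l (2 + r₀),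
      y + p ∈ {x : Eucl n | 0 < x l} \ Metric.closedBall 0 r₀ := by
    intro y hy
    refine ⟨?_, ?_⟩
    · change 0 < (y + p) l
      rw [PiLp.add_apply, hpl]
      linarith [hy.1]
    · simpa using (hnorm y hy.2).2.2
  have hS : IsComparisonSupersolution (ℱ.map fun x => x - p) l (2 + r₀)
      (fun s y => ‖y + p‖ ^ (-γ) * g s) (fun y => u (y + p)) := by
    refine ⟨?_, fun K hK hKD => ?_, fun R hR => ?_⟩
    · rw [eventually_map]
      filter_upwards [hpos] with x hx hxD
      simpa using hx (by simpa using hsub _ hxD)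
    · obtain ⟨c', hc', h⟩ := hlow ((fun y => y + p) '' K)
        (hK.image (continuous_id.add continuous_const))
        (by rintro _ ⟨y, hy, rfl⟩; exact hsub y (hKD hy))
      refine ⟨c', hc', ?_⟩
      rw [eventually_map]
      filter_upwards [h] with x hx hxK
      simpa using hx ⟨x - p, hxK, by simp⟩
    · refine ComparisonOn.translate (F := fun s x => ‖x‖ ^ (-γ) * g s) (u := u) p (hcomp _ ?_ ?_)
      · exact ((isOpen_lt continuous_const (continuous_coord l)).inter
          (isOpen_lt continuous_const continuous_norm)).preimage hcont
      · intro x hx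
        simpa using hsub _ (halfSpaceExterior_anti l hR hx)
  have hnormγ : ∀ y ∈ halfSpaceExterior l (2 + r₀),
      2 ^ (-|γ|) * ‖y‖ ^ (-γ) ≤ ‖y + p‖ ^ (-γ) := fun y hy =>
    rpow_neg_half_scale_le (by linarith [hy.2]) (hnorm y hy.2).1 (hnorm y hy.2).2.1
  refine hS.false (c := 2 ^ (-|γ|) * c) hn hγ (fun s hs y hy => ?_) (by positivity)
    (fun s hs hs1 y hy => ?_) (fun s hs1 y hy => ?_) fun U hU hUne hUsub => ?_
  · exact mul_pos (Real.rpow_pos_of_pos (hr₀.trans (hnorm y hy.2).2.2) _) (hg_pos s hs)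
  · calc _ = 2 ^ (-|γ|) * ‖y‖ ^ (-γ) * (c * s ^ (((n : ℝ) + 1 - γ) / ((n : ℝ) - 1))) := by ring
      _ ≤ _ := mul_le_mul (hnormγ y hy) (hg0 s hs hs1) (by positivity) (by positivity)
  · have hs : 0 < s := by linarith
    calc _ = 2 ^ (-|γ|) * ‖y‖ ^ (-γ) * (c * s ^ (γ - 1)) := by ring
      _ ≤ _ := mul_le_mul (hnormγ y hy) (hg1 s hs1) (by positivity) (by positivity)
  · rw [frequently_map]
    refine hfreq ((fun x => x - p) ⁻¹' U) (hU.preimage hcont) ?_ ?_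
    · obtain ⟨y, hy⟩ := hUne
      exact ⟨y + p, by simpa using hy⟩
    · intro x hx
      simpa using hsub _ (hUsub hx)

theorem isOpen_upperHalfSpace_diff {n : ℕ} (hn : 2 ≤ n) (r₀ : ℝ) :
    IsOpen (upperHalfSpace n \ Metric.closedBall (0 : Eucl n) r₀) := by
  rw [upperHalfSpace_eq (l := (⟨n - 1, by omega⟩ : Fin n)) (by simp; omega)]
  exact (isOpen_lt continuous_const (continuous_coord _)).sdiff Metric.isClosed_closedBall

/-! ### Partial derivatives and Green's identities. -/

/-- The `i`-th partial derivative. -/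
noncomputable def partialDeriv {n : ℕ} (i : Fin n) (φ : Eucl n → ℝ) (x : Eucl n) : ℝ :=
  fderiv ℝ φ x (EuclideanSpace.single i 1)

theorem laplacian_eq_sum_partialDeriv {n : ℕ} {φ : Eucl n → ℝ} {x : Eucl n}
    (h : ContDiffAt ℝ 2 φ x) :
    Laplacian.laplacian φ x = ∑ i, partialDeriv i (partialDeriv i φ) x :=
  laplacian_eq_sum_fderiv h

theorem ContDiff.partialDeriv {n : ℕ} {φ : Eucl n → ℝ} {k m : WithTop ℕ∞} (h : ContDiff ℝ k φ)
    (hm : m + 1 ≤ k) (i : Fin n) : ContDiff ℝ m (partialDeriv i φ) :=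
  (h.fderiv_right hm).clm_apply contDiff_const

theorem ContDiff.continuous_laplacian {n : ℕ} {φ : Eucl n → ℝ} (h : ContDiff ℝ 2 φ) :
    Continuous (fun x => Laplacian.laplacian φ x) := by
  have : (fun x => Laplacian.laplacian φ x) =
      fun x => ∑ i, _root_.partialDeriv i (_root_.partialDeriv i φ) x :=
    funext fun x => laplacian_eq_sum_partialDeriv h.contDiffAt
  rw [this]
  refine continuous_finsetSum _ fun i _ => ?_
  exact ((h.partialDeriv (m := 1) (by norm_num) i).partialDeriv (m := 0) (by norm_num) i).continuous

theorem tsupport_partialDeriv_subset {n : ℕ} (i : Fin n) (φ : Eucl n → ℝ) :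
    tsupport (partialDeriv i φ) ⊆ tsupport φ := tsupport_fderiv_apply_subset ℝ _

theorem HasCompactSupport.partialDeriv {n : ℕ} {φ : Eucl n → ℝ} (h : HasCompactSupport φ)
    (i : Fin n) : HasCompactSupport (partialDeriv i φ) := h.fderiv_apply ℝ _

theorem laplacian_eq_zero_of_notMem_tsupport {n : ℕ} {φ : Eucl n → ℝ} {x : Eucl n}
    (hx : x ∉ tsupport φ) : Laplacian.laplacian φ x = 0 := by
  have h1 : φ =ᶠ[𝓝 x] fun _ => 0 := notMem_tsupport_iff_eventuallyEq.1 hx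
  rw [(InnerProductSpace.laplacian_congr_nhds h1).self_of_nhds,
    laplacian_eq_sum_fderiv contDiffAt_const]
  simp

theorem HasCompactSupport.laplacian {n : ℕ} {φ : Eucl n → ℝ} (h : HasCompactSupport φ) :
    HasCompactSupport (fun x => Laplacian.laplacian φ x) :=
  h.mono' fun x hx => by
    by_contra h
    exact hx (laplacian_eq_zero_of_notMem_tsupport h)

theorem integrable_mul_of_hasCompactSupport {n : ℕ} {v w : Eucl n → ℝ} (hv : Continuous v)
    (hw : Continuous w) (hc : HasCompactSupport w) : Integrable (fun x => v x * w x) :=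
  (hv.mul hw).integrable_of_hasCompactSupport hc.mul_left

theorem integral_mul_partialDeriv {n : ℕ} {v w : Eucl n → ℝ} (hv : ContDiff ℝ 1 v)
    (hw : ContDiff ℝ 1 w) (hc : HasCompactSupport w) (i : Fin n) :
    ∫ x, v x * partialDeriv i w x = -∫ x, partialDeriv i v x * w x := by
  refine integral_mul_fderiv_eq_neg_fderiv_mul_of_integrable ?_ ?_ ?_
    (fun x _ => hv.differentiable (by norm_num) x) (fun x _ => hw.differentiable (by norm_num) x)
  · exact integrable_mul_of_hasCompactSupport
      (hv.partialDeriv (m := 0) (by norm_num) i).continuous hw.continuous hc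
  · exact integrable_mul_of_hasCompactSupport hv.continuous
      (hw.partialDeriv (m := 0) (by norm_num) i).continuous (hc.partialDeriv i)
  · exact integrable_mul_of_hasCompactSupport hv.continuous hw.continuous hc

/-- Green's first identity. -/
theorem integral_sum_partialDeriv_mul {n : ℕ} {v w : Eucl n → ℝ} (hv : ContDiff ℝ 2 v)
    (hw : ContDiff ℝ 1 w) (hc : HasCompactSupport w) :
    ∫ x, ∑ i, partialDeriv i v x * partialDeriv i w x =
      -∫ x, Laplacian.laplacian v x * w x := by
  have h1 : ∀ i, ContDiff ℝ 1 (partialDeriv i v) := hv.partialDeriv (by norm_num)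
  have h2 : ∀ x, Laplacian.laplacian v x * w x =
      ∑ i, partialDeriv i (partialDeriv i v) x * w x := fun x => by
    rw [laplacian_eq_sum_partialDeriv hv.contDiffAt, Finset.sum_mul]
  simp only [h2]
  rw [integral_finsetSum, integral_finsetSum, ← Finset.sum_neg_distrib]
  · exact Finset.sum_congr rfl fun i _ => integral_mul_partialDeriv (h1 i) hw hc i
  · exact fun i _ => integrable_mul_of_hasCompactSupport
      ((h1 i).partialDeriv (m := 0) (by norm_num) i).continuous hw.continuous hc
  · exact fun i _ => integrable_mul_of_hasCompactSupport (h1 i).continuous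
      (hw.partialDeriv (m := 0) (by norm_num) i).continuous (hc.partialDeriv i)

/-- Green's second identity. -/
theorem integral_mul_laplacian {n : ℕ} {v w : Eucl n → ℝ} (hv : ContDiff ℝ 2 v)
    (hw : ContDiff ℝ 2 w) (hc : HasCompactSupport w) :
    ∫ x, v x * Laplacian.laplacian w x = ∫ x, Laplacian.laplacian v x * w x := by
  have h1 : ∀ i, ContDiff ℝ 1 (partialDeriv i w) := hw.partialDeriv (by norm_num)
  have hv1 : ContDiff ℝ 1 v := hv.of_le (by norm_num)
  have hw1 : ContDiff ℝ 1 w := hw.of_le (by norm_num)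
  have h2 : ∀ x, v x * Laplacian.laplacian w x =
      ∑ i, v x * partialDeriv i (partialDeriv i w) x := fun x => by
    rw [laplacian_eq_sum_partialDeriv hw.contDiffAt, Finset.mul_sum]
  have h3 := integral_sum_partialDeriv_mul hv hw1 hc
  rw [integral_finsetSum] at h3
  · simp only [h2]
    rw [integral_finsetSum]
    · rw [← neg_eq_iff_eq_neg.2 h3, ← Finset.sum_neg_distrib]
      exact Finset.sum_congr rfl fun i _ =>
        integral_mul_partialDeriv hv1 (h1 i) (hc.partialDeriv i) i
    · exact fun i _ => integrable_mul_of_hasCompactSupport hv.continuous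
        ((h1 i).partialDeriv (m := 0) (by norm_num) i).continuous
        ((hc.partialDeriv i).partialDeriv i)
  · exact fun i _ => integrable_mul_of_hasCompactSupport
      (hv.partialDeriv (m := 0) (by norm_num) i).continuous (h1 i).continuous (hc.partialDeriv i)

/-! ### The concave truncation and Laplacians of convolutions. -/

theorem hasDerivAt_min_zero_pow {k : ℕ} (s : ℝ) :
    HasDerivAt (fun s : ℝ => min s 0 ^ (k + 2)) ((k + 2 : ℕ) * min s 0 ^ (k + 1)) s := by
  rcases lt_trichotomy s 0 with hs | rfl | hs
  · have h1 : (fun s : ℝ => min s 0 ^ (k + 2)) =ᶠ[𝓝 s] fun s => s ^ (k + 2) := by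
      filter_upwards [gt_mem_nhds hs] with t ht
      rw [min_eq_left ht.le]
    rw [min_eq_left hs.le]
    exact (hasDerivAt_pow (k + 2) s).congr_of_eventuallyEq h1
  · have h1 : (fun s : ℝ => min s 0 ^ (k + 2)) =O[𝓝 0] fun s : ℝ => s ^ (k + 2) := by
      refine Asymptotics.IsBigO.of_bound 1 (Eventually.of_forall fun t => ?_)
      rw [norm_pow, norm_pow, one_mul]
      gcongr
      rw [Real.norm_eq_abs, Real.norm_eq_abs]
      rcases le_total t 0 with h | h
      · rw [min_eq_left h]
      · rw [min_eq_right h]; simp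
    have h2 : HasFDerivAt (fun s : ℝ => min s 0 ^ (k + 2)) (0 : ℝ →L[ℝ] ℝ) 0 := by
      have h3 : (fun s : ℝ => min s 0 ^ (k + 2)) =O[𝓝 0] fun s : ℝ => ‖s - 0‖ ^ (k + 2) := by
        refine h1.trans (Asymptotics.IsBigO.of_bound 1 (Eventually.of_forall fun t => ?_))
        simp
      exact h3.hasFDerivAt (by omega)
    simpa using h2.hasDerivAt
  · have h1 : (fun s : ℝ => min s 0 ^ (k + 2)) =ᶠ[𝓝 s] fun _ => 0 := by
      filter_upwards [lt_mem_nhds hs] with t ht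
      rw [min_eq_right ht.le]
      simp
    rw [min_eq_right hs.le]
    simpa using (hasDerivAt_const s (0 : ℝ)).congr_of_eventuallyEq h1

theorem contDiff_min_zero_pow_two : ContDiff ℝ 1 (fun s : ℝ => min s 0 ^ 2) := by
  rw [contDiff_one_iff_deriv]
  refine ⟨fun s => (hasDerivAt_min_zero_pow (k := 0) s).differentiableAt, ?_⟩
  have : deriv (fun s : ℝ => min s 0 ^ 2) = fun s => ((0 + 2 : ℕ) : ℝ) * min s 0 ^ (0 + 1) :=
    funext fun s => (hasDerivAt_min_zero_pow (k := 0) s).deriv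
  rw [this]
  fun_prop

theorem contDiff_min_zero_pow_three : ContDiff ℝ 2 (fun s : ℝ => min s 0 ^ 3) := by
  rw [show (2 : WithTop ℕ∞) = 1 + 1 by norm_num, contDiff_succ_iff_deriv]
  refine ⟨fun s => (hasDerivAt_min_zero_pow (k := 1) s).differentiableAt, by simp, ?_⟩
  have : deriv (fun s : ℝ => min s 0 ^ 3) = fun s => ((1 + 2 : ℕ) : ℝ) * min s 0 ^ (1 + 1) :=
    funext fun s => (hasDerivAt_min_zero_pow (k := 1) s).deriv
  rw [this]
  exact contDiff_const.mul contDiff_min_zero_pow_two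

/-- Superharmonicity is preserved under the concave map `s ↦ (min s 0)³`. -/
theorem laplacian_min_zero_pow_three_le {n : ℕ} {v : Eucl n → ℝ} (hv : ContDiff ℝ 2 v)
    (x : Eucl n) :
    Laplacian.laplacian (fun y => min (v y) 0 ^ 3) x ≤
      3 * min (v x) 0 ^ 2 * Laplacian.laplacian v x := by
  have h0 : ContDiff ℝ 2 (fun y => min (v y) 0 ^ 3) := contDiff_min_zero_pow_three.comp hv
  rw [laplacian_eq_sum_partialDeriv h0.contDiffAt, laplacian_eq_sum_partialDeriv hv.contDiffAt,
    Finset.mul_sum]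
  refine Finset.sum_le_sum fun i _ => ?_
  have h1 : partialDeriv i (fun y => min (v y) 0 ^ 3) =
      fun y => 3 * min (v y) 0 ^ 2 * partialDeriv i v y := by
    funext y
    have h2 := (hasDerivAt_min_zero_pow (k := 1) (v y)).comp_hasFDerivAt y
      (hv.differentiable (by norm_num) y).hasFDerivAt
    have h3 : fderiv ℝ (fun y => min (v y) 0 ^ 3) y = _ := h2.fderiv
    rw [partialDeriv, h3]
    norm_num [partialDeriv]
  have h2 : ContDiff ℝ 1 (partialDeriv i v) := hv.partialDeriv (by norm_num) i
  have h3 := ((hasDerivAt_min_zero_pow (k := 0) (v x)).comp_hasFDerivAt x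
    (hv.differentiable (by norm_num) x).hasFDerivAt).const_mul 3
  have h4 := h3.mul (h2.differentiable (by norm_num) x).hasFDerivAt
  have h5 : fderiv ℝ (fun y => 3 * min (v y) 0 ^ 2 * partialDeriv i v y) x = _ := h4.fderiv
  rw [h1, partialDeriv, h5]
  have h6 : min (v x) 0 ≤ 0 := min_le_right _ _
  simp only [partialDeriv, add_apply, smul_apply,
    smul_eq_mul, Function.comp_apply]
  have h7 := mul_nonpos_of_nonpos_of_nonneg h6
    (sq_nonneg (fderiv ℝ v x (EuclideanSpace.single i 1)))
  norm_num
  linarith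

theorem partialDeriv_comp_neg {n : ℕ} {φ : Eucl n → ℝ} (hφ : Differentiable ℝ φ) (i : Fin n)
    (x : Eucl n) : partialDeriv i (fun y => φ (-y)) x = -partialDeriv i φ (-x) := by
  have h1 : HasFDerivAt (fun y : Eucl n => φ (-y)) _ x :=
    (hφ (-x)).hasFDerivAt.comp x (hasFDerivAt_id x).neg
  rw [partialDeriv, h1.fderiv]
  simp [partialDeriv]

theorem laplacian_comp_neg {n : ℕ} {φ : Eucl n → ℝ} (hφ : ContDiff ℝ 2 φ) (x : Eucl n) :
    Laplacian.laplacian (fun y => φ (-y)) x = Laplacian.laplacian φ (-x) := by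
  have h0 : ContDiff ℝ 2 (fun y => φ (-y)) := hφ.comp contDiff_neg
  rw [laplacian_eq_sum_partialDeriv h0.contDiffAt, laplacian_eq_sum_partialDeriv hφ.contDiffAt]
  refine Finset.sum_congr rfl fun i _ => ?_
  have h2 : ContDiff ℝ 1 (fun y => -partialDeriv i φ y) := (hφ.partialDeriv (by norm_num) i).neg
  rw [funext fun y => partialDeriv_comp_neg (hφ.differentiable (by norm_num)) i y,
    partialDeriv_comp_neg (h2.differentiable (by norm_num)), partialDeriv, partialDeriv,
    fderiv_fun_neg]
  simp

/-- The Laplacian of the convolution with a `C²` kernel falls on the kernel. -/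
theorem laplacian_convolution {n : ℕ} {ρ w : Eucl n → ℝ} (hρ : ContDiff ℝ 2 ρ)
    (hc : HasCompactSupport ρ) (hw : LocallyIntegrable w) (x : Eucl n) :
    Laplacian.laplacian (convolution ρ w (ContinuousLinearMap.lsmul ℝ ℝ) volume) x =
      ∫ t, Laplacian.laplacian ρ (x - t) * w t := by
  have hstep : ∀ (κ : Eucl n → ℝ) (i : Fin n), ContDiff ℝ 1 κ → HasCompactSupport κ →
      partialDeriv i (convolution κ w (ContinuousLinearMap.lsmul ℝ ℝ) volume) =
        convolution (partialDeriv i κ) w (ContinuousLinearMap.lsmul ℝ ℝ) volume := by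
    intro κ i hκ hκc
    funext y
    have hflip : ∀ κ' : Eucl n → ℝ,
        convolution κ' w (ContinuousLinearMap.lsmul ℝ ℝ) volume =
          convolution w κ' (ContinuousLinearMap.lsmul ℝ ℝ).flip volume := fun κ' =>
      (convolution_flip (ContinuousLinearMap.lsmul ℝ ℝ)).symm
    rw [hflip, hflip, partialDeriv,
      (hκc.hasFDerivAt_convolution_right _ hw hκ y).fderiv,
      convolution_precompR_apply _ hw (hκc.fderiv ℝ) (hκ.continuous_fderiv (by norm_num))]
    rfl
  have h1 : ∀ i, ContDiff ℝ 1 (partialDeriv i ρ) := hρ.partialDeriv (by norm_num)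
  rw [laplacian_eq_sum_partialDeriv
    (hc.contDiff_convolution_left (ContinuousLinearMap.lsmul ℝ ℝ) hρ hw).contDiffAt]
  have h2 : ∀ i, partialDeriv i (partialDeriv i
      (convolution ρ w (ContinuousLinearMap.lsmul ℝ ℝ) volume)) x =
      ∫ t, partialDeriv i (partialDeriv i ρ) (x - t) * w t := fun i => by
    rw [hstep ρ i (hρ.of_le (by norm_num)) hc, hstep _ i (h1 i) (hc.partialDeriv i),
      convolution_eq_swap]
    simp
  simp only [h2]
  rw [← integral_finsetSum]
  · refine integral_congr_ae (Eventually.of_forall fun t => ?_)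
    simp only [laplacian_eq_sum_partialDeriv hρ.contDiffAt, Finset.sum_mul]
  · intro i _
    have := ((hc.partialDeriv i).partialDeriv i).convolutionExists_left
      (ContinuousLinearMap.lsmul ℝ ℝ) ((h1 i).partialDeriv (m := 0) (by norm_num) i).continuous hw x
    simpa using this.integrable_swap

/-! ### Weak supersolutions as distributional supersolutions. -/

/-- `-Δw ≥ h` in the sense of distributions in `N`. -/
def DistribLeNegLaplacian {n : ℕ} (N : Set (Eucl n)) (h w : Eucl n → ℝ) : Prop :=
  ∀ η : Eucl n → ℝ, IsTestFunctionOn N η → (∀ x, 0 ≤ η x) →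
    ∫ x, h x * η x ≤ -∫ x, w x * Laplacian.laplacian η x

theorem MeasureTheory.MemLp.integrableOn_of_isCompact {n : ℕ} {F : Type*} [NormedAddCommGroup F]
    {u : Eucl n → F} {K : Set (Eucl n)} (h : MemLp u 2 (volume.restrict K)) (hK : IsCompact K) :
    IntegrableOn u K := by
  have : IsFiniteMeasure (volume.restrict K) := ⟨by simpa using hK.measure_lt_top⟩
  exact h.integrable (by norm_num)

theorem integrable_mul_of_tsupport_subset {n : ℕ} {u η : Eucl n → ℝ} {K : Set (Eucl n)}
    (hu : IntegrableOn u K) (hK : IsCompact K) (hη : Continuous η) (hsub : tsupport η ⊆ K) :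
    Integrable (fun x => u x * η x) := by
  have h1 : IntegrableOn (fun x => u x * η x) K := hu.mul_continuousOn hη.continuousOn hK
  refine (integrableOn_iff_integrable_of_support_subset fun x hx => ?_).1 h1
  exact hsub (subset_tsupport _ (right_ne_zero_of_mul hx))

theorem IsTestFunctionOn.partialDeriv {n : ℕ} {Ω : Set (Eucl n)} {η : Eucl n → ℝ}
    (h : IsTestFunctionOn Ω η) (i : Fin n) : IsTestFunctionOn Ω (partialDeriv i η) where
  contDiff := h.contDiff.partialDeriv (by simp) i
  hasCompactSupport := h.hasCompactSupport.partialDeriv i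
  tsupport_subset := (tsupport_partialDeriv_subset i η).trans h.tsupport_subset

theorem IsTestFunctionOn.mono {n : ℕ} {Ω Ω' : Set (Eucl n)} {η : Eucl n → ℝ}
    (h : IsTestFunctionOn Ω η) (hsub : Ω ⊆ Ω') : IsTestFunctionOn Ω' η where
  contDiff := h.contDiff
  hasCompactSupport := h.hasCompactSupport
  tsupport_subset := h.tsupport_subset.trans hsub

theorem ContinuousLinearMap.apply_eq_sum_single {n : ℕ} (L : Eucl n →L[ℝ] ℝ) (v : Eucl n) :
    L v = ∑ i, v i * L (EuclideanSpace.single i 1) := by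
  have h : v = ∑ i, v i • EuclideanSpace.single i (1 : ℝ) := by
    ext j
    simp [Pi.single_apply]
  conv_lhs => rw [h]
  simp

theorem inner_gradient_eq_sum {n : ℕ} {η : Eucl n → ℝ} (v x : Eucl n) :
    inner ℝ v (gradient η x) = ∑ i, v i * partialDeriv i η x := by
  rw [real_inner_comm, gradient, InnerProductSpace.toDual_symm_apply]
  exact ContinuousLinearMap.apply_eq_sum_single _ v

/-- A weak supersolution is a supersolution in the sense of distributions. -/
theorem IsWeakSupersolution.integral_le {n : ℕ} {Ω : Set (Eucl n)} {f : ℝ → Eucl n → ℝ}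
    {u η : Eucl n → ℝ} (hu : IsWeakSupersolution Ω f u) (hη : IsTestFunctionOn Ω η)
    (hpos : ∀ x, 0 ≤ η x) :
    IntegrableOn (fun x => f (u x) x * η x) Ω ∧
      ∫ x in Ω, f (u x) x * η x ≤ -∫ x in Ω, u x * Laplacian.laplacian η x := by
  obtain ⟨V, hV, h⟩ := hu
  obtain ⟨h1, h2⟩ := h η hη hpos
  refine ⟨h1, h2.trans_eq ?_⟩
  have hK := hη.hasCompactSupport.isCompact
  have hVi : ∀ i, IntegrableOn (fun x => V x i) (tsupport η) := fun i =>
    (EuclideanSpace.proj i : Eucl n →L[ℝ] ℝ).integrable_comp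
      ((hV.memLp_gradient _ hK hη.tsupport_subset).integrableOn_of_isCompact hK)
  have hui := (hV.memLp _ hK hη.tsupport_subset).integrableOn_of_isCompact hK
  have h3 : ∀ x, u x * Laplacian.laplacian η x =
      ∑ i, u x * partialDeriv i (partialDeriv i η) x := fun x => by
    rw [laplacian_eq_sum_partialDeriv hη.contDiff.two_of_infty.contDiffAt, Finset.mul_sum]
  simp only [h3, inner_gradient_eq_sum]
  rw [integral_finsetSum, integral_finsetSum, ← Finset.sum_neg_distrib]
  · refine Finset.sum_congr rfl fun i _ => ?_
    have h4 : ∫ x in Ω, u x * partialDeriv i (partialDeriv i η) x =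
      -∫ x in Ω, V x i * partialDeriv i η x := hV.isWeakGradient _ (hη.partialDeriv i) i
    rw [h4, neg_neg]
  · intro i _
    exact (integrable_mul_of_tsupport_subset hui hK
      ((hη.partialDeriv i).partialDeriv i).contDiff.continuous
      ((tsupport_partialDeriv_subset i _).trans (tsupport_partialDeriv_subset i _))).integrableOn
  · intro i _
    exact (integrable_mul_of_tsupport_subset (hVi i) hK (hη.partialDeriv i).contDiff.continuous
      (tsupport_partialDeriv_subset i _)).integrableOn

theorem IsWeakSupersolution.integrableOn {n : ℕ} {Ω K : Set (Eucl n)} {f : ℝ → Eucl n → ℝ}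
    {u : Eucl n → ℝ} (hu : IsWeakSupersolution Ω f u) (hK : IsCompact K) (hKΩ : K ⊆ Ω) :
    IntegrableOn u K := by
  obtain ⟨V, hV, -⟩ := hu
  exact (hV.memLp K hK hKΩ).integrableOn_of_isCompact hK

/-- Measurability is extracted from the integrability clause, tested with a cutoff equal to 1 on
`K`. -/
theorem IsWeakSupersolution.aestronglyMeasurable {n : ℕ} {Ω K : Set (Eucl n)}
    {f : ℝ → Eucl n → ℝ} {u : Eucl n → ℝ} (hΩ : IsOpen Ω) (hu : IsWeakSupersolution Ω f u)
    (hK : IsCompact K) (hKΩ : K ⊆ Ω) :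
    AEStronglyMeasurable (fun x => f (u x) x) (volume.restrict K) := by
  obtain ⟨χ, h1, h2, h3, h4, h5⟩ := hK.exists_contDiff_cutoff hΩ hKΩ
  have h6 := ((hu.integral_le ⟨h1, h2, h3⟩ fun x => (h5 x).1).1.mono_set hKΩ).aestronglyMeasurable
  refine h6.congr ?_
  filter_upwards [ae_restrict_mem hK.measurableSet] with x hx
  rw [h4.self_of_nhdsSet x hx, mul_one]

/-- The truncated equation for the difference of a weak supersolution and a `C²` function. -/
theorem IsWeakSupersolution.distribLeNegLaplacian {n : ℕ} {Ω K : Set (Eucl n)}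
    {f : ℝ → Eucl n → ℝ} {u ψ : Eucl n → ℝ} (hΩ : IsOpen Ω) (hu : IsWeakSupersolution Ω f u)
    (hpos : ∀ᵐ x ∂(volume.restrict Ω), 0 < u x) (hf : ∀ s, 0 < s → ∀ x ∈ Ω, 0 < f s x)
    (hK : IsCompact K) (hKΩ : K ⊆ Ω) (hψ : ContDiff ℝ 2 ψ) {M : ℝ} (hM : 0 ≤ M) :
    DistribLeNegLaplacian K
      (fun x => K.indicator (fun x => min (f (u x) x) M) x + Laplacian.laplacian ψ x)
      (fun x => K.indicator u x - ψ x) := by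
  intro η hη hη0
  obtain ⟨h1, h2⟩ := hu.integral_le (hη.mono hKΩ) hη0
  have hηc := hη.contDiff.continuous
  have hη2 := hη.contDiff.two_of_infty
  have hΔη := hη2.continuous_laplacian
  have hsupp : ∀ {x}, x ∉ K → η x = 0 := fun {x} hx =>
    image_eq_zero_of_notMem_tsupport fun h => hx (hη.tsupport_subset h)
  have hsuppΔ : ∀ {x}, x ∉ K → Laplacian.laplacian η x = 0 := fun {x} hx =>
    laplacian_eq_zero_of_notMem_tsupport fun h => hx (hη.tsupport_subset h)
  have e1 : ∀ x, (K.indicator (fun x => min (f (u x) x) M) x + Laplacian.laplacian ψ x) * η x =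
      min (f (u x) x) M * η x + Laplacian.laplacian ψ x * η x := fun x => by
    by_cases hx : x ∈ K
    · rw [indicator_of_mem hx]; ring
    · rw [hsupp hx]; ring
  have e2 : ∀ x, (K.indicator u x - ψ x) * Laplacian.laplacian η x =
      u x * Laplacian.laplacian η x - ψ x * Laplacian.laplacian η x := fun x => by
    by_cases hx : x ∈ K
    · rw [indicator_of_mem hx]; ring
    · rw [hsuppΔ hx]; ring
  simp only [e1, e2]
  have i1 : Integrable (fun x => u x * Laplacian.laplacian η x) :=
    integrable_mul_of_tsupport_subset (hu.integrableOn hK hKΩ) hK hΔη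
      ((closure_minimal (fun x hx => by
        by_contra h; exact hx (hsuppΔ h)) hK.isClosed))
  have i2 : Integrable (fun x => ψ x * Laplacian.laplacian η x) :=
    integrable_mul_of_hasCompactSupport hψ.continuous hΔη hη.hasCompactSupport.laplacian
  have i3 : Integrable (fun x => Laplacian.laplacian ψ x * η x) :=
    integrable_mul_of_hasCompactSupport hψ.continuous_laplacian hηc hη.hasCompactSupport
  have hpos' : ∀ᵐ x ∂(volume.restrict K), 0 < f (u x) x := by
    filter_upwards [ae_restrict_of_ae_restrict_of_subset hKΩ hpos,
      ae_restrict_mem hK.measurableSet] with x hx hxK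
    exact hf _ hx _ (hKΩ hxK)
  have i4 : IntegrableOn (fun x => min (f (u x) x) M) K := by
    have : IsFiniteMeasure (volume.restrict K) := ⟨by simpa using hK.measure_lt_top⟩
    refine Integrable.of_bound (C := M) ((hu.aestronglyMeasurable hΩ hK hKΩ).inf aestronglyMeasurable_const) ?_
    filter_upwards [hpos'] with x hx
    rw [Real.norm_eq_abs, abs_of_nonneg (le_min hx.le hM)]
    exact min_le_right _ _
  have i5 : Integrable (fun x => min (f (u x) x) M * η x) :=
    integrable_mul_of_tsupport_subset i4 hK hηc hη.tsupport_subset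
  have s1 : ∀ F : Eucl n → ℝ, (∀ x, x ∉ K → F x = 0) → ∫ x in Ω, F x = ∫ x, F x := fun F hF =>
    setIntegral_eq_integral_of_forall_compl_eq_zero fun x hx => hF x fun h => hx (hKΩ h)
  rw [s1 _ fun x hx => by rw [hsupp hx, mul_zero]] at h2
  rw [s1 _ fun x hx => by rw [hsuppΔ hx, mul_zero]] at h2
  -- Truncating the source at `M` only weakens the inequality, and gives a bounded right-hand side
  -- for the later passage to the limit.
  have h3 : ∫ x, min (f (u x) x) M * η x ≤ ∫ x, f (u x) x * η x := by
    refine integral_mono i5 ?_ fun x => mul_le_mul_of_nonneg_right (min_le_left _ _) (hη0 x)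
    refine (integrableOn_iff_integrable_of_support_subset fun x hx => ?_).1 h1
    by_contra h
    exact hx (by simp only [hsupp fun h' => h (hKΩ h'), mul_zero])
  rw [integral_add i5 i3, integral_sub i1 i2, integral_mul_laplacian hψ hη2 hη.hasCompactSupport]
  linarith

/-! ### Mollification of distributional inequalities. -/

/-- The mollification of `w` by a normalized bump function. -/
noncomputable def mollify {n : ℕ} (b : ContDiffBump (0 : Eucl n)) (w : Eucl n → ℝ) : Eucl n → ℝ :=
  convolution (b.normed volume) w (ContinuousLinearMap.lsmul ℝ ℝ) volume

theorem mollify_apply {n : ℕ} (b : ContDiffBump (0 : Eucl n)) (w : Eucl n → ℝ) (x : Eucl n) :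
    mollify b w x = ∫ t, b.normed volume (x - t) * w t := by
  rw [mollify, convolution_eq_swap]
  rfl

theorem contDiff_mollify {n : ℕ} (b : ContDiffBump (0 : Eucl n)) {w : Eucl n → ℝ}
    (hw : LocallyIntegrable w) : ContDiff ℝ ∞ (mollify b w) :=
  b.hasCompactSupport_normed.contDiff_convolution_left _ b.contDiff_normed hw

theorem ContDiffBump.integrable_normed_sub_mul {n : ℕ} (b : ContDiffBump (0 : Eucl n))
    {w : Eucl n → ℝ} (hw : LocallyIntegrable w) (x : Eucl n) :
    Integrable (fun t => b.normed volume (x - t) * w t) := by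
  have := b.hasCompactSupport_normed (μ := volume).convolutionExists_left
    (ContinuousLinearMap.lsmul ℝ ℝ) b.continuous_normed hw x
  simpa using this.integrable_swap

theorem le_mollify {n : ℕ} (b : ContDiffBump (0 : Eucl n)) {w : Eucl n → ℝ}
    (hw : LocallyIntegrable w) {c : ℝ} (hc : ∀ᵐ x, c ≤ w x) (x : Eucl n) : c ≤ mollify b w x := by
  have h1 : ∫ t, b.normed volume (x - t) * c = c := by
    rw [integral_mul_const, integral_sub_left_eq_self (fun t => b.normed volume t) volume x,
      b.integral_normed, one_mul]
  rw [mollify_apply, ← h1]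
  refine integral_mono_ae (b.integrable_normed_sub_mul (locallyIntegrable_const c) x)
    (b.integrable_normed_sub_mul hw x) ?_
  filter_upwards [hc] with t ht
  exact mul_le_mul_of_nonneg_left ht (b.nonneg_normed _)

theorem mollify_neg {n : ℕ} (b : ContDiffBump (0 : Eucl n)) (w : Eucl n → ℝ) (x : Eucl n) :
    mollify b (fun y => -w y) x = -mollify b w x := by
  simp only [mollify_apply, mul_neg, integral_neg]

theorem abs_mollify_le {n : ℕ} (b : ContDiffBump (0 : Eucl n)) {w : Eucl n → ℝ}
    (hw : LocallyIntegrable w) {c : ℝ} (hc : ∀ᵐ x, |w x| ≤ c) (x : Eucl n) :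
    |mollify b w x| ≤ c := by
  have h1 : -c ≤ mollify b w x := le_mollify b hw (hc.mono fun y hy => (abs_le.1 hy).1) x
  have h2 : -c ≤ mollify b (fun y => -w y) x :=
    le_mollify b hw.neg (hc.mono fun y hy => neg_le_neg (abs_le.1 hy).2) x
  rw [mollify_neg] at h2
  exact abs_le.2 ⟨h1, neg_le_neg_iff.1 h2⟩

theorem exists_contDiffBump_seq {n : ℕ} {δ : ℝ} (hδ : 0 < δ) :
    ∃ b : ℕ → ContDiffBump (0 : Eucl n), (∀ k, (b k).rOut ≤ δ) ∧
      ∀ w : Eucl n → ℝ, LocallyIntegrable w →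
        ∀ᵐ x, Tendsto (fun k => mollify (b k) w x) atTop (𝓝 (w x)) := by
  have hpos : ∀ k : ℕ, 0 < δ / (k + 1) := fun k => by positivity
  refine ⟨fun k => ⟨δ / (k + 1) / 2, δ / (k + 1), half_pos (hpos k), half_lt_self (hpos k)⟩,
    fun k => ?_, fun w hw => ?_⟩
  · exact div_le_self hδ.le (by linarith [k.cast_nonneg (α := ℝ)])
  · refine ContDiffBump.ae_convolution_tendsto_right_of_locallyIntegrable (K := 2) ?_ ?_ hw
    · simpa [div_eq_mul_inv] using (tendsto_one_div_add_atTop_nhds_zero_nat (𝕜 := ℝ)).const_mul δ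
    · exact Eventually.of_forall fun k => by linarith

/-- A distributional inequality becomes pointwise after mollification. -/
theorem DistribLeNegLaplacian.mollify_le {n : ℕ} {N : Set (Eucl n)} {h w : Eucl n → ℝ}
    (H : DistribLeNegLaplacian N h w) (hw : LocallyIntegrable w) (b : ContDiffBump (0 : Eucl n))
    {x : Eucl n} (hx : Metric.closedBall x b.rOut ⊆ N) :
    mollify b h x ≤ -Laplacian.laplacian (mollify b w) x := by
  have hρ : ContDiff ℝ 2 (b.normed (volume : Measure (Eucl n))) := b.contDiff_normed
  have h1 : ∀ t, Laplacian.laplacian (fun t => b.normed volume (x - t)) t =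
      Laplacian.laplacian (b.normed (volume : Measure (Eucl n))) (x - t) := fun t => by
    have := laplacian_comp_sub (fun s => b.normed volume (-s)) x t
    rw [laplacian_comp_neg hρ] at this
    simpa only [neg_sub] using this
  have h2 : tsupport (fun t => b.normed volume (x - t)) ⊆ Metric.closedBall x b.rOut := by
    refine closure_minimal (fun t ht => ?_) Metric.isClosed_closedBall
    have h3 : x - t ∈ Function.support (b.normed (volume : Measure (Eucl n))) := ht
    rw [b.support_normed_eq] at h3
    rw [Metric.mem_closedBall, dist_comm, dist_eq_norm]
    exact (mem_ball_zero_iff.1 h3).le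
  -- The mollifier centred at `x` is itself an admissible test function.
  have h3 := H (fun t => b.normed volume (x - t))
    ⟨b.contDiff_normed.comp (contDiff_const.sub contDiff_id),
      (isCompact_closedBall _ _).of_isClosed_subset (isClosed_tsupport _) h2, h2.trans hx⟩
    fun t => b.nonneg_normed _
  simp only [h1] at h3
  rw [mollify, mollify, laplacian_convolution hρ b.hasCompactSupport_normed hw,
    ← mollify, mollify_apply]
  simpa only [mul_comm] using h3

/-- The concave truncation `(min w 0)³` inherits the distributional inequality. -/
theorem DistribLeNegLaplacian.integral_min_pow_three_le {n : ℕ} {N : Set (Eucl n)}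
    {h w η : Eucl n → ℝ} {B C δ : ℝ} (H : DistribLeNegLaplacian N h w)
    (hh : AEStronglyMeasurable h) (hhC : ∀ᵐ x, |h x| ≤ C) (hw : LocallyIntegrable w)
    (hwB : ∀ᵐ x, -B ≤ w x) (hη : ContDiff ℝ 2 η) (hηc : HasCompactSupport η)
    (hη0 : ∀ x, 0 ≤ η x) (hδ : 0 < δ) (hN : ∀ x ∈ tsupport η, Metric.closedBall x δ ⊆ N) :
    ∫ x, min (w x) 0 ^ 3 * Laplacian.laplacian η x ≤
      -∫ x, 3 * min (w x) 0 ^ 2 * h x * η x := by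
  obtain ⟨b, hb, hlim⟩ := exists_contDiffBump_seq (n := n) hδ
  have hhl : LocallyIntegrable h := by
    refine (locallyIntegrable_const (max C 0)).mono hh ?_
    filter_upwards [hhC] with x hx
    rw [Real.norm_eq_abs, Real.norm_eq_abs]
    exact (hx.trans (le_max_left _ _)).trans (le_abs_self _)
  have hv : ∀ k, ContDiff ℝ 2 (mollify (b k) w) := fun k => (contDiff_mollify _ hw).two_of_infty
  have hq : ∀ k, Continuous (mollify (b k) h) := fun k => (contDiff_mollify _ hhl).continuous
  have hvB : ∀ k x, -|B| ≤ min (mollify (b k) w x) 0 := fun k x =>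
    le_min ((neg_le_neg (le_abs_self B)).trans (le_mollify _ hw hwB x)) (by simp)
  have hvB' : ∀ k x, |min (mollify (b k) w x) 0| ≤ |B| := fun k x => by
    rw [abs_of_nonpos (min_le_right _ _)]
    exact neg_le.1 (hvB k x)
  -- For the smooth mollifications the chain rule and Green's identity apply classically. Mollifying
  -- preserves the bounds on `w` and `h`, so dominated convergence carries the inequality to `w`.
  have hstep : ∀ k, ∫ x, min (mollify (b k) w x) 0 ^ 3 * Laplacian.laplacian η x ≤
      -∫ x, 3 * min (mollify (b k) w x) 0 ^ 2 * mollify (b k) h x * η x := by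
    intro k
    have hv3 : ContDiff ℝ 2 (fun x => min (mollify (b k) w x) 0 ^ 3) :=
      contDiff_min_zero_pow_three.comp (hv k)
    have hcm : Continuous fun x => min (mollify (b k) w x) 0 := (hv k).continuous.min continuous_const
    rw [integral_mul_laplacian hv3 hη hηc, ← integral_neg]
    refine integral_mono (integrable_mul_of_hasCompactSupport hv3.continuous_laplacian
      hη.continuous hηc) (integrable_mul_of_hasCompactSupport (by fun_prop)
      hη.continuous hηc).neg fun x => ?_
    by_cases hx : x ∈ tsupport η
    · have h1 := H.mollify_le hw (b k)
        ((Metric.closedBall_subset_closedBall (hb k)).trans (hN x hx))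
      have h2 := laplacian_min_zero_pow_three_le (hv k) x
      have h3 : 0 ≤ 3 * min (mollify (b k) w x) 0 ^ 2 := by positivity
      have h4 := mul_le_mul_of_nonneg_left h1 h3
      show _ ≤ -(_ * η x)
      rw [← neg_mul]
      exact mul_le_mul_of_nonneg_right (by linarith) (hη0 x)
    · simp [image_eq_zero_of_notMem_tsupport hx]
  have hΔ : Integrable (fun x => Laplacian.laplacian η x) :=
    hη.continuous_laplacian.integrable_of_hasCompactSupport hηc.laplacian
  have hηi : Integrable η := hη.continuous.integrable_of_hasCompactSupport hηc
  have hlimw := hlim w hw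
  refine le_of_tendsto_of_tendsto' (tendsto_integral_of_dominated_convergence
    (fun x => |B| ^ 3 * |Laplacian.laplacian η x|) (fun k => ?_) (hΔ.abs.const_mul _)
    (fun k => Eventually.of_forall fun x => ?_) ?_)
    (tendsto_integral_of_dominated_convergence
    (fun x => 3 * |B| ^ 2 * C * |η x|) (fun k => ?_) (hηi.abs.const_mul _)
    (fun k => Eventually.of_forall fun x => ?_) ?_).neg hstep
  · exact ((((hv k).continuous.min continuous_const).pow 3).mul
      hη.continuous_laplacian).aestronglyMeasurable
  · rw [norm_mul, norm_pow]
    exact mul_le_mul_of_nonneg_right (pow_le_pow_left₀ (norm_nonneg _) (hvB' k x) _) (norm_nonneg _)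
  · filter_upwards [hlimw] with x hx
    exact ((hx.min tendsto_const_nhds).pow 3).mul_const _
  · have := (hv k).continuous
    have := hq k
    have := hη.continuous
    exact Continuous.aestronglyMeasurable (by fun_prop)
  · rw [norm_mul, norm_mul, norm_mul, norm_pow]
    have h1 := pow_le_pow_left₀ (abs_nonneg _) (hvB' k x) 2
    have h2 := abs_mollify_le (b k) hhl hhC x
    simp only [Real.norm_eq_abs, abs_of_pos (show (0 : ℝ) < 3 by norm_num)]
    gcongr
  · filter_upwards [hlimw, hlim h hhl] with x hx hx'
    exact ((((hx.min tendsto_const_nhds).pow 2).const_mul 3).mul hx').mul_const _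

/-! ### Almost-everywhere comparison for weak supersolutions. -/

theorem laplacian_const_sub_normSq {n : ℕ} (C : ℝ) (x : Eucl n) :
    Laplacian.laplacian (fun y : Eucl n => C - ‖y‖ ^ 2) x = -(2 * n) := by
  have h : ContDiff ℝ 2 (fun y : Eucl n => C - ‖y‖ ^ 2) := contDiff_const.sub (contDiff_norm_sq ℝ)
  rw [laplacian_eq_sum_of_hasDerivAt h.contDiffAt (p := fun i t => -(2 * x i + 2 * t))
    (q := fun _ => -2)]
  · simp [mul_comm]
  · intro i
    refine Eventually.of_forall fun t => ?_
    simp only [norm_add_smul_single_sq]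
    refine ((((hasDerivAt_id t).const_mul 2).mul_const (x i)).const_add (‖x‖ ^ 2)
      |>.add (hasDerivAt_pow 2 t) |>.const_sub C).congr_deriv ?_
    simp
  · intro i
    exact ((((hasDerivAt_id (0 : ℝ)).const_mul 2).const_add (2 * x i)).neg).congr_deriv (by simp)

/-- Cuts off `C - |x|²`. Testing against such a function detects a nonpositive function concentrated
on `K` without any Poincaré inequality. -/
theorem IsCompact.exists_laplacian_neg {n : ℕ} (hn : 0 < n) {K D : Set (Eucl n)}
    (hK : IsCompact K) (hD : IsOpen D) (hKD : K ⊆ D) :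
    ∃ η : Eucl n → ℝ, ContDiff ℝ 2 η ∧ HasCompactSupport η ∧ tsupport η ⊆ D ∧ (∀ x, 0 ≤ η x) ∧
      ∀ x ∈ K, Laplacian.laplacian η x < 0 := by
  obtain ⟨χ, h1, h2, h3, h4, h5⟩ := hK.exists_contDiff_cutoff hD hKD
  obtain ⟨C, hC⟩ := h2.isCompact.exists_bound_of_continuousOn (f := fun x : Eucl n => ‖x‖ ^ 2)
    (by fun_prop)
  have hsub : tsupport (fun x => χ x * (C - ‖x‖ ^ 2)) ⊆ tsupport χ :=
    closure_mono (Function.support_mul_subset_left _ _)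
  refine ⟨fun x => χ x * (C - ‖x‖ ^ 2), h1.two_of_infty.mul
    (contDiff_const.sub (contDiff_norm_sq ℝ)), h2.mul_right, hsub.trans h3, fun x => ?_,
    fun x hx => ?_⟩
  · by_cases hx : x ∈ tsupport χ
    · exact mul_nonneg (h5 x).1 (sub_nonneg.2 ((le_abs_self _).trans (hC x hx)))
    · simp [image_eq_zero_of_notMem_tsupport hx]
  · rw [laplacian_cutoff_mul h4 hx, laplacian_const_sub_normSq]
    have : (0 : ℝ) < n := by exact_mod_cast hn
    linarith

/-- Weak supersolutions satisfy the comparison principle almost everywhere. -/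
theorem IsWeakSupersolution.comparisonOn {n : ℕ} (hn : 0 < n) {Ω D : Set (Eucl n)}
    {f : ℝ → Eucl n → ℝ} {u : Eucl n → ℝ} (hΩ : IsOpen Ω) (hu : IsWeakSupersolution Ω f u)
    (hpos : ∀ᵐ x ∂(volume.restrict Ω), 0 < u x) (hf : ∀ s, 0 < s → ∀ x ∈ Ω, 0 < f s x)
    (hD : IsOpen D) (hDΩ : D ⊆ Ω) : ComparisonOn (ae volume) D f u := by
  intro φ K hφ hK hKD hout hcontact
  obtain ⟨χ, hχ, hχc, hχD, hχ1, hχ01⟩ := hK.exists_contDiff_cutoff hD hKD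
  obtain ⟨η, hη, hηc, hηD, hη0, hηK⟩ := hK.exists_laplacian_neg hn hD hKD
  obtain ⟨K₁, hK₁, hηK₁, hK₁D⟩ := exists_compact_between hηc.isCompact hD hηD
  obtain ⟨δ, hδ, hδK₁⟩ := hηc.isCompact.exists_cthickening_subset_open isOpen_interior hηK₁
  have hψ : ContDiff ℝ 2 (fun x => χ x * φ x) := hφ.contDiff_cutoff_mul hD hχ hχD
  have hψc : HasCompactSupport (fun x => χ x * φ x) := hχc.mul_right
  set ψ : Eucl n → ℝ := fun x => χ x * φ x
  obtain ⟨B, hB⟩ := hψc.exists_bound_of_continuous hψ.continuous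
  -- Truncating the source at a bound for `|Δψ|` loses nothing: `-Δψ` is below both `f(u)` at
  -- contact and `M`.
  obtain ⟨M, hM⟩ := hψc.laplacian.exists_bound_of_continuous hψ.continuous_laplacian
  have hM0 : 0 ≤ M := (norm_nonneg _).trans (hM 0)
  have hK₁Ω := hK₁D.trans hDΩ
  have H := hu.distribLeNegLaplacian hΩ hpos hf hK₁ hK₁Ω hψ hM0
  set w : Eucl n → ℝ := fun x => K₁.indicator u x - ψ x
  set h : Eucl n → ℝ := fun x =>
    K₁.indicator (fun x => min (f (u x) x) M) x + Laplacian.laplacian ψ x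
  rw [ae_restrict_iff' hΩ.measurableSet] at hpos
  have hw : LocallyIntegrable w :=
    ((hu.integrableOn hK₁ hK₁Ω).integrable_indicator hK₁.measurableSet).locallyIntegrable.sub
      hψ.continuous.locallyIntegrable
  have hh : AEStronglyMeasurable h :=
    ((aestronglyMeasurable_indicator_iff hK₁.measurableSet).2
      ((hu.aestronglyMeasurable hΩ hK₁ hK₁Ω).inf aestronglyMeasurable_const)).add
      hψ.continuous_laplacian.aestronglyMeasurable
  have hhC : ∀ᵐ x, |h x| ≤ M + M := by
    filter_upwards [hpos] with x hx
    refine (abs_add_le _ _).trans (add_le_add ?_ (hM x))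
    by_cases hxK : x ∈ K₁
    · rw [indicator_of_mem hxK, abs_of_nonneg (le_min (hf _ (hx (hK₁Ω hxK)) _ (hK₁Ω hxK)).le hM0)]
      exact min_le_right _ _
    · simpa [indicator_of_notMem hxK] using hM0
  have hwB : ∀ᵐ x, -B ≤ w x := by
    filter_upwards [hpos] with x hx
    have h1 : 0 ≤ K₁.indicator u x := by
      by_cases hxK : x ∈ K₁
      · rw [indicator_of_mem hxK]; exact (hx (hK₁Ω hxK)).le
      · rw [indicator_of_notMem hxK]
    have h2 := (abs_le.1 (hB x)).2
    show -B ≤ K₁.indicator u x - ψ x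
    linarith
  have hηK₁' : ∀ x ∈ tsupport η, x ∈ K₁ := fun x hx => interior_subset (hηK₁ hx)
  have key := H.integral_min_pow_three_le hh hhC hw hwB hη hηc hη0 hδ fun x hx =>
    (Metric.closedBall_subset_cthickening hx δ).trans (hδK₁.trans interior_subset)
  have hright : 0 ≤ ∫ x, 3 * min (w x) 0 ^ 2 * h x * η x := by
    refine integral_nonneg_of_ae ?_
    filter_upwards [hpos, hout, hcontact] with x hx hxout hxcon
    show 0 ≤ 3 * min (w x) 0 ^ 2 * h x * η x
    by_cases hxη : x ∈ tsupport η
    · rcases le_or_gt 0 (w x) with hw0 | hw0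
      · simp [min_eq_right hw0]
      · have hxD := hηD hxη
        have hxw : w x = u x - χ x * φ x := by
          show K₁.indicator u x - _ = _
          rw [indicator_of_mem (hηK₁' x hxη)]
        -- Off `K` one has `φ ≤ u`, and `0 ≤ χ ≤ 1` with `u > 0` gives `χ φ ≤ u`; hence `w < 0` only
        -- inside `K`.
        have hxK : x ∈ K := by
          by_contra hxK
          have h1 := hxout hxD hxK
          have h2 := hx (hDΩ hxD)
          have h3 : χ x * φ x ≤ χ x * u x := mul_le_mul_of_nonneg_left h1 (hχ01 x).1
          have h4 : χ x * u x ≤ 1 * u x := mul_le_mul_of_nonneg_right (hχ01 x).2 h2.le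
          linarith
        rw [hχ1.self_of_nhdsSet x hxK] at hxw
        have h1 := hxcon hxK (by linarith)
        have h2 : 0 ≤ h x := by
          show 0 ≤ K₁.indicator (fun x => min (f (u x) x) M) x + Laplacian.laplacian ψ x
          have h3 := (abs_le.1 (hM x)).1
          have h4 : Laplacian.laplacian ψ x = Laplacian.laplacian φ x := laplacian_cutoff_mul hχ1 hxK
          rw [indicator_of_mem (hηK₁' x hxη)]
          rcases min_cases (f (u x) x) M with ⟨h5, -⟩ | ⟨h5, -⟩ <;> rw [h5] <;> linarith
        have := hη0 x
        positivity
    · simp [image_eq_zero_of_notMem_tsupport hxη]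
  have hnonneg : 0 ≤ᵐ[volume] fun x => min (w x) 0 ^ 3 * Laplacian.laplacian η x := by
    filter_upwards [hpos, hout] with x hx hxout
    show 0 ≤ min (w x) 0 ^ 3 * Laplacian.laplacian η x
    by_cases hxη : x ∈ tsupport η
    · by_cases hxK : x ∈ K
      · exact mul_nonneg_of_nonpos_of_nonpos
          (Odd.pow_nonpos (by decide) (min_le_right _ _)) (hηK x hxK).le
      · have hxD := hηD hxη
        have h1 := hxout hxD hxK
        have h2 := hx (hDΩ hxD)
        have h3 : χ x * φ x ≤ χ x * u x := mul_le_mul_of_nonneg_left h1 (hχ01 x).1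
        have h4 : χ x * u x ≤ 1 * u x := mul_le_mul_of_nonneg_right (hχ01 x).2 h2.le
        have h5 : 0 ≤ w x := by
          show 0 ≤ K₁.indicator u x - χ x * φ x
          rw [indicator_of_mem (hηK₁' x hxη)]
          linarith
        simp [min_eq_right h5]
    · simp [laplacian_eq_zero_of_notMem_tsupport hxη]
  have hint : Integrable (fun x => min (w x) 0 ^ 3 * Laplacian.laplacian η x) := by
    refine (hη.continuous_laplacian.integrable_of_hasCompactSupport hηc.laplacian).bdd_mul
      (c := |B| ^ 3) ((hw.aestronglyMeasurable.inf aestronglyMeasurable_const).pow 3) ?_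
    filter_upwards [hwB] with x hx
    rw [norm_pow]
    refine pow_le_pow_left₀ (norm_nonneg _) ?_ 3
    rw [Real.norm_eq_abs, abs_of_nonpos (min_le_right _ _), neg_le]
    exact le_min ((neg_le_neg (le_abs_self B)).trans hx) (by simp)
  -- The integrand is nonnegative because `(min w 0)³ ≤ 0` vanishes off `K`, within the support of
  -- `η`, and `Δη < 0` on `K`. The truncated inequality makes its integral nonpositive, so it
  -- vanishes a.e.
  have hzero := (integral_eq_zero_iff_of_nonneg_ae hnonneg hint).1
    (le_antisymm (by linarith) (integral_nonneg_of_ae hnonneg))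
  filter_upwards [hzero, hout] with x hx hxout hxD
  by_cases hxK : x ∈ K
  · have h1 : min (w x) 0 ^ 3 = 0 := (mul_eq_zero.1 hx).resolve_right (hηK x hxK).ne
    have h2 : 0 ≤ w x := min_eq_right_iff.1 (pow_eq_zero_iff (by norm_num) |>.1 h1)
    have hxη : x ∈ tsupport η := by
      by_contra h
      exact (hηK x hxK).ne (laplacian_eq_zero_of_notMem_tsupport h)
    have hxw : w x = u x - χ x * φ x := by
      show K₁.indicator u x - _ = _
      rw [indicator_of_mem (hηK₁' x hxη)]
    rw [hχ1.self_of_nhdsSet x hxK] at hxw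
    linarith
  · exact hxout hxD hxK

/-! ### A weighted mean-value inequality and local lower bounds for weak supersolutions. -/

theorem partialDeriv_comp_add_smul {n : ℕ} {w : Eucl n → ℝ} (hw : Differentiable ℝ w) (i : Fin n)
    (y : Eucl n) (R : ℝ) (z : Eucl n) :
    partialDeriv i (fun z => w (y + R • z)) z = R * partialDeriv i w (y + R • z) := by
  have h1 : HasFDerivAt (fun z : Eucl n => w (y + R • z)) _ z :=
    (hw (y + R • z)).hasFDerivAt.comp z (((hasFDerivAt_id z).const_smul R).const_add y)
  rw [partialDeriv, h1.fderiv]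
  simp [partialDeriv]

theorem laplacian_comp_add_smul {n : ℕ} {w : Eucl n → ℝ} (hw : ContDiff ℝ 2 w) (y : Eucl n)
    (R : ℝ) (z : Eucl n) :
    Laplacian.laplacian (fun z => w (y + R • z)) z =
      R ^ 2 * Laplacian.laplacian w (y + R • z) := by
  have h0 : ContDiff ℝ 2 (fun z => w (y + R • z)) :=
    hw.comp (contDiff_const.add (contDiff_id.const_smul R))
  rw [laplacian_eq_sum_partialDeriv h0.contDiffAt, laplacian_eq_sum_partialDeriv hw.contDiffAt,
    Finset.mul_sum]
  refine Finset.sum_congr rfl fun i _ => ?_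
  have h2 : ContDiff ℝ 1 (fun y => R * partialDeriv i w y) :=
    contDiff_const.mul (hw.partialDeriv (by norm_num) i)
  rw [funext fun z => partialDeriv_comp_add_smul (hw.differentiable (by norm_num)) i y R z,
    partialDeriv_comp_add_smul (w := fun x => R * partialDeriv i w x)
      (h2.differentiable (by norm_num)), partialDeriv,
    fderiv_const_mul ((hw.partialDeriv (m := 1) (by norm_num) i).differentiable (by norm_num) _)]
  simp [partialDeriv]
  ring

/-- The weight `((1 - |z|²)₊)²`. -/
noncomputable def quadraticWeight {n : ℕ} (z : Eucl n) : ℝ := min (‖z‖ ^ 2 - 1) 0 ^ 2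

theorem continuous_quadraticWeight {n : ℕ} : Continuous (quadraticWeight (n := n)) := by
  unfold quadraticWeight
  fun_prop

theorem hasCompactSupport_min_normSq_pow {n k : ℕ} (hk : k ≠ 0) :
    HasCompactSupport (fun z : Eucl n => min (‖z‖ ^ 2 - 1) 0 ^ k) := by
  refine HasCompactSupport.intro (isCompact_closedBall 0 1) fun z hz => ?_
  rw [mem_closedBall_zero_iff, not_le] at hz
  rw [min_eq_right (by nlinarith), zero_pow hk]

theorem hasCompactSupport_quadraticWeight {n : ℕ} : HasCompactSupport (quadraticWeight (n := n)) :=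
  hasCompactSupport_min_normSq_pow two_ne_zero

theorem quadraticWeight_nonneg {n : ℕ} (z : Eucl n) : 0 ≤ quadraticWeight z := sq_nonneg _

theorem integral_quadraticWeight_pos {n : ℕ} : 0 < ∫ z : Eucl n, quadraticWeight z :=
  continuous_quadraticWeight.integral_pos_of_hasCompactSupport_nonneg_nonzero
    hasCompactSupport_quadraticWeight quadraticWeight_nonneg
    (x := 0) (by simp [quadraticWeight])

/-- The weighted radial derivative of a `C²` function in terms of its Laplacian. -/
theorem integral_fderiv_mul_quadraticWeight {n : ℕ} {w : Eucl n → ℝ} (hw : ContDiff ℝ 2 w)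
    (y : Eucl n) (R : ℝ) :
    R * ∫ z, fderiv ℝ w (y + R • z) z * quadraticWeight z =
      R ^ 2 * ∫ z, Laplacian.laplacian w (y + R • z) * (-min (‖z‖ ^ 2 - 1) 0 ^ 3 / 6) := by
  have hG : ContDiff ℝ 2 (fun z => w (y + R • z)) :=
    hw.comp (contDiff_const.add (contDiff_id.const_smul R))
  -- This kernel is nonnegative with gradient `-z` times the weight, so Green's identity turns the
  -- weighted radial derivative into an integral of the Laplacian.
  have hκ : ContDiff ℝ 1 (fun z : Eucl n => -min (‖z‖ ^ 2 - 1) 0 ^ 3 / 6) :=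
    (((contDiff_min_zero_pow_three.of_le (by norm_num)).comp
      ((contDiff_norm_sq ℝ).sub contDiff_const)).neg).div_const 6
  have hκc : HasCompactSupport (fun z : Eucl n => -min (‖z‖ ^ 2 - 1) 0 ^ 3 / 6) := by
    refine (hasCompactSupport_min_normSq_pow (n := n) three_ne_zero).mono fun z hz hz' => hz ?_
    simp only [hz', neg_zero, zero_div]
  have h1 := integral_sum_partialDeriv_mul hG hκ hκc
  have h2 : ∀ (i : Fin n) (z : Eucl n),
      partialDeriv i (fun z : Eucl n => -min (‖z‖ ^ 2 - 1) 0 ^ 3 / 6) z =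
        -(z i * quadraticWeight z) := by
    intro i z
    have h3 : HasFDerivAt (fun z : Eucl n => ‖z‖ ^ 2 - 1) _ z :=
      ((hasStrictFDerivAt_norm_sq z).hasFDerivAt).sub_const 1
    have h4 := (hasDerivAt_min_zero_pow (k := 1) (‖z‖ ^ 2 - 1)).comp_hasFDerivAt z h3
    have h5 : HasFDerivAt (fun z : Eucl n => -min (‖z‖ ^ 2 - 1) 0 ^ 3 / 6) _ z :=
      (h4.neg).mul_const (6⁻¹ : ℝ)
    rw [partialDeriv, h5.fderiv, quadraticWeight]
    simp [EuclideanSpace.inner_single_right]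
    ring
  have h3 : ∀ z : Eucl n, fderiv ℝ w (y + R • z) z =
      ∑ i, z i * partialDeriv i w (y + R • z) := fun z =>
    ContinuousLinearMap.apply_eq_sum_single _ z
  have h4 : ∀ z, ∑ i, partialDeriv i (fun z => w (y + R • z)) z *
      partialDeriv i (fun z : Eucl n => -min (‖z‖ ^ 2 - 1) 0 ^ 3 / 6) z =
      -(R * (fderiv ℝ w (y + R • z) z * quadraticWeight z)) := by
    intro z
    rw [h3, Finset.sum_mul, Finset.mul_sum, ← Finset.sum_neg_distrib]
    refine Finset.sum_congr rfl fun i _ => ?_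
    rw [h2, partialDeriv_comp_add_smul (hw.differentiable (by norm_num))]
    ring
  simp only [h4, laplacian_comp_add_smul hw, mul_assoc] at h1
  rw [integral_neg, neg_inj, integral_const_mul, integral_const_mul] at h1
  exact h1

theorem hasDerivAt_integral_quadraticWeight {n : ℕ} {w : Eucl n → ℝ} (hw : ContDiff ℝ 2 w)
    (hwc : HasCompactSupport w) (y : Eucl n) (R : ℝ) :
    HasDerivAt (fun R : ℝ => ∫ z, w (y + R • z) * quadraticWeight z)
      (∫ z, fderiv ℝ w (y + R • z) z * quadraticWeight z) R := by
  have hcw := hw.continuous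
  have hcf : Continuous (fderiv ℝ w) := hw.continuous_fderiv (by norm_num)
  have hcq := continuous_quadraticWeight (n := n)
  obtain ⟨C, hC⟩ := (hwc.fderiv ℝ).exists_bound_of_continuous hcf
  have hint : ∀ v : Eucl n → ℝ, Continuous v → Integrable (fun z => v z * quadraticWeight z) :=
    fun v hv => integrable_mul_of_hasCompactSupport hv hcq hasCompactSupport_quadraticWeight
  refine (hasDerivAt_integral_of_dominated_loc_of_deriv_le (s := univ) (Filter.univ_mem)
    (F := fun R z => w (y + R • z) * quadraticWeight z)
    (F' := fun R z => fderiv ℝ w (y + R • z) z * quadraticWeight z)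
    (bound := fun z => C * ‖z‖ * quadraticWeight z) ?_ ?_ ?_ ?_ ?_ ?_).2
  · exact Eventually.of_forall fun R =>
      (hint (fun z => w (y + R • z)) (by fun_prop)).aestronglyMeasurable
  · exact hint (fun z => w (y + R • z)) (by fun_prop)
  · exact (hint (fun z => fderiv ℝ w (y + R • z) z) (by fun_prop)).aestronglyMeasurable
  · refine Eventually.of_forall fun z R _ => ?_
    rw [norm_mul, Real.norm_of_nonneg (quadraticWeight_nonneg z)]
    exact mul_le_mul_of_nonneg_right (((fderiv ℝ w (y + R • z)).le_opNorm z).trans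
      (mul_le_mul_of_nonneg_right (hC _) (norm_nonneg _))) (quadraticWeight_nonneg z)
  · exact hint (fun z => C * ‖z‖) (by fun_prop)
  · refine Eventually.of_forall fun z R _ => HasDerivAt.mul_const ?_ _
    have h1 : HasDerivAt (fun R : ℝ => y + R • z) z R := by
      simpa using ((hasDerivAt_id R).smul_const z).const_add y
    exact (hw.differentiable (by norm_num) _).hasFDerivAt.comp_hasDerivAt R h1

/-- A weighted super-mean-value inequality. -/
theorem integral_comp_le_of_laplacian_nonpos {n : ℕ} {w : Eucl n → ℝ} (hw : ContDiff ℝ 2 w)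
    (hwc : HasCompactSupport w) {y : Eucl n} {R : ℝ} (hR : 0 ≤ R)
    (hΔ : ∀ x ∈ Metric.closedBall y R, Laplacian.laplacian w x ≤ 0) :
    ∫ z, w (y + R • z) * quadraticWeight z ≤ w y * ∫ z : Eucl n, quadraticWeight z := by
  have h1 := hasDerivAt_integral_quadraticWeight hw hwc y
  have h2 : AntitoneOn (fun R : ℝ => ∫ z, w (y + R • z) * quadraticWeight z) (Icc 0 R) := by
    refine antitoneOn_of_deriv_nonpos (convex_Icc _ _)
      (fun t _ => (h1 t).continuousAt.continuousWithinAt)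
      (fun t _ => (h1 t).differentiableAt.differentiableWithinAt) fun t ht => ?_
    rw [interior_Icc] at ht
    rw [(h1 t).deriv]
    refine nonpos_of_mul_nonpos_right ?_ ht.1
    rw [integral_fderiv_mul_quadraticWeight hw]
    refine mul_nonpos_of_nonneg_of_nonpos (sq_nonneg _) (integral_nonpos fun z => ?_)
    have h3 : min (‖z‖ ^ 2 - 1) 0 ^ 3 ≤ 0 := Odd.pow_nonpos (by decide) (min_le_right _ _)
    by_cases hz : ‖z‖ ≤ 1
    · refine mul_nonpos_of_nonpos_of_nonneg (hΔ _ ?_) (by linarith)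
      rw [mem_closedBall_iff_norm, add_sub_cancel_left, norm_smul, Real.norm_of_nonneg ht.1.le]
      nlinarith [ht.1, ht.2]
    · rw [min_eq_right (by nlinarith)]
      simp
  have h3 := h2 ⟨le_rfl, hR⟩ ⟨hR, le_rfl⟩ hR
  simpa [integral_const_mul] using h3

/-- The mean-value inequality at `y` with radius `3d` stays inside the ball of radius `4d` about
`p`. Points of the `d`-ball lie within `2d` of `y`, where the weight is at least `(1 - 4/9)² =
25/81`; the factor `(3d)⁻ⁿ` is the Jacobian. -/
theorem exists_mul_setIntegral_le {n : ℕ} {d : ℝ} (hd : 0 < d) :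
    ∃ c > 0, ∀ (p : Eucl n) (w : Eucl n → ℝ), ContDiff ℝ 2 w → HasCompactSupport w →
      (∀ x, 0 ≤ w x) → (∀ x ∈ Metric.closedBall p (4 * d), Laplacian.laplacian w x ≤ 0) →
      ∀ y ∈ Metric.closedBall p d, c * ∫ x in Metric.closedBall p d, w x ≤ w y := by
  set I := ∫ z : Eucl n, quadraticWeight z
  have hI : 0 < I := integral_quadraticWeight_pos
  set A : ℝ := ((3 * d) ^ n)⁻¹
  have hA : 0 < A := by positivity
  refine ⟨A * (25 / 81) / I, by positivity, fun p w hw hwc hw0 hΔ y hy => ?_⟩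
  have hR : 0 < 3 * d := by positivity
  have h1 := integral_comp_le_of_laplacian_nonpos hw hwc hR.le (y := y) fun x hx => hΔ x ?_
  · have h2 : ∫ z, w (y + (3 * d) • z) * quadraticWeight z =
        A * ∫ x, w x * quadraticWeight ((3 * d)⁻¹ • (x - y)) := by
      have h3 := Measure.integral_comp_smul (volume : Measure (Eucl n))
        (fun z => w (y + z) * quadraticWeight ((3 * d)⁻¹ • z)) (3 * d)
      simp only [smul_smul, inv_mul_cancel₀ hR.ne', one_smul] at h3
      rw [h3, finrank_euclideanSpace_fin, abs_of_pos hA, smul_eq_mul,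
        ← integral_add_left_eq_self (fun x => w x * quadraticWeight ((3 * d)⁻¹ • (x - y))) y]
      simp
    have hint : Integrable (fun x => w x * quadraticWeight ((3 * d)⁻¹ • (x - y))) := by
      have hc := continuous_quadraticWeight (n := n)
      have := hw.continuous
      exact Continuous.integrable_of_hasCompactSupport (by fun_prop) hwc.mul_right
    have h4 : (25 / 81) * ∫ x in Metric.closedBall p d, w x ≤
        ∫ x, w x * quadraticWeight ((3 * d)⁻¹ • (x - y)) := by
      rw [← integral_const_mul]
      refine le_trans (setIntegral_mono_on ?_ hint.integrableOn Metric.isClosed_closedBall.measurableSet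
        fun x hx => ?_) (setIntegral_le_integral hint (Eventually.of_forall fun x =>
          mul_nonneg (hw0 x) (quadraticWeight_nonneg _)))
      · exact ((hw.continuous.integrable_of_hasCompactSupport hwc).const_mul _).integrableOn
      · rw [mul_comm]
        refine mul_le_mul_of_nonneg_left ?_ (hw0 x)
        have h5 : ‖x - y‖ ≤ 2 * d := by
          rw [← dist_eq_norm]
          have := dist_triangle_right x y p
          rw [Metric.mem_closedBall] at hx hy
          linarith
        have h6 : ‖(3 * d)⁻¹ • (x - y)‖ ≤ 2 / 3 := by
          rw [norm_smul, Real.norm_of_nonneg (by positivity), inv_mul_le_iff₀ hR]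
          linarith
        have h7 : ‖(3 * d)⁻¹ • (x - y)‖ ^ 2 ≤ 4 / 9 := by
          nlinarith [norm_nonneg ((3 * d)⁻¹ • (x - y))]
        rw [quadraticWeight, min_eq_left (by linarith)]
        nlinarith
    rw [h2] at h1
    rw [div_mul_eq_mul_div, div_le_iff₀ hI, mul_assoc]
    exact (mul_le_mul_of_nonneg_left h4 hA.le).trans h1
  · rw [Metric.mem_closedBall] at hx hy ⊢
    linarith [dist_triangle x y p]

/-- Mollifications of `u` at scale at most `d` are superharmonic on the ball of radius `4d`, whence
the radius `5d`. The mean-value bound is uniform in the mollification parameter and passes to the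
limit. -/
theorem IsWeakSupersolution.exists_pos_le_closedBall {n : ℕ} {Ω : Set (Eucl n)}
    {f : ℝ → Eucl n → ℝ} {u : Eucl n → ℝ} (hΩ : IsOpen Ω) (hu : IsWeakSupersolution Ω f u)
    (hpos : ∀ᵐ x ∂(volume.restrict Ω), 0 < u x) (hf : ∀ s, 0 < s → ∀ x ∈ Ω, 0 < f s x)
    {p : Eucl n} {d : ℝ} (hd : 0 < d) (hp : Metric.closedBall p (5 * d) ⊆ Ω) :
    ∃ c > 0, ∀ᵐ x, x ∈ Metric.closedBall p d → c ≤ u x := by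
  set K := Metric.closedBall p (5 * d)
  have hK : IsCompact K := isCompact_closedBall _ _
  have hsub : Metric.closedBall p d ⊆ K := Metric.closedBall_subset_closedBall (by linarith)
  -- Truncation level 0 and `ψ = 0` retain only superharmonicity.
  have H := hu.distribLeNegLaplacian hΩ hpos hf hK hp (contDiff_const (c := (0 : ℝ))) le_rfl
  simp only [sub_zero] at H
  rw [ae_restrict_iff' hΩ.measurableSet] at hpos
  set U := K.indicator u
  have hU : LocallyIntegrable U :=
    ((hu.integrableOn hK hp).integrable_indicator hK.measurableSet).locallyIntegrable
  have hU0 : ∀ᵐ x, 0 ≤ U x := by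
    filter_upwards [hpos] with x hx
    exact indicator_apply_nonneg fun h => (hx (hp h)).le
  have hUpos : ∀ᵐ x, x ∈ Metric.closedBall p d → 0 < U x := by
    filter_upwards [hpos] with x hx hxd
    exact (hx (hp (hsub hxd))).trans_eq (indicator_of_mem (hsub hxd) _).symm
  obtain ⟨b, hb, hlim⟩ := exists_contDiffBump_seq (n := n) hd
  obtain ⟨c, hc, hmean⟩ := exists_mul_setIntegral_le (n := n) hd
  have hw : ∀ k, ContDiff ℝ 2 (mollify (b k) U) := fun k => (contDiff_mollify _ hU).two_of_infty
  have hΔ : ∀ k, ∀ x ∈ Metric.closedBall p (4 * d), Laplacian.laplacian (mollify (b k) U) x ≤ 0 := by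
    intro k x hx
    have h1 := H.mollify_le hU (b k) (x := x) ?_
    · refine neg_nonneg.1 (le_trans ?_ h1)
      rw [mollify_apply]
      refine integral_nonneg_of_ae ?_
      filter_upwards [hpos] with t ht
      refine mul_nonneg ((b k).nonneg_normed _) ?_
      rw [laplacian_eq_zero_of_notMem_tsupport (by simp [tsupport]), add_zero]
      exact indicator_apply_nonneg fun h => le_min (hf _ (ht (hp h)) _ (hp h)).le le_rfl
    · refine Metric.closedBall_subset_closedBall' ?_
      rw [Metric.mem_closedBall] at hx
      linarith [hb k]
  have hUc : HasCompactSupport U := HasCompactSupport.intro hK fun x hx => indicator_of_notMem hx _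
  -- Capping at 1 supplies the dominating function for the limit, and the limiting integral is still
  -- positive.
  have hstep : ∀ k, ∀ y ∈ Metric.closedBall p d,
      c * ∫ x in Metric.closedBall p d, min (mollify (b k) U x) 1 ≤ mollify (b k) U y := by
    intro k y hy
    have hcw := (hw k).continuous
    refine le_trans (mul_le_mul_of_nonneg_left ?_ hc.le)
      (hmean p _ (hw k) (HasCompactSupport.convolution _ (b k).hasCompactSupport_normed hUc)
        (fun x => le_mollify _ hU hU0 x) (hΔ k) y hy)
    exact setIntegral_mono_on
      ((hcw.min continuous_const).continuousOn.integrableOn_compact (isCompact_closedBall _ _))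
      (hcw.continuousOn.integrableOn_compact (isCompact_closedBall _ _))
      Metric.isClosed_closedBall.measurableSet fun x _ => min_le_left _ _
  have hfin : IsFiniteMeasure (volume.restrict (Metric.closedBall p d)) :=
    ⟨by simpa using (isCompact_closedBall p d).measure_lt_top⟩
  have hI : Tendsto (fun k => ∫ x in Metric.closedBall p d, min (mollify (b k) U x) 1) atTop
      (𝓝 (∫ x in Metric.closedBall p d, min (U x) 1)) := by
    refine tendsto_integral_of_dominated_convergence (fun _ => 1)
      (fun k => ((hw k).continuous.min continuous_const).aestronglyMeasurable)
      (integrable_const _) (fun k => Eventually.of_forall fun x => ?_) ?_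
    · rw [Real.norm_of_nonneg (le_min (le_mollify _ hU hU0 x) zero_le_one)]
      exact min_le_right _ _
    · filter_upwards [ae_restrict_of_ae (hlim U hU)] with x hx
      exact hx.min tendsto_const_nhds
  have hIpos : 0 < ∫ x in Metric.closedBall p d, min (U x) 1 := by
    have h1 : Integrable (fun x => min (U x) 1) (volume.restrict (Metric.closedBall p d)) := by
      refine Integrable.of_bound (C := 1)
        (hU.aestronglyMeasurable.inf aestronglyMeasurable_const).restrict ?_
      filter_upwards [ae_restrict_of_ae hU0] with x hx
      rw [Real.norm_of_nonneg (le_min hx zero_le_one)]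
      exact min_le_right _ _
    have h2 : ∀ᵐ x ∂(volume.restrict (Metric.closedBall p d)), 0 < min (U x) 1 := by
      rw [ae_restrict_iff' Metric.isClosed_closedBall.measurableSet]
      filter_upwards [hUpos] with x hx hxd
      exact lt_min (hx hxd) one_pos
    refine lt_of_le_of_ne (integral_nonneg_of_ae (h2.mono fun x hx => hx.le)) fun h3 => ?_
    have h4 := (integral_eq_zero_iff_of_nonneg_ae (h2.mono fun x hx => hx.le) h1).1 h3.symm
    have h5 : ∀ᵐ x ∂(volume.restrict (Metric.closedBall p d)), False := by
      filter_upwards [h2, h4] with x hx hx'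
      exact hx.ne' hx'
    rw [eventually_false_iff_eq_bot, ae_eq_bot, Measure.restrict_eq_zero] at h5
    exact (Metric.measure_closedBall_pos volume p hd).ne' h5
  refine ⟨c * ∫ x in Metric.closedBall p d, min (U x) 1, mul_pos hc hIpos, ?_⟩
  filter_upwards [hlim U hU] with x hx hxd
  have h1 : U x = u x := indicator_of_mem (hsub hxd) _
  rw [← h1]
  exact le_of_tendsto_of_tendsto' (hI.const_mul c) hx fun k => hstep k x hxd

/-- Positive weak supersolutions are locally bounded away from zero. -/
theorem IsWeakSupersolution.exists_pos_le {n : ℕ} {Ω K : Set (Eucl n)} {f : ℝ → Eucl n → ℝ}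
    {u : Eucl n → ℝ} (hΩ : IsOpen Ω) (hu : IsWeakSupersolution Ω f u)
    (hpos : ∀ᵐ x ∂(volume.restrict Ω), 0 < u x) (hf : ∀ s, 0 < s → ∀ x ∈ Ω, 0 < f s x)
    (hK : IsCompact K) (hKΩ : K ⊆ Ω) : ∃ c > 0, ∀ᵐ x, x ∈ K → c ≤ u x := by
  refine hK.induction_on (p := fun S => ∃ c > 0, ∀ᵐ x, x ∈ S → c ≤ u x) ⟨1, one_pos, by simp⟩
    ?_ ?_ ?_
  · rintro S T hST ⟨c, hc, h⟩
    exact ⟨c, hc, h.mono fun x hx hxS => hx (hST hxS)⟩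
  · rintro S T ⟨c, hc, h⟩ ⟨c', hc', h'⟩
    refine ⟨min c c', lt_min hc hc', ?_⟩
    filter_upwards [h, h'] with x hx hx' hxST
    exact hxST.elim (fun h => (min_le_left _ _).trans (hx h))
      fun h => (min_le_right _ _).trans (hx' h)
  · intro p hp
    obtain ⟨ε, hε, hball⟩ := Metric.nhds_basis_closedBall.mem_iff.1 (hΩ.mem_nhds (hKΩ hp))
    have hd : 0 < ε / 5 := by positivity
    exact ⟨Metric.closedBall p (ε / 5), mem_nhdsWithin_of_mem_nhds (Metric.closedBall_mem_nhds p hd),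
      hu.exists_pos_le_closedBall hΩ hpos hf hd (by rwa [mul_div_cancel₀ ε (by norm_num)])⟩

theorem corollary5p4 (n : ℕ) (hn : 2 ≤ n) (γ : ℝ) (hγ : γ < 2) (r₀ : ℝ) (hr₀ : 0 < r₀)
    (g : ℝ → ℝ) (hg_cont : ContinuousOn g (Ioi 0)) (hg_pos : ∀ s, 0 < s → 0 < g s)
    (hg_zero : (0 : EReal) <
      liminf (fun s : ℝ => ((s ^ (-(((n : ℝ) + 1 - γ) / ((n : ℝ) - 1))) * g s : ℝ) : EReal))
        (𝓝[>] 0))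
    (hg_top : (0 : EReal) <
      liminf (fun s : ℝ => ((s ^ (1 - γ) * g s : ℝ) : EReal)) atTop)
    (Ω : Set (EuclideanSpace ℝ (Fin n)))
    (hΩ : Ω = upperHalfSpace n \ Metric.closedBall 0 r₀)
    (f : ℝ → EuclideanSpace ℝ (Fin n) → ℝ)
    (hf : f = fun s x => ‖x‖ ^ (-γ) * g s) :
    (¬ ∃ u : EuclideanSpace ℝ (Fin n) → ℝ,
      (∀ x ∈ Ω, 0 < u x) ∧ IsClassicalSupersolution Ω f u) ∧
    (¬ ∃ u : EuclideanSpace ℝ (Fin n) → ℝ,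
      (∀ᵐ x ∂(volume.restrict Ω), 0 < u x) ∧ IsWeakSupersolution Ω f u) ∧
    (¬ ∃ u : EuclideanSpace ℝ (Fin n) → ℝ,
      (∀ x ∈ Ω, 0 < u x) ∧ IsViscositySupersolution Ω f u) := by
  obtain ⟨c, hc, hg0, hg1⟩ := exists_critical_lower_bound hg_cont hg_pos hg_zero hg_top
  have hopen : IsOpen Ω := hΩ ▸ isOpen_upperHalfSpace_diff hn r₀
  have hvisc : ¬ ∃ u : EuclideanSpace ℝ (Fin n) → ℝ,
      (∀ x ∈ Ω, 0 < u x) ∧ IsViscositySupersolution Ω f u := by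
    rintro ⟨u, hpos, hu⟩
    subst hΩ hf
    have : CountableInterFilter (⊤ : Filter (Eucl n)) := by
      rw [← principal_univ]; infer_instance
    refine false_of_comparisonOn hn hγ hr₀ hc hg_pos hg0 hg1 (ℱ := ⊤) (u := u)
      (Eventually.of_forall hpos) (fun K hK hKΩ => ?_)
      (fun D hD hDΩ => hu.comparisonOn hD hDΩ) fun U hU hUne hUsub => ?_
    · obtain ⟨c, hc, h⟩ := LowerSemicontinuousOn.exists_pos_le
        (fun y hy => (hu.lowerSemicontinuousOn y (hKΩ hy)).mono hKΩ) hK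
        fun x hx => hpos x (hKΩ hx)
      exact ⟨c, hc, Eventually.of_forall h⟩
    · exact frequently_top.2 hUne
  refine ⟨?_, ?_, hvisc⟩
  · rintro ⟨u, hpos, hu⟩
    exact hvisc ⟨u, hpos, hu.isViscositySupersolution hopen⟩
  · rintro ⟨u, hpos, hu⟩
    have hfpos : ∀ s, 0 < s → ∀ x ∈ Ω, 0 < f s x := by
      intro s hs x hx
      rw [hΩ] at hx
      have : r₀ < ‖x‖ := by simpa using hx.2
      rw [hf]
      exact mul_pos (Real.rpow_pos_of_pos (hr₀.trans this) _) (hg_pos s hs)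
    have hcomp : ∀ D, IsOpen D → D ⊆ Ω → ComparisonOn (ae volume) D f u := fun D hD hDΩ =>
      hu.comparisonOn (by omega) hopen hpos hfpos hD hDΩ
    have hlow : ∀ K, IsCompact K → K ⊆ Ω → ∃ c > 0, ∀ᶠ x in ae volume, x ∈ K → c ≤ u x :=
      fun K hK hKΩ => hu.exists_pos_le hopen hpos hfpos hK hKΩ
    rw [ae_restrict_iff' hopen.measurableSet] at hpos
    subst hΩ hf
    refine false_of_comparisonOn hn hγ hr₀ hc hg_pos hg0 hg1 (ℱ := ae volume) (u := u)
      hpos hlow hcomp fun U hU hUne _ => ?_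
    exact frequently_ae_mem_iff.2 (hU.measure_pos volume hUne).ne'
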